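/- Let $k$ be an algebraically closed field. For a Hopf algebra $A$ over $k$ let $\mathcal{YD}_A^A$ be the $k$-linear abelian category of right-right Yetter-Drinfeld modules over $A$: right $A$-modules and right $A$-comodules $V$ with $$(v\cdot a)_{(0)}\otimes (v\cdot a)_{(1)} = v_{(0)}\cdot a_{(2)}\otimes S(a_{(1)})v_{(1)}a_{(3)}\qquad (v\in V,\ a\in A),$$ with the $A$-linear and $A$-colinear maps as morphisms and the usual tensor product of modules and comodules. For $V\in\mathcal{YD}_A^A$ put $H^n_{\rm GS}(A,V)=\mathrm{Ext}^n_{\mathcal{YD}_A^A}(k,V)$, where $k$ is the trivial Yetter-Drinfeld module, and $H^n_b(A)=H^n_{\rm GS}(A,k)$. Let $\Gamma$ be a finite abelian group with $|\Gamma|\neq 0$ in $k$, and let $$k\to B\overset{i}{\to} A\overset{p}{\to} k\Gamma\to k$$ be a cocentral exact sequence of Hopf algebras. That is, $i$ and $p$ are Hopf algebra maps such that $i$ is injective and $p$ is surjective; $\mathrm{Ker}(p)=A\,i(B)^+=i(B)^+A$, where $i(B)^+=i(B)\cap\mathrm{Ker}(\varepsilon)$; $i(B)=\{a\in A : a_{(1)}\otimes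 p(a_{(2)})=a\otimes 1\}=\{a\in A : p(a_{(1)})\otimes a_{(2)}=1\otimes a\}$; and $p(a_{(1)})\otimes a_{(2)}=p(a_{(2)})\otimes a_{(1)}$ for all $a\in A$. For $X\in\mathcal{YD}_A^A$ let $X^{(B)}=\{x\in X : x_{(0)}\otimes x_{(1)}\in X\otimes i(B)\}$, a Yetter-Drinfeld module over $B$ with the action and coaction induced by those of $X$. For a character $\psi\in\widehat\Gamma=\mathrm{Hom}(\Gamma,k^*)$ let $k_\psi\in\mathcal{YD}_A^A$ be the space $k$ with the trivial $A$-comodule structure and with the $A$-module structure given by the algebra map $\psi\circ p: A\to k$, where $\psi$ is extended linearly to $k\Gamma$. Then for every $X\in\mathcal{YD}_A^A$ and every $n\geq 0$ there is an isomorphism of $k$-vector spaces $$H^n_{\rm GS}(B,X^{(B)})\simeq\bigoplus_{\psi\in\widehat\Gamma}H^n_{\rm GS}(A,X\otimes k_\psi),$$ and in particular, for every $n\geq 0$, $$H^n_b(B)\simeq\bigoplus_{\psi\in\widehat\Gamma}H^n_{\rm GS}(A,k_\psi).$$ -/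

import Mathlib

open CategoryTheory TensorProduct

universe u

namespace YD

section Action

variable {k A V W : Type*} [Field k] [Ring A]
  [AddCommGroup V] [Module k V] [AddCommGroup W] [Module k W]

/-- For a right action `act v a = v · a` of `A` on `V`, the linear map
`a ⊗ b ↦ (v ⊗ c ↦ v · a ⊗ c b)`. -/
noncomputable def diagAct [Algebra k A] (act : V →ₗ[k] A →ₗ[k] V) :
    A ⊗[k] A →ₗ[k] Module.End k (V ⊗[k] A) :=
  TensorProduct.homTensorHomMap (RingHom.id k) V A V A ∘ₗ
    TensorProduct.map act.flip (LinearMap.mul k A).flip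

@[simp] lemma diagAct_tmul [Algebra k A] (act : V →ₗ[k] A →ₗ[k] V) (a b c : A) (v : V) :
    diagAct act (a ⊗ₜ b) (v ⊗ₜ c) = act v a ⊗ₜ (c * b) := rfl

/-- The linear map `a ↦ (v ⊗ c ↦ v ⊗ a c)`. -/
noncomputable def leftMul (k A V : Type*) [Field k] [Ring A] [Algebra k A]
    [AddCommGroup V] [Module k V] : A →ₗ[k] Module.End k (V ⊗[k] A) :=
  LinearMap.lTensorHom V ∘ₗ LinearMap.mul k A

@[simp] lemma leftMul_tmul [Algebra k A] (a c : A) (v : V) :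
    leftMul k A V a (v ⊗ₜ c) = v ⊗ₜ (a * c) := rfl

lemma leftMul_mul [Algebra k A] (a b : A) (t : V ⊗[k] A) :
    leftMul k A V (a * b) t = leftMul k A V a (leftMul k A V b t) := by
  induction t with
  | zero => simp
  | add x y hx hy => simp [hx, hy]
  | tmul v c => simp [mul_assoc]

lemma leftMul_one [Algebra k A] (t : V ⊗[k] A) :
    leftMul k A V 1 t = t := by
  induction t with
  | zero => simp
  | add x y hx hy => simp [hx, hy]
  | tmul v c => simp

/-- The iterated comultiplication `a ↦ a₁ ⊗ (a₂ ⊗ a₃)`. -/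
noncomputable def comul₃ (k : Type*) {A : Type*} [Field k] [Ring A] [Bialgebra k A] :
    A →ₗ[k] A ⊗[k] (A ⊗[k] A) :=
  (Coalgebra.comul (R := k) (A := A)).lTensor A ∘ₗ Coalgebra.comul

/-- The linear map `a ⊗ (b ⊗ c) ↦ (v ⊗ d ↦ v · b ⊗ S(a) d c)`; see `twist_tmul`. -/
noncomputable def twist [HopfAlgebra k A] (act : V →ₗ[k] A →ₗ[k] V) :
    A ⊗[k] (A ⊗[k] A) →ₗ[k] Module.End k (V ⊗[k] A) :=
  LinearMap.mul' k (Module.End k (V ⊗[k] A)) ∘ₗ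
    TensorProduct.map (leftMul k A V ∘ₗ HopfAlgebra.antipode k) (diagAct act)

@[simp] lemma twist_tmul [HopfAlgebra k A] (act : V →ₗ[k] A →ₗ[k] V) (a b c d : A) (v : V) :
    twist act (a ⊗ₜ (b ⊗ₜ c)) (v ⊗ₜ d) = act v b ⊗ₜ (HopfAlgebra.antipode k a * d * c) := by
  simp [twist, mul_assoc]

/-- For linear maps `φ : A → End(M)` and `H : A → M`, the linear map
`a ↦ φ(a₁) (H a₂)`. -/
noncomputable def conv [Bialgebra k A] (φ : A →ₗ[k] Module.End k V) (H : A →ₗ[k] V) :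
    A →ₗ[k] V :=
  TensorProduct.lift (φ.compl₂ H) ∘ₗ Coalgebra.comul

lemma conv_repr [Bialgebra k A] (φ : A →ₗ[k] Module.End k V) (H : A →ₗ[k] V) (a : A)
    {ι : Type*} (r : Coalgebra.Repr k a ι) :
    conv φ H a = ∑ i ∈ r.index, φ (r.left i) (H (r.right i)) := by
  simp [conv, ← r.eq]

lemma conv_zero [Bialgebra k A] (φ : A →ₗ[k] Module.End k V) :
    conv φ (0 : A →ₗ[k] V) = 0 := by
  ext a
  rw [conv_repr _ _ a (Coalgebra.Repr.arbitrary k a)]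
  simp

lemma conv_add [Bialgebra k A] (φ : A →ₗ[k] Module.End k V) (H K : A →ₗ[k] V) :
    conv φ (H + K) = conv φ H + conv φ K := by
  ext a
  simp only [LinearMap.add_apply, conv_repr _ _ a (Coalgebra.Repr.arbitrary k a), map_add,
    Finset.sum_add_distrib]

lemma conv_conv [Bialgebra k A] (φ χ : A →ₗ[k] Module.End k V) (H : A →ₗ[k] V) :
    conv φ (conv χ H) =
      conv (LinearMap.mul' k _ ∘ₗ TensorProduct.map φ χ ∘ₗ Coalgebra.comul) H := by
  ext a
  have h := Coalgebra.coassoc_apply (R := k) a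
  let T : A ⊗[k] (A ⊗[k] A) →ₗ[k] V :=
    TensorProduct.lift (φ.compl₂ (TensorProduct.lift (χ.compl₂ H)))
  have h1 : ∀ t : A ⊗[k] A, TensorProduct.lift (φ.compl₂ (conv χ H)) t =
      T ((Coalgebra.comul (R := k) (A := A)).lTensor A t) := by
    intro t
    induction t with
    | zero => simp
    | add x y hx hy => simp only [map_add, hx, hy]
    | tmul v c => simp [T, conv]
  have h2 : ∀ t : A ⊗[k] A, TensorProduct.lift (LinearMap.compl₂
      (LinearMap.mul' k _ ∘ₗ TensorProduct.map φ χ ∘ₗ Coalgebra.comul) H) t =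
      T (TensorProduct.assoc k A A A ((Coalgebra.comul (R := k) (A := A)).rTensor A t)) := by
    intro t
    induction t with
    | zero => simp
    | add x y hx hy => simp only [map_add, hx, hy]
    | tmul v c =>
      simp only [TensorProduct.lift.tmul, LinearMap.compl₂_apply, LinearMap.comp_apply,
        LinearMap.rTensor_tmul]
      generalize Coalgebra.comul (R := k) v = s
      induction s with
      | zero => simp
      | add x y hx hy => simp only [map_add, add_tmul, hx, hy, LinearMap.add_apply]
      | tmul a b => simp [T]
  change TensorProduct.lift _ _ = TensorProduct.lift _ _
  rw [h1, h2, h]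

lemma conv_counit [Bialgebra k A] (H : A →ₗ[k] V) :
    conv (Algebra.linearMap k (Module.End k V) ∘ₗ Coalgebra.counit) H = H := by
  ext a
  rw [conv_repr _ _ a (Coalgebra.Repr.arbitrary k a)]
  simp only [LinearMap.comp_apply, Algebra.linearMap_apply, Module.algebraMap_end_apply,
    ← map_smul, ← map_sum, Coalgebra.sum_counit_smul]

lemma leftMul_conv [Bialgebra k A] (φ χ : A →ₗ[k] A)
    (h : LinearMap.mul' k A ∘ₗ TensorProduct.map φ χ ∘ₗ Coalgebra.comul =
      Algebra.linearMap k A ∘ₗ Coalgebra.counit) :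
    LinearMap.mul' k _ ∘ₗ TensorProduct.map (leftMul k A V ∘ₗ φ) (leftMul k A V ∘ₗ χ) ∘ₗ
      Coalgebra.comul = Algebra.linearMap k (Module.End k (V ⊗[k] A)) ∘ₗ Coalgebra.counit := by
  have h1 : ∀ t : A ⊗[k] A, LinearMap.mul' k _ (TensorProduct.map (leftMul k A V ∘ₗ φ)
      (leftMul k A V ∘ₗ χ) t) = leftMul k A V (LinearMap.mul' k A (TensorProduct.map φ χ t)) := by
    intro t
    induction t with
    | zero => simp
    | add x y hx hy => simp only [map_add, hx, hy]
    | tmul a b =>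
      refine LinearMap.ext fun t => ?_
      simp [leftMul_mul]
  ext a : 1
  have h2 := LinearMap.congr_fun h a
  simp only [LinearMap.comp_apply] at h2 ⊢
  rw [h1, h2]
  refine LinearMap.ext fun t => ?_
  simp [Algebra.algebraMap_eq_smul_one, leftMul_one]

/-- The Yetter-Drinfeld compatibility condition can be written without the antipode. -/
lemma compat_iff [HopfAlgebra k A] (act : V →ₗ[k] A →ₗ[k] V) (F : A →ₗ[k] V ⊗[k] A)
    (t : V ⊗[k] A) :
    (∀ a, F a = twist act (comul₃ k a) t) ↔
      ∀ a, conv (leftMul k A V) F a = diagAct act (Coalgebra.comul (R := k) a) t := by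
  let G : A →ₗ[k] V ⊗[k] A := (diagAct act).flip t ∘ₗ Coalgebra.comul
  have hG : ∀ a, twist act (comul₃ k a) t =
      conv (leftMul k A V ∘ₗ HopfAlgebra.antipode k) G a := by
    intro a
    simp only [comul₃, conv, LinearMap.comp_apply]
    generalize Coalgebra.comul (R := k) a = s
    induction s with
    | zero => simp
    | add x y hx hy => simp only [map_add, hx, hy, LinearMap.add_apply]
    | tmul a b => simp [G, twist]
  have e1 := leftMul_conv (V := V) (HopfAlgebra.antipode k) (LinearMap.id (M := A) (R := k)) (by
    have := HopfAlgebra.mul_antipode_rTensor_comul (R := k) (A := A)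
    rwa [LinearMap.rTensor] at this)
  have e2 := leftMul_conv (V := V) (LinearMap.id (M := A) (R := k)) (HopfAlgebra.antipode k) (by
    have := HopfAlgebra.mul_antipode_lTensor_comul (R := k) (A := A)
    rwa [LinearMap.lTensor] at this)
  simp only [LinearMap.comp_id] at e1 e2
  constructor
  · intro h
    have hF : F = conv (leftMul k A V ∘ₗ HopfAlgebra.antipode k) G := by
      ext a; rw [h, hG]
    intro a
    rw [hF, conv_conv, e2, conv_counit]
    rfl
  · intro h
    have hF : conv (leftMul k A V) F = G := by
      ext a; rw [h]; rfl
    intro a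
    rw [hG, ← hF, conv_conv, e1, conv_counit]

end Action
section Predicate

variable {k : Type*} [Field k] {A B : Type*} [Ring A] [HopfAlgebra k A] [Ring B] [HopfAlgebra k B]
  {V W : Type*} [AddCommGroup V] [Module k V] [AddCommGroup W] [Module k W]

/-- The linear maps `act : V → Hom(A, V)`, `act v a = v · a`, and `coact : V → V ⊗ A`
make `V` a right-right Yetter-Drinfeld module over the Hopf algebra `A`: `V` is a right `A`-module
and a right `A`-comodule, and
`(v · a)₀ ⊗ (v · a)₁ = v₀ · a₂ ⊗ S(a₁) v₁ a₃` for all `v` and `a`. -/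
structure IsYetterDrinfeld (act : V →ₗ[k] A →ₗ[k] V) (coact : V →ₗ[k] V ⊗[k] A) : Prop where
  act_one : ∀ v, act v 1 = v
  act_mul : ∀ v a b, act v (a * b) = act (act v a) b
  coact_counit : ∀ v, TensorProduct.rid k V
    ((Coalgebra.counit (R := k) (A := A)).lTensor V (coact v)) = v
  coact_coassoc : ∀ v, TensorProduct.assoc k V A A (coact.rTensor A (coact v)) =
    (Coalgebra.comul (R := k) (A := A)).lTensor V (coact v)
  coact_act : ∀ v a, coact (act v a) = twist act (comul₃ k a) (coact v)

/-- The compatibility condition in the form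
`v₀ · a₁ ⊗ v₁ a₂ = (v · a₂)₀ ⊗ a₁ (v · a₂)₁`. -/
lemma IsYetterDrinfeld.compat {act : V →ₗ[k] A →ₗ[k] V} {coact : V →ₗ[k] V ⊗[k] A}
    (h : IsYetterDrinfeld act coact) (v : V) (a : A) :
    conv (leftMul k A V) (coact ∘ₗ act v) a =
      diagAct act (Coalgebra.comul (R := k) a) (coact v) :=
  (compat_iff act (coact ∘ₗ act v) (coact v)).1 (fun a => h.coact_act v a) a

lemma IsYetterDrinfeld.of_compat {act : V →ₗ[k] A →ₗ[k] V} {coact : V →ₗ[k] V ⊗[k] A}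
    (h1 : ∀ v, act v 1 = v)
    (h2 : ∀ v a b, act v (a * b) = act (act v a) b)
    (h3 : ∀ v, TensorProduct.rid k V
      ((Coalgebra.counit (R := k) (A := A)).lTensor V (coact v)) = v)
    (h4 : ∀ v, TensorProduct.assoc k V A A (coact.rTensor A (coact v)) =
      (Coalgebra.comul (R := k) (A := A)).lTensor V (coact v))
    (h5 : ∀ v a, conv (leftMul k A V) (coact ∘ₗ act v) a =
      diagAct act (Coalgebra.comul (R := k) a) (coact v)) : IsYetterDrinfeld act coact :=
  ⟨h1, h2, h3, h4, fun v a => (compat_iff act (coact ∘ₗ act v) (coact v)).2 (h5 v) a⟩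

section Transport

variable (i : B →ₐc[k] A) (j : W →ₗ[k] V)
  {actV : V →ₗ[k] A →ₗ[k] V} {coactV : V →ₗ[k] V ⊗[k] A}
  {actW : W →ₗ[k] B →ₗ[k] W} {coactW : W →ₗ[k] W ⊗[k] B}

lemma map_leftMul (b : B) (s : W ⊗[k] B) :
    TensorProduct.map j (i : B →ₗ[k] A) (leftMul k B W b s) =
      leftMul k A V (i b) (TensorProduct.map j (i : B →ₗ[k] A) s) := by
  induction s with
  | zero => simp
  | add x y hx hy => simp only [map_add, hx, hy]
  | tmul v c => simp

lemma map_diagAct (hact : ∀ w b, j (actW w b) = actV (j w) (i b)) (t : B ⊗[k] B) (s : W ⊗[k] B) :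
    TensorProduct.map j (i : B →ₗ[k] A) (diagAct actW t s) =
      diagAct actV (TensorProduct.map (i : B →ₗ[k] A) (i : B →ₗ[k] A) t)
        (TensorProduct.map j (i : B →ₗ[k] A) s) := by
  induction t with
  | zero => simp
  | add x y hx hy => simp only [map_add, LinearMap.add_apply, hx, hy]
  | tmul a b =>
    induction s with
    | zero => simp
    | add x y hx hy => simp only [map_add, hx, hy]
    | tmul v c => simp [hact]

lemma map_conv (F : B →ₗ[k] W ⊗[k] B) (F' : A →ₗ[k] V ⊗[k] A)
    (hF : ∀ b, TensorProduct.map j (i : B →ₗ[k] A) (F b) = F' (i b)) (b : B) :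
    TensorProduct.map j (i : B →ₗ[k] A) (conv (leftMul k B W) F b) =
      conv (leftMul k A V) F' (i b) := by
  have h : Coalgebra.comul (R := k) (i b) = TensorProduct.map (i : B →ₗ[k] A) (i : B →ₗ[k] A)
      (Coalgebra.comul (R := k) b) := (CoalgHomClass.map_comp_comul_apply i b).symm
  simp only [conv, LinearMap.comp_apply, h]
  generalize Coalgebra.comul (R := k) b = t
  induction t with
  | zero => simp
  | add x y hx hy => simp only [map_add, hx, hy]
  | tmul a c => simp [map_leftMul, hF]

lemma map_coassoc_left (hcoact : ∀ w, TensorProduct.map j (i : B →ₗ[k] A) (coactW w) =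
      coactV (j w)) (t : W ⊗[k] B) :
    TensorProduct.map j (TensorProduct.map (i : B →ₗ[k] A) (i : B →ₗ[k] A))
      (TensorProduct.assoc k W B B (coactW.rTensor B t)) =
    TensorProduct.assoc k V A A (coactV.rTensor A (TensorProduct.map j (i : B →ₗ[k] A) t)) := by
  induction t with
  | zero => simp
  | add x y hx hy => simp only [map_add, hx, hy]
  | tmul w b =>
    simp only [LinearMap.rTensor_tmul, TensorProduct.map_tmul, ← hcoact]
    generalize coactW w = s
    induction s with
    | zero => simp
    | add x y hx hy => simp only [map_add, add_tmul, hx, hy]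
    | tmul w c => simp

lemma map_coassoc_right (t : W ⊗[k] B) :
    TensorProduct.map j (TensorProduct.map (i : B →ₗ[k] A) (i : B →ₗ[k] A))
      ((Coalgebra.comul (R := k) (A := B)).lTensor W t) =
    (Coalgebra.comul (R := k) (A := A)).lTensor V (TensorProduct.map j (i : B →ₗ[k] A) t) := by
  induction t with
  | zero => simp
  | add x y hx hy => simp only [map_add, hx, hy]
  | tmul w b =>
    have h : Coalgebra.comul (R := k) (i b) = TensorProduct.map (i : B →ₗ[k] A) (i : B →ₗ[k] A)
      (Coalgebra.comul (R := k) b) := (CoalgHomClass.map_comp_comul_apply i b).symm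
    have h' : (i : B →ₗ[k] A) b = i b := rfl
    simp only [LinearMap.lTensor_tmul, TensorProduct.map_tmul, h, h']

lemma map_rid_counit (t : W ⊗[k] B) :
    j (TensorProduct.rid k W ((Coalgebra.counit (R := k) (A := B)).lTensor W t)) =
    TensorProduct.rid k V ((Coalgebra.counit (R := k) (A := A)).lTensor V
      (TensorProduct.map j (i : B →ₗ[k] A) t)) := by
  induction t with
  | zero => simp
  | add x y hx hy => simp only [map_add, hx, hy]
  | tmul w b =>
    have h : Coalgebra.counit (R := k) (i b) = Coalgebra.counit (R := k) b :=
      CoalgHomClass.counit_comp_apply i b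
    have h' : (i : B →ₗ[k] A) b = i b := rfl
    simp only [LinearMap.lTensor_tmul, TensorProduct.map_tmul, TensorProduct.rid_tmul, map_smul,
      h, h']

/-- The structure of a Yetter-Drinfeld module restricts along injective maps. -/
lemma IsYetterDrinfeld.of_injective (h : IsYetterDrinfeld actV coactV)
    (hi : Function.Injective i) (hj : Function.Injective j)
    (hact : ∀ w b, j (actW w b) = actV (j w) (i b))
    (hcoact : ∀ w, TensorProduct.map j (i : B →ₗ[k] A) (coactW w) = coactV (j w)) :
    IsYetterDrinfeld actW coactW := by
  have hi' : Function.Injective (i : B →ₗ[k] A) := hi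
  have hji : Function.Injective (TensorProduct.map j (i : B →ₗ[k] A)) :=
    TensorProduct.map_injective_of_flat_flat _ _ hj hi'
  have hii : Function.Injective (TensorProduct.map (i : B →ₗ[k] A) (i : B →ₗ[k] A)) :=
    TensorProduct.map_injective_of_flat_flat _ _ hi' hi'
  have hjii : Function.Injective (TensorProduct.map j
      (TensorProduct.map (i : B →ₗ[k] A) (i : B →ₗ[k] A))) :=
    TensorProduct.map_injective_of_flat_flat _ _ hj hii
  refine .of_compat (fun w => hj ?_) (fun w a b => hj ?_) (fun w => hj ?_) (fun w => hjii ?_)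
    (fun w b => hji ?_)
  · rw [hact, map_one, h.act_one]
  · rw [hact, map_mul, h.act_mul, hact, hact]
  · rw [map_rid_counit i j, hcoact, h.coact_counit]
  · rw [map_coassoc_left i j hcoact, map_coassoc_right, hcoact, h.coact_coassoc]
  · rw [map_conv i j _ (coactV ∘ₗ actV (j w)) (fun b => by simp [hact, hcoact]), h.compat,
      map_diagAct i j hact, hcoact]
    congr 2
    exact (CoalgHomClass.map_comp_comul_apply i b).symm

section Image

variable {V W : Type*} [AddCommGroup V] [Module k V]
  [AddCommGroup W] [Module k W] {j : V →ₗ[k] W}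
  {actV : V →ₗ[k] A →ₗ[k] V} {coactV : V →ₗ[k] V ⊗[k] A}
  {actW : W →ₗ[k] A →ₗ[k] W} {coactW : W →ₗ[k] W ⊗[k] A}

/-- The axioms of a Yetter-Drinfeld module hold on the image of a map that is compatible with
the actions and coactions. -/
lemma IsYetterDrinfeld.image (h : IsYetterDrinfeld actV coactV)
    (hact : ∀ v a, j (actV v a) = actW (j v) a)
    (hcoact : ∀ v, j.rTensor A (coactV v) = coactW (j v)) (v : V) :
    actW (j v) 1 = j v ∧ (∀ a b, actW (j v) (a * b) = actW (actW (j v) a) b) ∧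
    TensorProduct.rid k W
      ((Coalgebra.counit (R := k) (A := A)).lTensor W (coactW (j v))) = j v ∧
    TensorProduct.assoc k W A A (coactW.rTensor A (coactW (j v))) =
      (Coalgebra.comul (R := k) (A := A)).lTensor W (coactW (j v)) ∧
    ∀ a, coactW (actW (j v) a) = twist actW (comul₃ k a) (coactW (j v)) := by
  let i := BialgHom.id k A
  have hact' : ∀ v a, j (actV v a) = actW (j v) (i a) := hact
  have hcoact' : ∀ v, TensorProduct.map j (i : A →ₗ[k] A) (coactV v) = coactW (j v) := hcoact
  refine ⟨?_, ?_, ?_, ?_, ?_⟩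
  · rw [← hact, h.act_one]
  · intro a b
    rw [← hact, h.act_mul, hact, hact]
  · rw [← hcoact', ← map_rid_counit i j, h.coact_counit]
  · rw [← hcoact', ← map_coassoc_left i j hcoact', h.coact_coassoc, map_coassoc_right]
  · refine (compat_iff actW (coactW ∘ₗ actW (j v)) (coactW (j v))).2 fun b => ?_
    have e := map_conv i j (coactV ∘ₗ actV v) (coactW ∘ₗ actW (j v))
      (fun b => by simp [hact', hcoact']) b
    rw [h.compat, map_diagAct i j hact', hcoact'] at e
    have hb : i b = b := rfl
    rw [hb] at e
    rw [← e]
    congr 2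
    exact CoalgHomClass.map_comp_comul_apply i b

/-- The structure of a Yetter-Drinfeld module passes to quotients. -/
lemma IsYetterDrinfeld.of_surjective
    (h : IsYetterDrinfeld actV coactV) (hj : Function.Surjective j)
    (hact : ∀ v a, j (actV v a) = actW (j v) a)
    (hcoact : ∀ v, j.rTensor A (coactV v) = coactW (j v)) :
    IsYetterDrinfeld actW coactW := by
  have H := h.image hact hcoact
  constructor <;> intro w <;> obtain ⟨v, rfl⟩ := hj w
  exacts [(H v).1, (H v).2.1, (H v).2.2.1, (H v).2.2.2.1, (H v).2.2.2.2]

end Image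

end Transport

end Predicate

/-- The right-right Yetter-Drinfeld modules over a Hopf algebra `A`. -/
structure YDModule (k A : Type u) [Field k] [Ring A] [HopfAlgebra k A] where
  carrier : Type u
  [addCommGroup : AddCommGroup carrier]
  [module : Module k carrier]
  act : carrier →ₗ[k] A →ₗ[k] carrier
  coact : carrier →ₗ[k] carrier ⊗[k] A
  isYetterDrinfeld : IsYetterDrinfeld act coact

attribute [instance] YDModule.addCommGroup YDModule.module

section Category

variable {k A : Type u} [Field k] [Ring A] [HopfAlgebra k A]

/-- The space of `A`-linear and `A`-colinear maps between Yetter-Drinfeld modules. -/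
def homSubmodule (X Y : YDModule k A) : Submodule k (X.carrier →ₗ[k] Y.carrier) where
  carrier := {f | (∀ x a, f (X.act x a) = Y.act (f x) a) ∧
    ∀ x, f.rTensor A (X.coact x) = Y.coact (f x)}
  zero_mem' := by simp
  add_mem' {f g} hf hg :=
    ⟨fun x a => by simp [hf.1, hg.1], fun x => by simp [LinearMap.rTensor_add, hf.2, hg.2]⟩
  smul_mem' c f hf :=
    ⟨fun x a => by simp [hf.1], fun x => by simp [LinearMap.rTensor_smul, hf.2]⟩

instance : Category (YDModule k A) where
  Hom X Y := homSubmodule X Y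
  id X := ⟨LinearMap.id, fun _ _ => rfl, fun x => by simp⟩
  comp f g := ⟨g.1 ∘ₗ f.1, fun x a => by simp [f.2.1, g.2.1],
    fun x => by simp [LinearMap.rTensor_comp, f.2.2, g.2.2]⟩

/-- The underlying linear map of a morphism. -/
def toLin {X Y : YDModule k A} (f : X ⟶ Y) : X.carrier →ₗ[k] Y.carrier := Subtype.val f

/-- Constructor for morphisms. -/
def ofLin {X Y : YDModule k A} (f : X.carrier →ₗ[k] Y.carrier)
    (h1 : ∀ x a, f (X.act x a) = Y.act (f x) a)
    (h2 : ∀ x, f.rTensor A (X.coact x) = Y.coact (f x)) : X ⟶ Y := ⟨f, h1, h2⟩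

section
variable {X Y Z : YDModule k A}

@[simp] lemma toLin_ofLin (f : X.carrier →ₗ[k] Y.carrier) (h1 h2) :
    toLin (ofLin (X := X) (Y := Y) f h1 h2) = f := rfl

lemma toLin_act (f : X ⟶ Y) (x : X.carrier) (a : A) :
    toLin f (X.act x a) = Y.act (toLin f x) a := f.2.1 x a

lemma toLin_coact (f : X ⟶ Y) (x : X.carrier) :
    (toLin f).rTensor A (X.coact x) = Y.coact (toLin f x) := f.2.2 x

@[ext] lemma hom_ext {f g : X ⟶ Y} (h : toLin f = toLin g) : f = g := Subtype.ext h

@[simp] lemma toLin_id : toLin (𝟙 X) = LinearMap.id := rfl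

@[simp] lemma toLin_comp (f : X ⟶ Y) (g : Y ⟶ Z) : toLin (f ≫ g) = toLin g ∘ₗ toLin f := rfl

instance : AddCommGroup (X ⟶ Y) := inferInstanceAs (AddCommGroup (homSubmodule X Y))

instance : Module k (X ⟶ Y) := inferInstanceAs (Module k (homSubmodule X Y))

@[simp] lemma toLin_zero : toLin (0 : X ⟶ Y) = 0 := rfl

@[simp] lemma toLin_add (f g : X ⟶ Y) : toLin (f + g) = toLin f + toLin g := rfl

@[simp] lemma toLin_smul (c : k) (f : X ⟶ Y) : toLin (c • f) = c • toLin f := rfl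

end

instance : Preadditive (YDModule k A) where
  add_comp X Y Z f g h := by ext : 1; simp [LinearMap.comp_add]
  comp_add X Y Z f g h := by ext : 1; simp [LinearMap.add_comp]

instance : Linear k (YDModule k A) where
  smul_comp X Y Z c f g := by ext : 1; simp [LinearMap.comp_smul]
  comp_smul X Y Z f c g := by ext : 1; simp [LinearMap.smul_comp]

lemma map_subtype_injective {B : Type u} [Ring B] [HopfAlgebra k B] (i : B →ₐc[k] A)
    (hi : Function.Injective i) (X : YDModule k A) (W : Submodule k X.carrier) :
    Function.Injective (TensorProduct.map W.subtype (i : B →ₗ[k] A)) :=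
  TensorProduct.map_injective_of_flat_flat _ _ W.injective_subtype hi

section Restrict

variable {B : Type u} [Ring B] [HopfAlgebra k B] (i : B →ₐc[k] A) (hi : Function.Injective i)
  (X : YDModule k A) (W : Submodule k X.carrier)
  (hact : ∀ w ∈ W, ∀ b, X.act w (i b) ∈ W)
  (hcoact : ∀ w ∈ W, X.coact w ∈ LinearMap.range (TensorProduct.map W.subtype (i : B →ₗ[k] A)))

/-- For a subspace `W` of a Yetter-Drinfeld module over `A` that is stable under the action of `B`
and whose coaction takes values in `W ⊗ B`, the induced Yetter-Drinfeld module over `B`; see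
`restrict_act` and `restrict_coact`. -/
noncomputable def restrict : YDModule k B where
  carrier := W
  act := LinearMap.mk₂ k (fun w b => ⟨X.act w (i b), hact w w.2 b⟩)
    (fun _ _ _ => Subtype.ext (by simp)) (fun _ _ _ => Subtype.ext (by simp))
    (fun _ _ _ => Subtype.ext (by simp)) (fun _ _ _ => Subtype.ext (by simp))
  coact := (LinearEquiv.ofInjective _ (map_subtype_injective i hi X W)).symm.toLinearMap ∘ₗ
    LinearMap.codRestrict _ (X.coact ∘ₗ W.subtype) (fun w => hcoact w w.2)
  isYetterDrinfeld := X.isYetterDrinfeld.of_injective i W.subtype hi W.injective_subtype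
    (fun w b => rfl) (fun w => by
      have := LinearEquiv.apply_symm_apply (LinearEquiv.ofInjective _
        (map_subtype_injective i hi X W)) ⟨X.coact w, hcoact w w.2⟩
      exact congrArg Subtype.val this)

lemma restrict_act (w : W) (b : B) :
    W.subtype ((restrict i hi X W hact hcoact).act w b) = X.act (W.subtype w) (i b) := rfl

lemma restrict_coact (w : W) :
    TensorProduct.map W.subtype (i : B →ₗ[k] A) ((restrict i hi X W hact hcoact).coact w) =
      X.coact (W.subtype w) := by
  have := LinearEquiv.apply_symm_apply (LinearEquiv.ofInjective _
    (map_subtype_injective i hi X W)) ⟨X.coact w, hcoact w w.2⟩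
  exact congrArg Subtype.val this

end Restrict

section Quotient

variable (X : YDModule k A) (W : Submodule k X.carrier)
  (hact : ∀ w ∈ W, ∀ a, X.act w a ∈ W)
  (hcoact : ∀ w ∈ W, W.mkQ.rTensor A (X.coact w) = 0)

/-- The quotient Yetter-Drinfeld module. -/
noncomputable def quotient : YDModule k A where
  carrier := X.carrier ⧸ W
  act := W.liftQ (X.act.compr₂ W.mkQ) (fun w hw => by
    ext a
    simpa using hact w hw a)
  coact := W.liftQ (W.mkQ.rTensor A ∘ₗ X.coact) (fun w hw => hcoact w hw)
  isYetterDrinfeld := X.isYetterDrinfeld.of_surjective (j := W.mkQ) W.mkQ_surjective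
    (fun _ _ => rfl) (fun _ => rfl)

end Quotient

/-- Over a field, `Ker(f ⊗ id) = Ker(f) ⊗ M`. -/
lemma mem_range_of_rTensor_eq_zero {V V' M : Type*} [AddCommGroup V] [Module k V]
    [AddCommGroup V'] [Module k V'] [AddCommGroup M] [Module k M]
    (f : V →ₗ[k] V') (t : V ⊗[k] M) (h : f.rTensor M t = 0) :
    t ∈ LinearMap.range ((LinearMap.ker f).subtype.rTensor M) :=
  (Module.Flat.rTensor_exact M (LinearMap.exact_subtype_ker_map f) t).1 h

section Abelian

variable {X Y : YDModule k A} (f : X ⟶ Y)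

lemma ker_stable (w : X.carrier) (hw : w ∈ LinearMap.ker (toLin f)) (a : A) :
    X.act w (BialgHom.id k A a) ∈ LinearMap.ker (toLin f) := by
  have hw' : toLin f w = 0 := hw
  simp [toLin_act, hw']

lemma ker_costable (w : X.carrier) (hw : w ∈ LinearMap.ker (toLin f)) :
    X.coact w ∈ LinearMap.range (TensorProduct.map (LinearMap.ker (toLin f)).subtype
      (BialgHom.id k A : A →ₗ[k] A)) :=
  mem_range_of_rTensor_eq_zero _ _ (by
    have hw' : toLin f w = 0 := hw
    rw [toLin_coact, hw', map_zero])

/-- The kernel of a morphism of Yetter-Drinfeld modules. -/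
noncomputable def kerObj : YDModule k A :=
  restrict (BialgHom.id k A) Function.injective_id X (LinearMap.ker (toLin f))
    (ker_stable f) (ker_costable f)

/-- The inclusion of the kernel. -/
noncomputable def kerι : kerObj f ⟶ X :=
  ofLin (X := kerObj f) (Y := X) (LinearMap.ker (toLin f)).subtype (fun _ _ => rfl)
    (restrict_coact (BialgHom.id k A) Function.injective_id X (LinearMap.ker (toLin f))
      (ker_stable f) (ker_costable f))

@[simp] lemma toLin_kerι : toLin (kerι f) = (LinearMap.ker (toLin f)).subtype := rfl

lemma rTensor_injective {V V' : Type*} [AddCommGroup V] [Module k V]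
    [AddCommGroup V'] [Module k V'] (j : V →ₗ[k] V') (hj : Function.Injective j) :
    Function.Injective (j.rTensor A) :=
  Module.Flat.rTensor_preserves_injective_linearMap j hj

/-- Factorization through an injective morphism. -/
noncomputable def liftInj {Z : YDModule k A} (hf : Function.Injective (toLin f)) (g : Z ⟶ Y)
    (hg : ∀ z, toLin g z ∈ LinearMap.range (toLin f)) : Z ⟶ X :=
  have h (z) : toLin f ((LinearEquiv.ofInjective _ hf).symm ⟨toLin g z, hg z⟩) = toLin g z :=
    congrArg Subtype.val
      (LinearEquiv.apply_symm_apply (LinearEquiv.ofInjective _ hf) ⟨toLin g z, hg z⟩)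
  have h' : toLin f ∘ₗ ((LinearEquiv.ofInjective _ hf).symm.toLinearMap ∘ₗ
      LinearMap.codRestrict _ (toLin g) hg) = toLin g := LinearMap.ext h
  ofLin ((LinearEquiv.ofInjective _ hf).symm.toLinearMap ∘ₗ
      LinearMap.codRestrict _ (toLin g) hg)
    (fun z a => hf (by
      rw [toLin_act]
      exact ((h _).trans (toLin_act g z a)).trans (congrArg (fun y => Y.act y a) (h z).symm)))
    (fun z => rTensor_injective _ hf (by
      rw [toLin_coact, ← LinearMap.comp_apply, ← LinearMap.rTensor_comp, h', toLin_coact]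
      exact congrArg Y.coact (h z).symm))

lemma liftInj_comp {Z : YDModule k A} (hf : Function.Injective (toLin f)) (g : Z ⟶ Y)
    (hg : ∀ z, toLin g z ∈ LinearMap.range (toLin f)) : liftInj f hf g hg ≫ f = g := by
  ext z
  exact congrArg Subtype.val
      (LinearEquiv.apply_symm_apply (LinearEquiv.ofInjective _ hf) ⟨toLin g z, hg z⟩)

/-- Factorization through a surjective morphism. -/
noncomputable def descSurj {Z : YDModule k A} (hf : Function.Surjective (toLin f)) (g : X ⟶ Z)
    (hg : LinearMap.ker (toLin f) ≤ LinearMap.ker (toLin g)) : Y ⟶ Z :=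
  let e := (toLin f).quotKerEquivOfSurjective hf
  let l : Y.carrier →ₗ[k] Z.carrier := (LinearMap.ker (toLin f)).liftQ (toLin g) hg ∘ₗ
    e.symm.toLinearMap
  have h (x : X.carrier) : l (toLin f x) = toLin g x := by
    have : e.symm (toLin f x) = (LinearMap.ker (toLin f)).mkQ x :=
      e.symm_apply_eq.2 rfl
    simp [l, this]
  have h' : l ∘ₗ toLin f = toLin g := LinearMap.ext h
  ofLin l
    (fun y a => by
      obtain ⟨x, rfl⟩ := hf y
      rw [← toLin_act, h, h, toLin_act])
    (fun y => by
      obtain ⟨x, rfl⟩ := hf y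
      rw [← toLin_coact, ← LinearMap.comp_apply, ← LinearMap.rTensor_comp, h', toLin_coact, h])

lemma comp_descSurj {Z : YDModule k A} (hf : Function.Surjective (toLin f)) (g : X ⟶ Z)
    (hg : LinearMap.ker (toLin f) ≤ LinearMap.ker (toLin g)) : f ≫ descSurj f hf g hg = g := by
  ext x
  have : ((toLin f).quotKerEquivOfSurjective hf).symm (toLin f x) =
      (LinearMap.ker (toLin f)).mkQ x := (LinearEquiv.symm_apply_eq _).2 rfl
  change (LinearMap.ker (toLin f)).liftQ (toLin g) hg
    (((toLin f).quotKerEquivOfSurjective hf).symm (toLin f x)) = _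
  rw [this]
  rfl

/-- The cokernel of a morphism of Yetter-Drinfeld modules. -/
noncomputable def cokerObj : YDModule k A :=
  quotient Y (LinearMap.range (toLin f))
    (by
      rintro _ ⟨x, rfl⟩ a
      exact ⟨X.act x a, toLin_act f x a⟩)
    (by
      rintro _ ⟨x, rfl⟩
      rw [← toLin_coact, ← LinearMap.comp_apply, ← LinearMap.rTensor_comp,
        LinearMap.range_mkQ_comp, LinearMap.rTensor_zero, LinearMap.zero_apply])

/-- The projection onto the cokernel. -/
noncomputable def cokerπ : Y ⟶ cokerObj f :=
  ofLin (LinearMap.range (toLin f)).mkQ (fun _ _ => rfl) (fun _ => rfl)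

@[simp] lemma toLin_cokerπ : toLin (cokerπ f) = (LinearMap.range (toLin f)).mkQ := rfl

lemma kerι_comp : kerι f ≫ f = 0 := by
  ext x
  exact Subtype.property (p := fun x => x ∈ LinearMap.ker (toLin f)) x

lemma comp_cokerπ : f ≫ cokerπ f = 0 := by
  ext x : 2
  exact (Submodule.Quotient.mk_eq_zero _).2 ⟨x, rfl⟩

lemma kerι_injective : Function.Injective (toLin (kerι f)) := Subtype.val_injective

lemma cokerπ_surjective : Function.Surjective (toLin (cokerπ f)) := Submodule.mkQ_surjective _

lemma comp_apply_eq_zero {Z : YDModule k A} {f : X ⟶ Y} {g : Y ⟶ Z} (w : f ≫ g = 0)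
    (x : X.carrier) : toLin g (toLin f x) = 0 :=
  LinearMap.congr_fun (congrArg toLin w) x

lemma injective_of_mono [Mono f] : Function.Injective (toLin f) := by
  have h : kerι f = 0 := by
    rw [← cancel_mono f, kerι_comp, Limits.zero_comp]
  refine (injective_iff_map_eq_zero _).2 fun x hx => ?_
  exact LinearMap.congr_fun (congrArg toLin h) (⟨x, hx⟩ : LinearMap.ker (toLin f))

lemma surjective_of_epi [Epi f] : Function.Surjective (toLin f) := by
  have h : cokerπ f = 0 := by
    rw [← cancel_epi f, comp_cokerπ, Limits.comp_zero]
  intro y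
  exact (Submodule.Quotient.mk_eq_zero (LinearMap.range (toLin f))).1
    (LinearMap.congr_fun (congrArg toLin h) y)

lemma mono_of_injective (hf : Function.Injective (toLin f)) : Mono f :=
  ⟨fun g h e => by
    ext z
    exact hf (LinearMap.congr_fun (congrArg toLin e) z)⟩

lemma epi_of_surjective (hf : Function.Surjective (toLin f)) : Epi f :=
  ⟨fun g h e => by
    ext z
    obtain ⟨x, rfl⟩ := hf z
    exact LinearMap.congr_fun (congrArg toLin e) x⟩

/-- An injective morphism `f` is a kernel of `g` if the image of `f` is the kernel of `g`. -/
noncomputable def isKernel {Z : YDModule k A} (g : Y ⟶ Z) (w : f ≫ g = 0)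
    (hf : Function.Injective (toLin f)) (h : ∀ y, toLin g y = 0 → y ∈ LinearMap.range (toLin f)) :
    Limits.IsLimit (Limits.KernelFork.ofι f w) :=
  have := mono_of_injective f hf
  Limits.KernelFork.IsLimit.ofι' f w fun l hl =>
    ⟨liftInj f hf l (fun z => h _ (comp_apply_eq_zero hl z)), liftInj_comp _ _ _ _⟩

/-- A surjective morphism `g` is a cokernel of `f` if the kernel of `g` is the image of `f`. -/
noncomputable def isCokernel {Z : YDModule k A} (g : Y ⟶ Z) (w : f ≫ g = 0)
    (hg : Function.Surjective (toLin g))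
    (h : ∀ y, toLin g y = 0 → y ∈ LinearMap.range (toLin f)) :
    Limits.IsColimit (Limits.CokernelCofork.ofπ g w) :=
  have := epi_of_surjective g hg
  Limits.CokernelCofork.IsColimit.ofπ' g w fun l hl =>
    ⟨descSurj g hg l (fun y hy => by
      obtain ⟨x, rfl⟩ := h y hy
      exact comp_apply_eq_zero hl x), comp_descSurj _ _ _ _⟩

end Abelian

section Prod

variable (X Y : YDModule k A)

/-- The zero Yetter-Drinfeld module. -/
noncomputable def zeroObj (k A : Type u) [Field k] [Ring A] [HopfAlgebra k A] : YDModule k A where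
  carrier := PUnit
  act := 0
  coact := 0
  isYetterDrinfeld := ⟨fun _ => rfl, fun _ _ _ => rfl, fun _ => rfl,
    fun _ => by simp, fun _ _ => by simp⟩

/-- The componentwise action on the direct sum. -/
noncomputable def prodAct :
    X.carrier × Y.carrier →ₗ[k] A →ₗ[k] X.carrier × Y.carrier :=
  LinearMap.mk₂ k (fun w a => (X.act w.1 a, Y.act w.2 a)) (by simp) (by simp) (by simp) (by simp)

/-- The componentwise coaction on the direct sum. -/
noncomputable def prodCoact :
    X.carrier × Y.carrier →ₗ[k] (X.carrier × Y.carrier) ⊗[k] A :=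
  ((LinearMap.inl k X.carrier Y.carrier).rTensor A ∘ₗ X.coact).coprod
    ((LinearMap.inr k X.carrier Y.carrier).rTensor A ∘ₗ Y.coact)

lemma inl_act (x : X.carrier) (a : A) :
    LinearMap.inl k X.carrier Y.carrier (X.act x a) =
      prodAct X Y (LinearMap.inl k X.carrier Y.carrier x) a := by simp [prodAct]

lemma inr_act (y : Y.carrier) (a : A) :
    LinearMap.inr k X.carrier Y.carrier (Y.act y a) =
      prodAct X Y (LinearMap.inr k X.carrier Y.carrier y) a := by simp [prodAct]

lemma inl_coact (x : X.carrier) :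
    (LinearMap.inl k X.carrier Y.carrier).rTensor A (X.coact x) =
      prodCoact X Y (LinearMap.inl k X.carrier Y.carrier x) := by simp [prodCoact]

lemma inr_coact (y : Y.carrier) :
    (LinearMap.inr k X.carrier Y.carrier).rTensor A (Y.coact y) =
      prodCoact X Y (LinearMap.inr k X.carrier Y.carrier y) := by simp [prodCoact]

lemma fst_coact (w : X.carrier × Y.carrier) :
    (LinearMap.fst k X.carrier Y.carrier).rTensor A (prodCoact X Y w) = X.coact w.1 := by
  simp only [prodCoact, LinearMap.coprod_apply, LinearMap.comp_apply, map_add]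
  rw [← LinearMap.rTensor_comp_apply, ← LinearMap.rTensor_comp_apply, LinearMap.fst_comp_inl,
    LinearMap.fst_comp_inr]
  simp

lemma snd_coact (w : X.carrier × Y.carrier) :
    (LinearMap.snd k X.carrier Y.carrier).rTensor A (prodCoact X Y w) = Y.coact w.2 := by
  simp only [prodCoact, LinearMap.coprod_apply, LinearMap.comp_apply, map_add]
  rw [← LinearMap.rTensor_comp_apply, ← LinearMap.rTensor_comp_apply, LinearMap.snd_comp_inl,
    LinearMap.snd_comp_inr]
  simp

/-- The direct sum of two Yetter-Drinfeld modules. -/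
noncomputable def prodObj : YDModule k A where
  carrier := X.carrier × Y.carrier
  act := prodAct X Y
  coact := prodCoact X Y
  isYetterDrinfeld := by
    have hX := X.isYetterDrinfeld.image (inl_act X Y) (inl_coact X Y)
    have hY := Y.isYetterDrinfeld.image (inr_act X Y) (inr_coact X Y)
    have key : ∀ w : X.carrier × Y.carrier,
        w = LinearMap.inl k X.carrier Y.carrier w.1 + LinearMap.inr k X.carrier Y.carrier w.2 :=
      fun w => by simp
    constructor <;> intro w <;> rw [key w] <;> simp only [map_add, LinearMap.add_apply]
    · rw [(hX _).1, (hY _).1]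
    · intro a b
      rw [(hX _).2.1, (hY _).2.1]
    · rw [(hX _).2.2.1, (hY _).2.2.1]
    · rw [(hX _).2.2.2.1, (hY _).2.2.2.1]
    · intro a
      rw [(hX _).2.2.2.2, (hY _).2.2.2.2]

noncomputable instance : Limits.HasZeroObject (YDModule k A) :=
  ⟨zeroObj k A, ⟨fun _ => ⟨⟨⟨0⟩, fun _ => by ext x; exact (map_zero (toLin _))⟩⟩,
    fun _ => ⟨⟨⟨0⟩, fun _ => by ext x; rfl⟩⟩⟩⟩

/-- The first projection. -/
noncomputable def prodFst : prodObj X Y ⟶ X :=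
  ofLin (X := prodObj X Y) (Y := X) (LinearMap.fst k X.carrier Y.carrier) (fun _ _ => rfl)
    (fst_coact X Y)

/-- The second projection. -/
noncomputable def prodSnd : prodObj X Y ⟶ Y :=
  ofLin (X := prodObj X Y) (Y := Y) (LinearMap.snd k X.carrier Y.carrier) (fun _ _ => rfl)
    (snd_coact X Y)

/-- The first inclusion. -/
noncomputable def prodInl : X ⟶ prodObj X Y :=
  ofLin (X := X) (Y := prodObj X Y) (LinearMap.inl k X.carrier Y.carrier)
    (inl_act X Y) (inl_coact X Y)

/-- The second inclusion. -/
noncomputable def prodInr : Y ⟶ prodObj X Y :=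
  ofLin (X := Y) (Y := prodObj X Y) (LinearMap.inr k X.carrier Y.carrier)
    (inr_act X Y) (inr_coact X Y)

/-- The direct sum as a binary bicone. -/
noncomputable def prodBicone : Limits.BinaryBicone X Y where
  pt := prodObj X Y
  fst := prodFst X Y
  snd := prodSnd X Y
  inl := prodInl X Y
  inr := prodInr X Y
  inl_fst := by ext x; rfl
  inl_snd := by ext x; rfl
  inr_fst := by ext x; rfl
  inr_snd := by ext x; rfl

noncomputable instance : Limits.HasBinaryBiproducts (YDModule k A) where
  has_binary_biproduct X Y := .mk
    { bicone := prodBicone X Y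
      isBilimit := Limits.isBinaryBilimitOfTotal _ (by
        ext w : 2
        exact Prod.ext (add_zero (Prod.fst (α := X.carrier) (β := Y.carrier) w))
          (zero_add (Prod.snd (α := X.carrier) (β := Y.carrier) w))) }

end Prod

section Instances

noncomputable instance : Limits.HasFiniteProducts (YDModule k A) :=
  have := Limits.hasBinaryProducts_of_hasBinaryBiproducts (C := YDModule k A)
  hasFiniteProducts_of_has_binary_and_terminal

noncomputable instance : Limits.HasKernels (YDModule k A) where
  has_limit f := ⟨⟨_, isKernel (kerι f) f (kerι_comp f) (kerι_injective f)
    (fun y hy => ⟨⟨y, hy⟩, rfl⟩)⟩⟩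

noncomputable instance : Limits.HasCokernels (YDModule k A) where
  has_colimit f := ⟨⟨_, isCokernel f (cokerπ f) (comp_cokerπ f) (cokerπ_surjective f)
    (fun _ hy => (Submodule.Quotient.mk_eq_zero _).1 hy)⟩⟩

/-- The category of Yetter-Drinfeld modules is abelian. -/
noncomputable instance : Abelian (YDModule k A) where
  normalMonoOfMono f _ := ⟨⟨cokerObj f, cokerπ f, comp_cokerπ f,
    isKernel f (cokerπ f) (comp_cokerπ f) (injective_of_mono f)
      (fun _ hy => (Submodule.Quotient.mk_eq_zero _).1 hy)⟩⟩
  normalEpiOfEpi f _ := ⟨⟨kerObj f, kerι f, kerι_comp f,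
    isCokernel (kerι f) f (kerι_comp f) (surjective_of_epi f)
      (fun y hy => ⟨⟨y, hy⟩, rfl⟩)⟩⟩

instance : HasExt.{u + 1} (YDModule k A) := HasExt.standard _

end Instances

end Category

section Antipode

variable {k A B : Type*} [Field k] [Ring A] [HopfAlgebra k A] [Ring B] [HopfAlgebra k B]

lemma mul'_map_comp (i : B →ₐc[k] A) (t : B ⊗[k] B) :
    LinearMap.mul' k A (TensorProduct.map (i : B →ₗ[k] A) (i : B →ₗ[k] A) t) =
      i (LinearMap.mul' k B t) := by
  induction t with
  | zero => simp
  | add x y hx hy => simp only [map_add, hx, hy]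
  | tmul a b => simp

open WithConv in
/-- A morphism of bialgebras between Hopf algebras commutes with the antipodes. -/
lemma antipode_map (i : B →ₐc[k] A) (b : B) :
    HopfAlgebra.antipode k (i b) = i (HopfAlgebra.antipode k b) := by
  let ι : B →ₗ[k] A := (i : B →ₗ[k] A)
  let f : WithConv (B →ₗ[k] A) := toConv (HopfAlgebra.antipode k ∘ₗ ι)
  let g : WithConv (B →ₗ[k] A) := toConv (ι ∘ₗ HopfAlgebra.antipode k)
  have h1 : f * toConv ι = 1 := by
    ext b
    rw [LinearMap.convMul_apply, LinearMap.convOne_apply]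
    have h : Coalgebra.comul (R := k) (i b) = TensorProduct.map ι ι
      (Coalgebra.comul (R := k) b) := (CoalgHomClass.map_comp_comul_apply i b).symm
    have h' : Coalgebra.counit (R := k) (i b) = Coalgebra.counit (R := k) b :=
      CoalgHomClass.counit_comp_apply i b
    have e := HopfAlgebra.mul_antipode_rTensor_comul_apply (R := k) (i b)
    rw [h, h'] at e
    rw [← e]
    congr 1
    rw [LinearMap.rTensor, TensorProduct.map_map]
    rfl
  have h2 : toConv ι * g = 1 := by
    ext b
    rw [LinearMap.convMul_apply, LinearMap.convOne_apply]
    have e := congrArg i (HopfAlgebra.mul_antipode_lTensor_comul_apply (R := k) b)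
    rw [← mul'_map_comp, LinearMap.lTensor, TensorProduct.map_map] at e
    refine Eq.trans ?_ (e.trans ?_)
    · rfl
    · exact AlgHomClass.commutes i _
  have h3 : f = g := left_inv_eq_right_inv h1 h2
  exact LinearMap.congr_fun (congrArg WithConv.ofConv h3) b

end Antipode

section OneDim

variable {k A : Type u} [Field k] [Ring A] [HopfAlgebra k A]

/-- The condition `ψ(a₁) a₂ = ψ(a₂) a₁` on an algebra map `ψ : A → k`. -/
def IsCentralChar (ψ : A →ₐ[k] k) : Prop :=
  ∀ a : A, TensorProduct.lid k A (ψ.toLinearMap.rTensor A (Coalgebra.comul (R := k) a)) =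
    TensorProduct.rid k A (ψ.toLinearMap.lTensor A (Coalgebra.comul (R := k) a))

/-- The Yetter-Drinfeld module `k_ψ`: the vector space `k` with the action `c · a = c ψ(a)` and
the trivial coaction `c ↦ c ⊗ 1`. -/
noncomputable def oneDim (ψ : A →ₐ[k] k) (hψ : IsCentralChar ψ) : YDModule k A where
  carrier := k
  act := (LinearMap.mul k k).compl₂ ψ.toLinearMap
  coact := (TensorProduct.mk k k A).flip 1
  isYetterDrinfeld := by
    refine .of_compat (by simp) (by simp [mul_assoc]) (by simp)
      (by simp [Algebra.TensorProduct.one_def]) (fun v a => ?_)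
    have h1 : ∀ t : A ⊗[k] A, TensorProduct.lift ((leftMul k A k).compl₂
        ((TensorProduct.mk k k A).flip 1 ∘ₗ
          (LinearMap.mul k k).compl₂ ψ.toLinearMap v)) t =
        v ⊗ₜ TensorProduct.rid k A (ψ.toLinearMap.lTensor A t) := by
      intro t
      induction t with
      | zero => simp
      | add x y hx hy => simp only [map_add, tmul_add, hx, hy]
      | tmul a b =>
        simp [TensorProduct.tmul_smul, TensorProduct.smul_tmul', mul_comm]
    have h2 : ∀ t : A ⊗[k] A, diagAct
        ((LinearMap.mul k k).compl₂ ψ.toLinearMap) t (v ⊗ₜ 1) =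
        v ⊗ₜ TensorProduct.lid k A (ψ.toLinearMap.rTensor A t) := by
      intro t
      induction t with
      | zero => simp
      | add x y hx hy => simp only [map_add, tmul_add, LinearMap.add_apply, hx, hy]
      | tmul a b =>
        simp [TensorProduct.tmul_smul, TensorProduct.smul_tmul', mul_comm]
    refine (h1 _).trans (Eq.trans ?_ (h2 _).symm)
    rw [hψ a]

lemma isCentralChar_counit : IsCentralChar (Bialgebra.counitAlgHom k A) := fun a => by
  have h1 := Coalgebra.rTensor_counit_comul (R := k) a
  have h2 := Coalgebra.lTensor_counit_comul (R := k) a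
  change TensorProduct.lid k A ((Coalgebra.counit (R := k) (A := A)).rTensor A _) =
    TensorProduct.rid k A ((Coalgebra.counit (R := k) (A := A)).lTensor A _)
  rw [h1, h2]
  simp

/-- The trivial Yetter-Drinfeld module `k`. -/
noncomputable def triv (k A : Type u) [Field k] [Ring A] [HopfAlgebra k A] : YDModule k A :=
  oneDim (Bialgebra.counitAlgHom k A) isCentralChar_counit

end OneDim

section Tensor

variable {k A : Type u} [Field k] [Ring A] [HopfAlgebra k A]
variable {V W : Type*} [AddCommGroup V] [Module k V] [AddCommGroup W] [Module k W]

/-- The diagonal action `(x ⊗ y) · a = x · a₁ ⊗ y · a₂`. -/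
noncomputable def tensorAct (actV : V →ₗ[k] A →ₗ[k] V) (actW : W →ₗ[k] A →ₗ[k] W) :
    V ⊗[k] W →ₗ[k] A →ₗ[k] V ⊗[k] W :=
  (TensorProduct.map₂ actV actW).compl₂ Coalgebra.comul

/-- The linear map `(x ⊗ a) ⊗ (y ⊗ b) ↦ (x ⊗ y) ⊗ a b`. -/
noncomputable def tensorMul (k A V W : Type*) [Field k] [Ring A] [Algebra k A]
    [AddCommGroup V] [Module k V] [AddCommGroup W] [Module k W] :
    (V ⊗[k] A) ⊗[k] (W ⊗[k] A) →ₗ[k] (V ⊗[k] W) ⊗[k] A :=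
  (LinearMap.mul' k A).lTensor (V ⊗[k] W) ∘ₗ
    (TensorProduct.tensorTensorTensorComm k V A W A).toLinearMap

@[simp] lemma tensorMul_tmul (x : V) (y : W) (a b : A) :
    tensorMul k A V W ((x ⊗ₜ a) ⊗ₜ (y ⊗ₜ b)) = (x ⊗ₜ y) ⊗ₜ (a * b) := rfl

/-- The codiagonal coaction `x ⊗ y ↦ (x₀ ⊗ y₀) ⊗ x₁ y₁`. -/
noncomputable def tensorCoact (coactV : V →ₗ[k] V ⊗[k] A) (coactW : W →ₗ[k] W ⊗[k] A) :
    V ⊗[k] W →ₗ[k] (V ⊗[k] W) ⊗[k] A :=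
  tensorMul k A V W ∘ₗ TensorProduct.map coactV coactW

lemma map₂_comp_mul (actV : V →ₗ[k] A →ₗ[k] V) (actW : W →ₗ[k] A →ₗ[k] W)
    (hV : ∀ v a b, actV v (a * b) = actV (actV v a) b)
    (hW : ∀ v a b, actW v (a * b) = actW (actW v a) b) (x : V ⊗[k] W) (s t : A ⊗[k] A) :
    TensorProduct.map₂ actV actW x (s * t) =
      TensorProduct.map₂ actV actW (TensorProduct.map₂ actV actW x s) t := by
  induction x with
  | zero => simp
  | add x y hx hy => simp only [map_add, LinearMap.add_apply, hx, hy]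
  | tmul v w =>
    induction s with
    | zero => simp
    | add x y hx hy => simp only [map_add, LinearMap.add_apply, add_mul, hx, hy]
    | tmul a b =>
      induction t with
      | zero => simp
      | add x y hx hy => simp only [map_add, mul_add, hx, hy]
      | tmul c d => simp [hV, hW]

lemma rid_tensorMul (s : V ⊗[k] A) (t : W ⊗[k] A) :
    TensorProduct.rid k (V ⊗[k] W) ((Coalgebra.counit (R := k) (A := A)).lTensor (V ⊗[k] W)
      (tensorMul k A V W (s ⊗ₜ t))) =
    TensorProduct.rid k V ((Coalgebra.counit (R := k) (A := A)).lTensor V s) ⊗ₜ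
      TensorProduct.rid k W ((Coalgebra.counit (R := k) (A := A)).lTensor W t) := by
  induction s with
  | zero => simp
  | add x y hx hy => simp only [map_add, add_tmul, hx, hy]
  | tmul v a =>
    induction t with
    | zero => simp
    | add x y hx hy => simp only [map_add, tmul_add, hx, hy]
    | tmul w b => simp [TensorProduct.smul_tmul', smul_smul, mul_comm]

/-- The linear map `(x ⊗ s) ⊗ (y ⊗ t) ↦ (x ⊗ y) ⊗ s t` with `s` and `t` in `A ⊗ A`. -/
noncomputable def tensorMul₂ (k A V W : Type*) [Field k] [Ring A] [Algebra k A]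
    [AddCommGroup V] [Module k V] [AddCommGroup W] [Module k W] :
    (V ⊗[k] (A ⊗[k] A)) ⊗[k] (W ⊗[k] (A ⊗[k] A)) →ₗ[k] (V ⊗[k] W) ⊗[k] (A ⊗[k] A) :=
  (LinearMap.mul' k (A ⊗[k] A)).lTensor (V ⊗[k] W) ∘ₗ
    (TensorProduct.tensorTensorTensorComm k V (A ⊗[k] A) W (A ⊗[k] A)).toLinearMap

@[simp] lemma tensorMul₂_tmul (x : V) (y : W) (a b : A ⊗[k] A) :
    tensorMul₂ k A V W ((x ⊗ₜ a) ⊗ₜ (y ⊗ₜ b)) = (x ⊗ₜ y) ⊗ₜ (a * b) := rfl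

lemma comul_tensorMul (s : V ⊗[k] A) (t : W ⊗[k] A) :
    (Coalgebra.comul (R := k) (A := A)).lTensor (V ⊗[k] W) (tensorMul k A V W (s ⊗ₜ t)) =
    tensorMul₂ k A V W ((Coalgebra.comul (R := k) (A := A)).lTensor V s ⊗ₜ
      (Coalgebra.comul (R := k) (A := A)).lTensor W t) := by
  induction s with
  | zero => simp
  | add x y hx hy => simp only [map_add, add_tmul, hx, hy]
  | tmul v a =>
    induction t with
    | zero => simp
    | add x y hx hy => simp only [map_add, tmul_add, hx, hy]
    | tmul w b => simp

lemma assoc_tensorMul (s : V ⊗[k] A) (t : W ⊗[k] A) (a b : A) :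
    TensorProduct.assoc k (V ⊗[k] W) A A (tensorMul k A V W (s ⊗ₜ t) ⊗ₜ (a * b)) =
    tensorMul₂ k A V W (TensorProduct.assoc k V A A (s ⊗ₜ a) ⊗ₜ
      TensorProduct.assoc k W A A (t ⊗ₜ b)) := by
  induction s with
  | zero => simp
  | add x y hx hy => simp only [map_add, add_tmul, hx, hy]
  | tmul v c =>
    induction t with
    | zero => simp
    | add x y hx hy => simp only [map_add, add_tmul, tmul_add, hx, hy]
    | tmul w d => simp

lemma coact_tensorMul (coactV : V →ₗ[k] V ⊗[k] A) (coactW : W →ₗ[k] W ⊗[k] A)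
    (s : V ⊗[k] A) (t : W ⊗[k] A) :
    TensorProduct.assoc k (V ⊗[k] W) A A ((tensorCoact coactV coactW).rTensor A
      (tensorMul k A V W (s ⊗ₜ t))) =
    tensorMul₂ k A V W (TensorProduct.assoc k V A A (coactV.rTensor A s) ⊗ₜ
      TensorProduct.assoc k W A A (coactW.rTensor A t)) := by
  induction s with
  | zero => simp
  | add x y hx hy => simp only [map_add, add_tmul, hx, hy]
  | tmul v a =>
    induction t with
    | zero => simp
    | add x y hx hy => simp only [map_add, tmul_add, hx, hy]
    | tmul w b => simp [tensorCoact, assoc_tensorMul]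

lemma tensorMul_leftMul_left (a : A) (s : V ⊗[k] A) (t : W ⊗[k] A) :
    tensorMul k A V W (leftMul k A V a s ⊗ₜ t) =
      leftMul k A (V ⊗[k] W) a (tensorMul k A V W (s ⊗ₜ t)) := by
  induction s with
  | zero => simp
  | add x y hx hy => simp only [map_add, add_tmul, hx, hy]
  | tmul v c =>
    induction t with
    | zero => simp
    | add x y hx hy => simp only [map_add, tmul_add, hx, hy]
    | tmul w d => simp [mul_assoc]

lemma tensorMul_leftMul_right (v : V) (c b : A) (t : W ⊗[k] A) :
    tensorMul k A V W ((v ⊗ₜ c) ⊗ₜ leftMul k A W b t) =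
      tensorMul k A V W ((v ⊗ₜ (c * b)) ⊗ₜ t) := by
  induction t with
  | zero => simp
  | add x y hx hy => simp only [map_add, tmul_add, hx, hy]
  | tmul w d => simp [mul_assoc]

lemma coassoc_apply' {M : Type*} [AddCommGroup M] [Module k M] (T : A ⊗[k] (A ⊗[k] A) →ₗ[k] M)
    (a : A) : T ((Coalgebra.comul (R := k) (A := A)).lTensor A (Coalgebra.comul (R := k) a)) =
      T (TensorProduct.assoc k A A A ((Coalgebra.comul (R := k) (A := A)).rTensor A
        (Coalgebra.comul (R := k) a))) :=
  congrArg T (Coalgebra.coassoc_apply a).symm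

section TensorCompat

variable {actV : V →ₗ[k] A →ₗ[k] V} {actW : W →ₗ[k] A →ₗ[k] W}
  {coactV : V →ₗ[k] V ⊗[k] A} {coactW : W →ₗ[k] W ⊗[k] A}

lemma tensor_compat_aux1 (x : V) (d : A) (r : W ⊗[k] A) (a : A) :
    tensorMul k A V W (TensorProduct.map ((TensorProduct.mk k V A).flip d ∘ₗ actV x)
      ((diagAct actW).flip r ∘ₗ Coalgebra.comul) (Coalgebra.comul (R := k) a)) =
    diagAct (tensorAct actV actW) (Coalgebra.comul (R := k) a)
      (tensorMul k A V W ((x ⊗ₜ d) ⊗ₜ r)) := by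
  induction r with
  | zero => simp [LinearMap.zero_comp]
  | add r s hr hs =>
    simp only [map_add, LinearMap.add_comp, TensorProduct.map_add_right, LinearMap.add_apply,
      tmul_add, hr, hs]
  | tmul y e =>
    let U : A ⊗[k] (A ⊗[k] A) →ₗ[k] (V ⊗[k] W) ⊗[k] A :=
      TensorProduct.map (TensorProduct.map (actV x) (actW y)) (LinearMap.mul k A (d * e)) ∘ₗ
        (TensorProduct.assoc k A A A).symm.toLinearMap
    have h1 : ∀ t : A ⊗[k] A, tensorMul k A V W (TensorProduct.map
        ((TensorProduct.mk k V A).flip d ∘ₗ actV x)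
        ((diagAct actW).flip (y ⊗ₜ e) ∘ₗ Coalgebra.comul) t) =
        U ((Coalgebra.comul (R := k) (A := A)).lTensor A t) := by
      intro t
      induction t with
      | zero => simp
      | add x y hx hy => simp only [map_add, hx, hy]
      | tmul a b =>
        simp only [TensorProduct.map_tmul, LinearMap.comp_apply, LinearMap.flip_apply,
          LinearMap.lTensor_tmul]
        generalize Coalgebra.comul (R := k) b = s
        induction s with
        | zero => simp
        | add x y hx hy => simp only [map_add, LinearMap.add_apply, tmul_add, hx, hy]
        | tmul b c => simp [U, mul_assoc]
    have h2 : ∀ t : A ⊗[k] A, diagAct (tensorAct actV actW) t ((x ⊗ₜ y) ⊗ₜ (d * e)) =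
        U (TensorProduct.assoc k A A A ((Coalgebra.comul (R := k) (A := A)).rTensor A t)) := by
      intro t
      induction t with
      | zero => simp
      | add x y hx hy => simp only [map_add, LinearMap.add_apply, hx, hy]
      | tmul a c =>
        simp only [diagAct_tmul, tensorAct, LinearMap.compl₂_apply, LinearMap.rTensor_tmul]
        generalize Coalgebra.comul (R := k) a = s
        induction s with
        | zero => simp
        | add x y hx hy => simp only [map_add, add_tmul, hx, hy]
        | tmul b c => simp [U]
    rw [tensorMul_tmul, h1, h2, coassoc_apply']

lemma tensor_compat_aux2 (hW : IsYetterDrinfeld actW coactW) (s : V ⊗[k] A) (w : W) (a : A) :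
    tensorMul k A V W (TensorProduct.map ((diagAct actV).flip s ∘ₗ Coalgebra.comul)
      (coactW ∘ₗ actW w) (Coalgebra.comul (R := k) a)) =
    diagAct (tensorAct actV actW) (Coalgebra.comul (R := k) a)
      (tensorMul k A V W (s ⊗ₜ coactW w)) := by
  induction s with
  | zero => simp [LinearMap.zero_comp]
  | add r s hr hs =>
    simp only [map_add, LinearMap.add_comp, TensorProduct.map_add_left, LinearMap.add_apply,
      add_tmul, hr, hs]
  | tmul x d =>
    let R : A ⊗[k] (A ⊗[k] A) →ₗ[k] (V ⊗[k] W) ⊗[k] A :=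
      tensorMul k A V W ∘ₗ TensorProduct.map ((TensorProduct.mk k V A).flip d ∘ₗ actV x)
        (TensorProduct.lift ((leftMul k A W).compl₂ (coactW ∘ₗ actW w)))
    have h1 : ∀ t : A ⊗[k] A, tensorMul k A V W (TensorProduct.map
        ((diagAct actV).flip (x ⊗ₜ d) ∘ₗ Coalgebra.comul) (coactW ∘ₗ actW w) t) =
        R (TensorProduct.assoc k A A A ((Coalgebra.comul (R := k) (A := A)).rTensor A t)) := by
      intro t
      induction t with
      | zero => simp
      | add x y hx hy => simp only [map_add, hx, hy]
      | tmul a c =>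
        simp only [TensorProduct.map_tmul, LinearMap.comp_apply, LinearMap.flip_apply,
          LinearMap.rTensor_tmul]
        generalize Coalgebra.comul (R := k) a = s
        induction s with
        | zero => simp
        | add x y hx hy => simp only [map_add, LinearMap.add_apply, add_tmul, hx, hy]
        | tmul a b => simp [R, tensorMul_leftMul_right]
    have h2 : ∀ t : A ⊗[k] A, R ((Coalgebra.comul (R := k) (A := A)).lTensor A t) =
        tensorMul k A V W (TensorProduct.map ((TensorProduct.mk k V A).flip d ∘ₗ actV x)
          ((diagAct actW).flip (coactW w) ∘ₗ Coalgebra.comul) t) := by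
      intro t
      induction t with
      | zero => simp
      | add x y hx hy => simp only [map_add, hx, hy]
      | tmul a c =>
        have := hW.compat w c
        simp only [conv, LinearMap.comp_apply] at this
        simp [R, this]
    rw [h1, ← coassoc_apply', h2, tensor_compat_aux1]

lemma tensor_compat_aux3 (hV : IsYetterDrinfeld actV coactV) (hW : IsYetterDrinfeld actW coactW)
    (v : V) (w : W) (a : A) :
    conv (leftMul k A (V ⊗[k] W)) (tensorCoact coactV coactW ∘ₗ tensorAct actV actW (v ⊗ₜ w)) a =
    diagAct (tensorAct actV actW) (Coalgebra.comul (R := k) a)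
      (tensorCoact coactV coactW (v ⊗ₜ w)) := by
  let Q : A ⊗[k] (A ⊗[k] A) →ₗ[k] (V ⊗[k] W) ⊗[k] A :=
    TensorProduct.lift ((leftMul k A (V ⊗[k] W)).compl₂ (tensorMul k A V W ∘ₗ
      TensorProduct.map (coactV ∘ₗ actV v) (coactW ∘ₗ actW w)))
  have h1 : ∀ t : A ⊗[k] A, TensorProduct.lift ((leftMul k A (V ⊗[k] W)).compl₂
      (tensorCoact coactV coactW ∘ₗ tensorAct actV actW (v ⊗ₜ w))) t =
      Q ((Coalgebra.comul (R := k) (A := A)).lTensor A t) := by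
    intro t
    induction t with
    | zero => simp
    | add x y hx hy => simp only [map_add, hx, hy]
    | tmul a b =>
      simp only [TensorProduct.lift.tmul, LinearMap.compl₂_apply, LinearMap.comp_apply,
        tensorAct, LinearMap.lTensor_tmul]
      generalize Coalgebra.comul (R := k) b = s
      induction s with
      | zero => simp
      | add x y hx hy => simp only [map_add, tmul_add, hx, hy]
      | tmul b c => simp [Q, tensorCoact]
  have h2 : ∀ t : A ⊗[k] A,
      Q (TensorProduct.assoc k A A A ((Coalgebra.comul (R := k) (A := A)).rTensor A t)) =
      tensorMul k A V W (TensorProduct.map ((diagAct actV).flip (coactV v) ∘ₗ Coalgebra.comul)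
        (coactW ∘ₗ actW w) t) := by
    intro t
    induction t with
    | zero => simp
    | add x y hx hy => simp only [map_add, hx, hy]
    | tmul a c =>
      have e : ∀ s : A ⊗[k] A, Q (TensorProduct.assoc k A A A (s ⊗ₜ c)) =
          tensorMul k A V W (TensorProduct.lift ((leftMul k A V).compl₂ (coactV ∘ₗ actV v)) s ⊗ₜ
            coactW (actW w c)) := by
        intro s
        induction s with
        | zero => simp
        | add x y hx hy => simp only [map_add, add_tmul, hx, hy]
        | tmul a b => simp [Q, tensorMul_leftMul_left]
      have := hV.compat v a
      simp only [conv, LinearMap.comp_apply] at this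
      simp [e, this]
  rw [conv, LinearMap.comp_apply, h1, coassoc_apply', h2, tensor_compat_aux2 hW]
  rfl

end TensorCompat

lemma IsYetterDrinfeld.tensor {actV : V →ₗ[k] A →ₗ[k] V} {actW : W →ₗ[k] A →ₗ[k] W}
    {coactV : V →ₗ[k] V ⊗[k] A} {coactW : W →ₗ[k] W ⊗[k] A}
    (hV : IsYetterDrinfeld actV coactV) (hW : IsYetterDrinfeld actW coactW) :
    IsYetterDrinfeld (tensorAct actV actW) (tensorCoact coactV coactW) := by
  refine .of_compat (fun x => ?_) (fun x a b => ?_) (fun x => ?_) (fun x => ?_) (fun x a => ?_)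
  · induction x with
    | zero => simp
    | add x y hx hy => simp only [map_add, LinearMap.add_apply, hx, hy]
    | tmul v w => simp [tensorAct, Algebra.TensorProduct.one_def, hV.act_one, hW.act_one]
  · simp only [tensorAct, LinearMap.compl₂_apply, Bialgebra.comul_mul]
    exact map₂_comp_mul actV actW hV.act_mul hW.act_mul x _ _
  · induction x with
    | zero => simp
    | add x y hx hy => simp only [map_add, hx, hy]
    | tmul v w =>
      simp only [tensorCoact, LinearMap.comp_apply, TensorProduct.map_tmul]
      rw [rid_tensorMul, hV.coact_counit, hW.coact_counit]
  · induction x with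
    | zero => simp
    | add x y hx hy => simp only [map_add, hx, hy]
    | tmul v w =>
      conv_lhs => rw [tensorCoact, LinearMap.comp_apply, TensorProduct.map_tmul, ← tensorCoact]
      conv_rhs => rw [tensorCoact, LinearMap.comp_apply, TensorProduct.map_tmul]
      rw [coact_tensorMul, comul_tensorMul, hV.coact_coassoc, hW.coact_coassoc]
  · induction x with
    | zero => simp [conv_zero]
    | add x y hx hy =>
      simp only [map_add, LinearMap.comp_add, conv_add, LinearMap.add_apply, hx, hy]
    | tmul v w => exact tensor_compat_aux3 hV hW v w a

end Tensor

section Constructions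

variable {k A B : Type u} [Field k] [Ring A] [HopfAlgebra k A] [Ring B] [HopfAlgebra k B]

/-- The tensor product of Yetter-Drinfeld modules, with the diagonal action
`(x ⊗ y) · a = x · a₁ ⊗ y · a₂` and the codiagonal coaction `x ⊗ y ↦ x₀ ⊗ y₀ ⊗ x₁ y₁`. -/
noncomputable def tensor (X Y : YDModule k A) : YDModule k A where
  carrier := X.carrier ⊗[k] Y.carrier
  act := tensorAct X.act Y.act
  coact := tensorCoact X.coact Y.coact
  isYetterDrinfeld := X.isYetterDrinfeld.tensor Y.isYetterDrinfeld

/-- The subspace `X^(B) = {x | x₀ ⊗ x₁ ∈ X ⊗ B}` for an embedding `i : B → A`. -/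
def part (i : B →ₐc[k] A) (X : YDModule k A) : Submodule k X.carrier :=
  (LinearMap.range ((i : B →ₗ[k] A).lTensor X.carrier)).comap X.coact

lemma twist_mem_range (i : B →ₐc[k] A) (X : YDModule k A) (u : B ⊗[k] (B ⊗[k] B))
    (t : X.carrier ⊗[k] B) :
    twist X.act (TensorProduct.map (i : B →ₗ[k] A)
      (TensorProduct.map (i : B →ₗ[k] A) (i : B →ₗ[k] A)) u)
      ((i : B →ₗ[k] A).lTensor X.carrier t) ∈
      LinearMap.range ((i : B →ₗ[k] A).lTensor X.carrier) := by
  induction u with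
  | zero => simp
  | add u v hu hv =>
    simp only [map_add, LinearMap.add_apply]
    exact add_mem hu hv
  | tmul a u =>
    induction u with
    | zero => simp
    | add u v hu hv =>
      simp only [map_add, tmul_add, LinearMap.add_apply]
      exact add_mem hu hv
    | tmul b c =>
      induction t with
      | zero => simp
      | add s t hs ht =>
        simp only [map_add]
        exact add_mem hs ht
      | tmul x d =>
        refine ⟨X.act x (i b) ⊗ₜ (HopfAlgebra.antipode k a * d * c), ?_⟩
        simp [antipode_map]

lemma comul₃_map (i : B →ₐc[k] A) (b : B) :
    comul₃ k (i b) = TensorProduct.map (i : B →ₗ[k] A)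
      (TensorProduct.map (i : B →ₗ[k] A) (i : B →ₗ[k] A)) (comul₃ k b) := by
  have h : ∀ b, Coalgebra.comul (R := k) (i b) = TensorProduct.map (i : B →ₗ[k] A)
    (i : B →ₗ[k] A) (Coalgebra.comul (R := k) b) :=
    fun b => (CoalgHomClass.map_comp_comul_apply i b).symm
  simp only [comul₃, LinearMap.comp_apply]
  rw [h, map_coassoc_right]

lemma part_stable (i : B →ₐc[k] A) (X : YDModule k A) (x : X.carrier) (hx : x ∈ part i X) (b : B) :
    X.act x (i b) ∈ part i X := by
  obtain ⟨t, ht⟩ := hx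
  change X.coact (X.act x (i b)) ∈ LinearMap.range ((i : B →ₗ[k] A).lTensor X.carrier)
  rw [X.isYetterDrinfeld.coact_act, ← ht, comul₃_map]
  exact twist_mem_range i X _ t

lemma part_costable (i : B →ₐc[k] A) (hi : Function.Injective i) (X : YDModule k A)
    (x : X.carrier) (hx : x ∈ part i X) :
    X.coact x ∈ LinearMap.range (TensorProduct.map (part i X).subtype (i : B →ₗ[k] A)) := by
  let ι : B →ₗ[k] A := (i : B →ₗ[k] A)
  have hι : Function.Injective ι := hi
  let q : A →ₗ[k] A ⧸ LinearMap.range ι := (LinearMap.range ι).mkQ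
  let f : X.carrier →ₗ[k] X.carrier ⊗[k] (A ⧸ LinearMap.range ι) := q.lTensor X.carrier ∘ₗ X.coact
  have hexact : Function.Exact (ι.lTensor X.carrier) (q.lTensor X.carrier) :=
    lTensor_exact X.carrier (LinearMap.exact_map_mkQ_range ι) (Submodule.mkQ_surjective _)
  have hker : LinearMap.ker f = part i X := by
    ext y
    exact hexact (X.coact y)
  obtain ⟨t, ht⟩ := hx
  have hqi : q ∘ₗ ι = 0 := LinearMap.range_mkQ_comp ι
  have hq : q.rTensor A ∘ₗ Coalgebra.comul ∘ₗ ι = 0 := by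
    ext b
    have h : Coalgebra.comul (R := k) (ι b) = TensorProduct.map ι ι
      (Coalgebra.comul (R := k) b) := (CoalgHomClass.map_comp_comul_apply i b).symm
    simp only [LinearMap.comp_apply, h, LinearMap.rTensor]
    rw [TensorProduct.map_map, hqi, TensorProduct.map_zero_left]
    rfl
  have hf : f.rTensor B t = 0 := by
    have hinj : Function.Injective
        (ι.lTensor (X.carrier ⊗[k] (A ⧸ LinearMap.range ι))) :=
      Module.Flat.lTensor_preserves_injective_linearMap ι hι
    apply hinj
    rw [map_zero, ← LinearMap.comp_apply, LinearMap.lTensor_comp_rTensor,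
      ← LinearMap.rTensor_comp_lTensor, LinearMap.comp_apply, ht, LinearMap.rTensor_comp_apply]
    apply (TensorProduct.assoc k X.carrier (A ⧸ LinearMap.range ι) A).injective
    have nat : ∀ s : (X.carrier ⊗[k] A) ⊗[k] A,
        TensorProduct.assoc k X.carrier (A ⧸ LinearMap.range ι) A
          ((q.lTensor X.carrier).rTensor A s) =
        (q.rTensor A).lTensor X.carrier (TensorProduct.assoc k X.carrier A A s) := by
      intro s
      induction s with
      | zero => simp
      | add x y hx hy => simp only [map_add, hx, hy]
      | tmul s a =>
        induction s with
        | zero => simp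
        | add x y hx hy => simp only [map_add, add_tmul, hx, hy]
        | tmul x b => simp
    rw [nat, X.isYetterDrinfeld.coact_coassoc, ← ht, ← LinearMap.lTensor_comp_apply,
      ← LinearMap.lTensor_comp_apply, LinearMap.comp_assoc, hq]
    simp
  obtain ⟨s, hs⟩ := mem_range_of_rTensor_eq_zero f t hf
  rw [← hker]
  refine ⟨s, ?_⟩
  rw [← ht, ← hs, ← LinearMap.comp_apply, LinearMap.lTensor_comp_rTensor]

/-- The Yetter-Drinfeld module `X^(B)` over `B`: the subspace `{x | x₀ ⊗ x₁ ∈ X ⊗ B}` of `X` with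
the action and the coaction of `X`; see `restrict_act` and `restrict_coact`. -/
noncomputable def restrictPart (i : B →ₐc[k] A) (hi : Function.Injective i) (X : YDModule k A) :
    YDModule k B :=
  restrict i hi X (part i X) (part_stable i X) (part_costable i hi X)

/-- Gerstenhaber-Schack cohomology `H_GS^n(A, V) = Ext^n(k, V)` in the category of Yetter-Drinfeld
modules over `A`. -/
abbrev HGS (V : YDModule k A) (n : ℕ) : Type (u + 1) :=
  Abelian.Ext.{u + 1} (triv k A) V n

/-- Bialgebra cohomology `H_b^n(A) = H_GS^n(A, k)`. -/
abbrev Hb (k A : Type u) [Field k] [Ring A] [HopfAlgebra k A] (n : ℕ) : Type (u + 1) :=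
  HGS (triv k A) n

end Constructions

section ExactSequences

variable {k A B L : Type*} [Field k] [Ring A] [HopfAlgebra k A] [Ring B] [HopfAlgebra k B]
  [Ring L] [HopfAlgebra k L]

/-- The subspace `i(B)⁺ = i(B) ∩ Ker(ε)` of `A`. -/
def augmentation (i : B →ₐc[k] A) : Submodule k A :=
  LinearMap.range (i : B →ₗ[k] A) ⊓ LinearMap.ker (Coalgebra.counit (R := k) (A := A))

/-- Exactness of a sequence `k → B → A → L → k` of Hopf algebra maps. -/
structure IsExactSequence (i : B →ₐc[k] A) (p : A →ₐc[k] L) : Prop where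
  injective : Function.Injective i
  surjective : Function.Surjective p
  ker_eq_left : LinearMap.ker (p : A →ₗ[k] L) = ⊤ * augmentation i
  ker_eq_right : LinearMap.ker (p : A →ₗ[k] L) = augmentation i * ⊤
  range_eq_right : ∀ a : A, a ∈ LinearMap.range (i : B →ₗ[k] A) ↔
    (p : A →ₗ[k] L).lTensor A (Coalgebra.comul (R := k) a) = a ⊗ₜ 1
  range_eq_left : ∀ a : A, a ∈ LinearMap.range (i : B →ₗ[k] A) ↔
    (p : A →ₗ[k] L).rTensor A (Coalgebra.comul (R := k) a) = 1 ⊗ₜ a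

/-- A Hopf algebra map `p` is cocentral if `p(a₁) ⊗ a₂ = p(a₂) ⊗ a₁` for all `a`. -/
def IsCocentral (p : A →ₐc[k] L) : Prop :=
  ∀ a : A, (p : A →ₗ[k] L).rTensor A (Coalgebra.comul (R := k) a) =
    (p : A →ₗ[k] L).rTensor A (TensorProduct.comm k A A (Coalgebra.comul (R := k) a))

end ExactSequences

section Characters

variable {k A : Type u} [Field k] [Ring A] [HopfAlgebra k A] {Γ : Type*} [CommGroup Γ]

/-- For a character `ψ` of `Γ`, the algebra map `A → k` that is the composition of `p : A → kΓ`
and the linear extension `kΓ → k` of `ψ`. -/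
noncomputable def charHom (p : A →ₐc[k] MonoidAlgebra k Γ) (ψ : Γ →* kˣ) : A →ₐ[k] k :=
  (MonoidAlgebra.lift k k Γ ((Units.coeHom k).comp ψ)).comp (p : A →ₐ[k] MonoidAlgebra k Γ)

lemma IsCocentral.isCentralChar {p : A →ₐc[k] MonoidAlgebra k Γ} (hp : IsCocentral p)
    (ψ : Γ →* kˣ) : IsCentralChar (charHom p ψ) := fun a => by
  let χ : MonoidAlgebra k Γ →ₗ[k] k :=
    (MonoidAlgebra.lift k k Γ ((Units.coeHom k).comp ψ)).toLinearMap
  have e : (charHom p ψ).toLinearMap = χ ∘ₗ (p : A →ₗ[k] MonoidAlgebra k Γ) := rfl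
  have h : ∀ t : A ⊗[k] A, TensorProduct.rid k A ((charHom p ψ).toLinearMap.lTensor A t) =
      TensorProduct.lid k A ((charHom p ψ).toLinearMap.rTensor A (TensorProduct.comm k A A t)) := by
    intro t
    induction t with
    | zero => simp
    | add x y hx hy => simp only [map_add, hx, hy]
    | tmul a b => simp
  rw [h, e, LinearMap.rTensor_comp_apply, LinearMap.rTensor_comp_apply, hp a]

/-- The one-dimensional Yetter-Drinfeld module `k_ψ` of a character `ψ` of `Γ`. -/
noncomputable def charModule (p : A →ₐc[k] MonoidAlgebra k Γ) (hp : IsCocentral p)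
    (ψ : Γ →* kˣ) : YDModule k A :=
  oneDim (charHom p ψ) (hp.isCentralChar ψ)

end Characters

end YD

/-! Write F for the functor X ↦ X^(B). The isomorphism is the composite of Ext^n(k, F X) ≅ ⊕_ψ
Ext^n(k_ψ, X) with Ext^n(k_ψ⁻¹, X) ≅ Ext^n(k, X ⊗ k_ψ), after reindexing by ψ ↦ ψ⁻¹. The second
holds because X ↦ X ⊗ k_ψ is an autoequivalence (`twistFunctor_isEquivalence`) that sends k_ψ⁻¹ to
k. The first is a dimension shift (`extComparison_bijective`) with three inputs.

Degree 0 (`IsExactSequence.bijective_hom`). A morphism k → F X is a coinvariant x in X on which B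
acts through ε. Since Ker(p) is generated by i(B)⁺, the orbit map a ↦ x · a factors through kΓ. The
hypotheses on k and Γ split 1 in kΓ into the idempotents of the characters, and so x into components
on which A acts through ψ ∘ p. Cocentrality keeps these components coinvariant, so they are
morphisms k_ψ → X.

Exactness of F (`IsProjection.shortExact_map`). The functional σ = "coefficient of 1 in p(a)" gives
a natural linear projection x ↦ x₀ σ(x₁) of X onto X^(B).

Injectives (`IsExactSequence.exists_injective_restrict`). Every X embeds in the cofree module J on a
coinduced module Hom(A, Y). A morphism from V to F J is the same as a B-linear map V → Hom(A, Y),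
that is, a linear map V ⊗_B A → Y. Such maps extend along monomorphisms because A is a finitely
generated projective left B-module: if p(t) is the sum of the elements of Γ, then S(t₁) ⊗ t₂ is a
dual basis for the projection a ↦ a₁ σ(a₂) of A onto B. With B = A this also shows that J itself is
injective. -/

namespace YD

/-! ### The antipode and the comultiplication. -/

section Antipode

variable {k A : Type*} [Field k] [Ring A] [HopfAlgebra k A]

open WithConv in
/-- The antipode is an anti-morphism of coalgebras. -/
lemma comul_antipode (a : A) :
    Coalgebra.comul (R := k) (HopfAlgebra.antipode k a) =
      TensorProduct.map (HopfAlgebra.antipode k) (HopfAlgebra.antipode k)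
        (TensorProduct.comm k A A (Coalgebra.comul (R := k) a)) := by
  let inl : A →ₐ[k] A ⊗[k] A := Algebra.TensorProduct.includeLeft
  let inr : A →ₐ[k] A ⊗[k] A := Algebra.TensorProduct.includeRight
  let S : A →ₗ[k] A := HopfAlgebra.antipode k
  let δ : WithConv (A →ₗ[k] A ⊗[k] A) := toConv Coalgebra.comul
  let F : WithConv (A →ₗ[k] A ⊗[k] A) := toConv (Coalgebra.comul ∘ₗ S)
  let G : WithConv (A →ₗ[k] A ⊗[k] A) :=
    toConv (TensorProduct.map S S ∘ₗ (TensorProduct.comm k A A).toLinearMap ∘ₗ Coalgebra.comul)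
  have hinv : ∀ j : A →ₐ[k] A ⊗[k] A,
      toConv (j.toLinearMap ∘ₗ S) * toConv j.toLinearMap = 1 := by
    intro j
    ext a
    rw [LinearMap.convMul_apply, LinearMap.convOne_apply]
    have e := congrArg j (HopfAlgebra.mul_antipode_rTensor_comul_apply (R := k) a)
    rw [AlgHom.commutes] at e
    rw [← e]
    generalize Coalgebra.comul (R := k) a = t
    induction t with
    | zero => simp
    | add x y hx hy => simp only [map_add, hx, hy]
    | tmul a b => simp [S]
  have h1 : δ = toConv inl.toLinearMap * toConv inr.toLinearMap := by
    ext a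
    rw [LinearMap.convMul_apply]
    change Coalgebra.comul (R := k) a = _
    generalize Coalgebra.comul (R := k) a = t
    induction t with
    | zero => simp
    | add x y hx hy => rw [map_add, map_add, ← hx, ← hy]
    | tmul a b => simp [inl, inr]
  have h2 : G = toConv (inr.toLinearMap ∘ₗ S) * toConv (inl.toLinearMap ∘ₗ S) := by
    ext a
    rw [LinearMap.convMul_apply]
    change TensorProduct.map S S (TensorProduct.comm k A A (Coalgebra.comul (R := k) a)) = _
    generalize Coalgebra.comul (R := k) a = t
    induction t with
    | zero => simp
    | add x y hx hy => simp only [map_add, hx, hy]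
    | tmul a b => simp [inl, inr]
  -- In the convolution algebra Hom(A, A ⊗ A) the comultiplication is the product of the two
  -- inclusions, so inverting them in reverse order gives a left inverse; the comultiplication
  -- composed with S is a right inverse.
  have h3 : G * δ = 1 := by
    rw [h1, h2, mul_assoc, ← mul_assoc (toConv (inl.toLinearMap ∘ₗ S)), hinv, one_mul, hinv]
  have h4 : G = F := left_inv_eq_right_inv h3 LinearMap.comul_right_inv
  exact (LinearMap.congr_fun (congrArg WithConv.ofConv h4) a).symm

end Antipode

/-! ### The cofree Yetter-Drinfeld structure on M ⊗ A. -/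

section Cofree

variable {k A M : Type*} [Field k] [Ring A] [HopfAlgebra k A] [AddCommGroup M] [Module k M]

lemma comul₃_mul (a b : A) : comul₃ k (a * b) = comul₃ k a * comul₃ k b :=
  map_mul ((Algebra.TensorProduct.map (AlgHom.id k A) (Bialgebra.comulAlgHom k A)).comp
    (Bialgebra.comulAlgHom k A)) a b

lemma comul₃_one : comul₃ k (1 : A) = 1 :=
  map_one ((Algebra.TensorProduct.map (AlgHom.id k A) (Bialgebra.comulAlgHom k A)).comp
    (Bialgebra.comulAlgHom k A))

/-- The antipode reverses products, so c ↦ S(a) c b composes as a right action. -/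
lemma twist_mul {act : M →ₗ[k] A →ₗ[k] M} (h : ∀ m a b, act m (a * b) = act (act m a) b)
    (x y : A ⊗[k] (A ⊗[k] A)) (t : M ⊗[k] A) :
    twist act (x * y) t = twist act y (twist act x t) := by
  induction x with
  | zero => simp
  | add x x' hx hx' => simp only [add_mul, map_add, LinearMap.add_apply, hx, hx']
  | tmul a u =>
    induction u with
    | zero => simp
    | add x x' hx hx' => simp only [tmul_add, add_mul, map_add, LinearMap.add_apply, hx, hx']
    | tmul b c =>
      induction y with
      | zero => simp
      | add x x' hx hx' => simp only [mul_add, map_add, LinearMap.add_apply, hx, hx']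
      | tmul a' u =>
        induction u with
        | zero => simp
        | add x x' hx hx' => simp only [tmul_add, mul_add, map_add, LinearMap.add_apply, hx, hx']
        | tmul b' c' =>
          induction t with
          | zero => simp
          | add x x' hx hx' => simp only [map_add, hx, hx']
          | tmul m d => simp [h, HopfAlgebra.antipode_mul_antidistrib, mul_assoc]

/-- The action `(m ⊗ c) · a = m · a₂ ⊗ S(a₁) c a₃` on `M ⊗ A`. -/
noncomputable def cofreeAct (act : M →ₗ[k] A →ₗ[k] M) :
    M ⊗[k] A →ₗ[k] A →ₗ[k] M ⊗[k] A :=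
  (twist act ∘ₗ comul₃ k).flip

lemma cofreeAct_apply (act : M →ₗ[k] A →ₗ[k] M) (t : M ⊗[k] A) (a : A) :
    cofreeAct act t a = twist act (comul₃ k a) t := rfl

/-- The coaction `m ⊗ c ↦ (m ⊗ c₁) ⊗ c₂` on `M ⊗ A`. -/
noncomputable def cofreeCoact (k A M : Type*) [Field k] [Ring A] [HopfAlgebra k A]
    [AddCommGroup M] [Module k M] : M ⊗[k] A →ₗ[k] (M ⊗[k] A) ⊗[k] A :=
  (TensorProduct.assoc k M A A).symm.toLinearMap ∘ₗ Coalgebra.comul.lTensor M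

lemma cofreeCoact_tmul (m : M) (c : A) : cofreeCoact k A M (m ⊗ₜ c) =
    (TensorProduct.assoc k M A A).symm (m ⊗ₜ Coalgebra.comul (R := k) c) := rfl

/-- Left multiplication on the middle factor of `(M ⊗ A) ⊗ A`. -/
noncomputable def midMul (k A M : Type*) [Field k] [Ring A] [HopfAlgebra k A]
    [AddCommGroup M] [Module k M] : A →ₗ[k] Module.End k ((M ⊗[k] A) ⊗[k] A) :=
  LinearMap.rTensorHom A ∘ₗ leftMul k A M

@[simp] lemma midMul_tmul (a : A) (s : M ⊗[k] A) (c : A) :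
    midMul k A M a (s ⊗ₜ c) = leftMul k A M a s ⊗ₜ c := rfl

lemma midMul_conv (φ χ : A →ₗ[k] A)
    (h : LinearMap.mul' k A ∘ₗ TensorProduct.map φ χ ∘ₗ Coalgebra.comul =
      Algebra.linearMap k A ∘ₗ Coalgebra.counit) :
    LinearMap.mul' k _ ∘ₗ TensorProduct.map (midMul k A M ∘ₗ φ) (midMul k A M ∘ₗ χ) ∘ₗ
      Coalgebra.comul =
        Algebra.linearMap k (Module.End k ((M ⊗[k] A) ⊗[k] A)) ∘ₗ Coalgebra.counit := by
  have h1 : ∀ t : A ⊗[k] A, LinearMap.mul' k _ (TensorProduct.map (midMul k A M ∘ₗ φ)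
      (midMul k A M ∘ₗ χ) t) = midMul k A M (LinearMap.mul' k A (TensorProduct.map φ χ t)) := by
    intro t
    induction t with
    | zero => simp
    | add x y hx hy => simp only [map_add, hx, hy]
    | tmul a b =>
      refine TensorProduct.ext' fun s c => ?_
      simp [leftMul_mul]
  ext a : 1
  have h2 := LinearMap.congr_fun h a
  simp only [LinearMap.comp_apply] at h2 ⊢
  rw [h1, h2]
  refine TensorProduct.ext' fun s c => ?_
  simp [Algebra.algebraMap_eq_smul_one, leftMul_one, smul_tmul']

/-- Convolution with S undoes it. Identities in (M ⊗ A) ⊗ A may therefore be checked after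
multiplying a₁ back onto the middle factor, where it cancels the antipode in the cofree action. -/
lemma conv_midMul_injective :
    Function.Injective (conv (midMul k A M) : (A →ₗ[k] (M ⊗[k] A) ⊗[k] A) → _) := by
  have e1 := midMul_conv (M := M) (HopfAlgebra.antipode k) (LinearMap.id (M := A) (R := k)) (by
    have := HopfAlgebra.mul_antipode_rTensor_comul (R := k) (A := A)
    rwa [LinearMap.rTensor] at this)
  rw [LinearMap.comp_id] at e1
  refine Function.LeftInverse.injective
    (g := conv (midMul k A M ∘ₗ HopfAlgebra.antipode k)) fun H => ?_
  rw [conv_conv, e1, conv_counit]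

/-- Multiplicativity of the comultiplication: left multiplication by a on the last factor becomes
left multiplication by a₁ and a₂ on the last two. -/
lemma cofreeCoact_leftMul (a : A) (s : M ⊗[k] A) :
    cofreeCoact k A M (leftMul k A M a s) =
      LinearMap.mul' k _ (TensorProduct.map (midMul k A M) (leftMul k A (M ⊗[k] A))
        (Coalgebra.comul (R := k) a)) (cofreeCoact k A M s) := by
  induction s with
  | zero => simp
  | add x y hx hy => simp only [map_add, hx, hy]
  | tmul m c =>
    rw [leftMul_tmul, cofreeCoact_tmul, cofreeCoact_tmul, Bialgebra.comul_mul]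
    generalize Coalgebra.comul (R := k) a = t
    generalize Coalgebra.comul (R := k) c = r
    induction t with
    | zero => simp
    | add x y hx hy => simp only [add_mul, tmul_add, map_add, LinearMap.add_apply, hx, hy]
    | tmul a b =>
      induction r with
      | zero => simp
      | add x y hx hy => simp only [mul_add, tmul_add, map_add, hx, hy]
      | tmul c d => simp

lemma cofreeCoact_conv (F : A →ₗ[k] M ⊗[k] A) :
    cofreeCoact k A M ∘ₗ conv (leftMul k A M) F =
      conv (midMul k A M) (conv (leftMul k A (M ⊗[k] A)) (cofreeCoact k A M ∘ₗ F)) := by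
  rw [conv_conv]
  ext a
  rw [LinearMap.comp_apply, conv_repr _ _ a (Coalgebra.Repr.arbitrary k a), map_sum,
    conv_repr _ _ a (Coalgebra.Repr.arbitrary k a)]
  exact Finset.sum_congr rfl fun i _ => cofreeCoact_leftMul _ _

lemma conv_cofreeAct (act : M →ₗ[k] A →ₗ[k] M) (t : M ⊗[k] A) (a : A) :
    conv (leftMul k A M) (cofreeAct act t) a = diagAct act (Coalgebra.comul (R := k) a) t :=
  (compat_iff act (cofreeAct act t) t).1 (fun _ => rfl) a

/-- Coassociativity pairs the convolving a₁ with the cofree action, which turns it into the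
antipode-free action m ⊗ c ↦ m · a₁ ⊗ c a₂. -/
lemma conv_midMul_diagAct (act : M →ₗ[k] A →ₗ[k] M) (r : (M ⊗[k] A) ⊗[k] A) (a : A) :
    conv (midMul k A M) ((diagAct (cofreeAct act)).flip r ∘ₗ Coalgebra.comul) a =
      diagAct ((diagAct act ∘ₗ Coalgebra.comul).flip) (Coalgebra.comul (R := k) a) r := by
  induction r with
  | zero => simp [conv_zero]
  | add x y hx hy =>
    simp only [map_add, LinearMap.add_comp, conv_add, LinearMap.add_apply, hx, hy]
  | tmul s c =>
    let T : A ⊗[k] (A ⊗[k] A) →ₗ[k] (M ⊗[k] A) ⊗[k] A :=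
      TensorProduct.map (TensorProduct.lift ((leftMul k A M).compl₂ (cofreeAct act s)))
        (LinearMap.mul k A c) ∘ₗ (TensorProduct.assoc k A A A).symm.toLinearMap
    have h1 : ∀ t : A ⊗[k] A, TensorProduct.lift ((midMul k A M).compl₂
        ((diagAct (cofreeAct act)).flip (s ⊗ₜ c) ∘ₗ Coalgebra.comul)) t =
        T ((Coalgebra.comul (R := k) (A := A)).lTensor A t) := by
      intro t
      induction t with
      | zero => simp
      | add x y hx hy => simp only [map_add, hx, hy]
      | tmul a b =>
        simp only [TensorProduct.lift.tmul, LinearMap.compl₂_apply, LinearMap.comp_apply,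
          LinearMap.lTensor_tmul, LinearMap.flip_apply]
        generalize Coalgebra.comul (R := k) b = t
        induction t with
        | zero => simp
        | add x y hx hy => simp only [map_add, tmul_add, LinearMap.add_apply, hx, hy]
        | tmul b d => simp [T]
    have h2 : ∀ t : A ⊗[k] A,
        T (TensorProduct.assoc k A A A ((Coalgebra.comul (R := k) (A := A)).rTensor A t)) =
        diagAct ((diagAct act ∘ₗ Coalgebra.comul).flip) t (s ⊗ₜ c) := by
      intro t
      induction t with
      | zero => simp
      | add x y hx hy => simp only [map_add, LinearMap.add_apply, hx, hy]
      | tmul a b =>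
        have := conv_cofreeAct act s a
        simp only [conv, LinearMap.comp_apply] at this
        simp [T, this]
    rw [conv, LinearMap.comp_apply, h1, ← Coalgebra.coassoc_apply, h2]

lemma cofreeCoact_diagAct (act : M →ₗ[k] A →ₗ[k] M) (s : M ⊗[k] A) (a : A) :
    cofreeCoact k A M (diagAct act (Coalgebra.comul (R := k) a) s) =
      diagAct ((diagAct act ∘ₗ Coalgebra.comul).flip) (Coalgebra.comul (R := k) a)
        (cofreeCoact k A M s) := by
  induction s with
  | zero => simp
  | add x y hx hy => simp only [map_add, hx, hy]
  | tmul m c =>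
    let T : A ⊗[k] (A ⊗[k] A) →ₗ[k] (M ⊗[k] A) ⊗[k] A :=
      (TensorProduct.assoc k M A A).symm.toLinearMap ∘ₗ
        TensorProduct.map (act m) (LinearMap.mul k (A ⊗[k] A) (Coalgebra.comul (R := k) c))
    have h1 : ∀ t : A ⊗[k] A, cofreeCoact k A M (diagAct act t (m ⊗ₜ c)) =
        T ((Coalgebra.comul (R := k) (A := A)).lTensor A t) := by
      intro t
      induction t with
      | zero => simp
      | add x y hx hy => simp only [map_add, LinearMap.add_apply, hx, hy]
      | tmul a b => simp [T, cofreeCoact_tmul]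
    have h2 : ∀ t : A ⊗[k] A,
        T (TensorProduct.assoc k A A A ((Coalgebra.comul (R := k) (A := A)).rTensor A t)) =
        diagAct ((diagAct act ∘ₗ Coalgebra.comul).flip) t (cofreeCoact k A M (m ⊗ₜ c)) := by
      intro t
      rw [cofreeCoact_tmul]
      simp only [T]
      generalize Coalgebra.comul (R := k) c = r
      induction t with
      | zero => simp
      | add x y hx hy => simp only [map_add, LinearMap.add_apply, hx, hy]
      | tmul a b =>
        induction r with
        | zero => simp
        | add x y hx hy =>
          simp only [map_add, tmul_add, ← hx, ← hy, TensorProduct.map_add_right,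
            LinearMap.comp_add, LinearMap.add_apply, LinearEquiv.coe_coe,
            LinearMap.comp_apply]
        | tmul d e =>
          simp only [LinearMap.rTensor_tmul, TensorProduct.assoc_symm_tmul, diagAct_tmul,
            LinearMap.flip_apply, LinearMap.comp_apply]
          generalize Coalgebra.comul (R := k) a = q
          induction q with
          | zero => simp
          | add x y hx hy => simp only [map_add, add_tmul, LinearMap.add_apply, hx, hy]
          | tmul x y => simp
    rw [h1, ← Coalgebra.coassoc_apply, h2]

lemma isYetterDrinfeld_cofree {act : M →ₗ[k] A →ₗ[k] M} (h1 : ∀ m, act m 1 = m)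
    (h2 : ∀ m a b, act m (a * b) = act (act m a) b) :
    IsYetterDrinfeld (cofreeAct act) (cofreeCoact k A M) := by
  refine .of_compat (fun t => ?_) (fun t a b => ?_) (fun t => ?_) (fun t => ?_) (fun t a => ?_)
  · rw [cofreeAct_apply, comul₃_one, Algebra.TensorProduct.one_def, Algebra.TensorProduct.one_def]
    induction t with
    | zero => simp
    | add x y hx hy => rw [map_add, hx, hy]
    | tmul m c => simp [h1]
  · simp only [cofreeAct_apply, comul₃_mul, twist_mul h2]
  · induction t with
    | zero => simp
    | add x y hx hy => simp only [map_add, hx, hy]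
    | tmul m c =>
      rw [cofreeCoact_tmul]
      have e : ∀ t : A ⊗[k] A, TensorProduct.rid k (M ⊗[k] A)
          ((Coalgebra.counit (R := k) (A := A)).lTensor (M ⊗[k] A)
            ((TensorProduct.assoc k M A A).symm (m ⊗ₜ t))) =
          m ⊗ₜ TensorProduct.rid k A ((Coalgebra.counit (R := k) (A := A)).lTensor A t) := by
        intro t
        induction t with
        | zero => simp
        | add x y hx hy => simp only [map_add, tmul_add, hx, hy]
        | tmul a b => simp
      rw [e, Coalgebra.lTensor_counit_comul]
      simp
  · induction t with
    | zero => simp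
    | add x y hx hy => simp only [map_add, hx, hy]
    | tmul m c =>
      rw [cofreeCoact_tmul]
      let T : A ⊗[k] (A ⊗[k] A) →ₗ[k] (M ⊗[k] A) ⊗[k] (A ⊗[k] A) :=
        (TensorProduct.assoc k M A (A ⊗[k] A)).symm.toLinearMap ∘ₗ TensorProduct.mk k M _ m
      have e1 : ∀ t : A ⊗[k] A, TensorProduct.assoc k (M ⊗[k] A) A A
          ((cofreeCoact k A M).rTensor A ((TensorProduct.assoc k M A A).symm (m ⊗ₜ t))) =
          T (TensorProduct.assoc k A A A
            ((Coalgebra.comul (R := k) (A := A)).rTensor A t)) := by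
        intro t
        induction t with
        | zero => simp
        | add x y hx hy => simp only [map_add, tmul_add, hx, hy]
        | tmul a b =>
          simp only [TensorProduct.assoc_symm_tmul, LinearMap.rTensor_tmul, cofreeCoact_tmul]
          generalize Coalgebra.comul (R := k) a = r
          induction r with
          | zero => simp
          | add x y hx hy => simp only [map_add, tmul_add, add_tmul, hx, hy]
          | tmul x y => simp [T]
      have e2 : ∀ t : A ⊗[k] A, (Coalgebra.comul (R := k) (A := A)).lTensor (M ⊗[k] A)
          ((TensorProduct.assoc k M A A).symm (m ⊗ₜ t)) =
          T ((Coalgebra.comul (R := k) (A := A)).lTensor A t) := by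
        intro t
        induction t with
        | zero => simp
        | add x y hx hy => simp only [map_add, tmul_add, hx, hy]
        | tmul a b => simp [T]
      rw [e1, e2, Coalgebra.coassoc_apply]
  · have e : conv (leftMul k A (M ⊗[k] A)) (cofreeCoact k A M ∘ₗ cofreeAct act t) =
        (diagAct (cofreeAct act)).flip (cofreeCoact k A M t) ∘ₗ Coalgebra.comul := by
      -- After this convolution no antipode is left: for t = m ⊗ c both sides equal (m · a₁ ⊗ c₁ a₂)
      -- ⊗ c₂ a₃.
      apply conv_midMul_injective
      rw [← cofreeCoact_conv]
      ext a
      rw [conv_midMul_diagAct, LinearMap.comp_apply, conv_cofreeAct, cofreeCoact_diagAct]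
    exact LinearMap.congr_fun e a

end Cofree

/-! ### Maps along i : B → A and the universal property of X^(B). -/

section Restriction

variable {k A B : Type u} [Field k] [Ring A] [HopfAlgebra k A] [Ring B] [HopfAlgebra k B]

section TensorMap

variable {k V V' V'' N N' : Type*} [Field k] [AddCommGroup V] [Module k V] [AddCommGroup V']
  [Module k V'] [AddCommGroup V''] [Module k V''] [AddCommGroup N] [Module k N]
  [AddCommGroup N'] [Module k N']

lemma map_rTensor_apply (f : V' →ₗ[k] V'') (h : V →ₗ[k] V') (g : N →ₗ[k] N') (t : V ⊗[k] N) :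
    TensorProduct.map f g (h.rTensor N t) = TensorProduct.map (f ∘ₗ h) g t :=
  LinearMap.congr_fun (LinearMap.map_comp_rTensor _ _ _ _) t

lemma rTensor_map_apply (f : V' →ₗ[k] V'') (h : V →ₗ[k] V') (g : N →ₗ[k] N') (t : V ⊗[k] N) :
    f.rTensor N' (TensorProduct.map h g t) = TensorProduct.map (f ∘ₗ h) g t :=
  LinearMap.congr_fun (LinearMap.rTensor_comp_map _ _ _ _) t

end TensorMap

/-- A linear map from a Yetter-Drinfeld module over `B` to one over `A` that is compatible with
the actions and the coactions along `i : B → A`. -/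
structure IsMapAlong (i : B →ₐc[k] A) {V : YDModule k B} {X : YDModule k A}
    (f : V.carrier →ₗ[k] X.carrier) : Prop where
  map_act : ∀ v b, f (V.act v b) = X.act (f v) (i b)
  map_coact : ∀ v, TensorProduct.map f (i : B →ₗ[k] A) (V.coact v) = X.coact (f v)

lemma isMapAlong_id {V X : YDModule k A} (f : V ⟶ X) :
    IsMapAlong (BialgHom.id k A) (toLin f) :=
  ⟨toLin_act f, toLin_coact f⟩

/-- A map along the identity is a morphism. -/
noncomputable def IsMapAlong.toHom {V X : YDModule k A} {f : V.carrier →ₗ[k] X.carrier}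
    (hf : IsMapAlong (BialgHom.id k A) f) : V ⟶ X :=
  ofLin f hf.map_act hf.map_coact

section Part

variable {i : B →ₐc[k] A} {V W : YDModule k B} {X Y : YDModule k A}

lemma IsMapAlong.mem_part {f : V.carrier →ₗ[k] X.carrier} (hf : IsMapAlong i f) (v : V.carrier) :
    f v ∈ part i X := by
  refine ⟨f.rTensor B (V.coact v), ?_⟩
  rw [← hf.map_coact, ← LinearMap.comp_apply, LinearMap.lTensor_comp_rTensor]

lemma IsMapAlong.comp_hom {f : W.carrier →ₗ[k] X.carrier} (hf : IsMapAlong i f) (g : V ⟶ W) :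
    IsMapAlong i (f ∘ₗ toLin g) where
  map_act v b := by simp [toLin_act, hf.map_act]
  map_coact v := by
    rw [LinearMap.comp_apply, ← hf.map_coact, ← toLin_coact, map_rTensor_apply]

lemma IsMapAlong.hom_comp {f : V.carrier →ₗ[k] X.carrier} (hf : IsMapAlong i f) (g : X ⟶ Y) :
    IsMapAlong i (toLin g ∘ₗ f) where
  map_act v b := by simp [toLin_act, hf.map_act]
  map_coact v := by
    rw [LinearMap.comp_apply, ← toLin_coact, ← hf.map_coact, rTensor_map_apply]

variable (hi : Function.Injective i)

/-- The inclusion of `X^(B)` into `X`. -/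
noncomputable def partι (i : B →ₐc[k] A) (hi : Function.Injective i) (X : YDModule k A) :
    (restrictPart i hi X).carrier →ₗ[k] X.carrier := (part i X).subtype

lemma partι_injective : Function.Injective (partι i hi X) := (part i X).injective_subtype

lemma mem_range_partι (x : X.carrier) (hx : x ∈ part i X) : x ∈ LinearMap.range (partι i hi X) :=
  ⟨(⟨x, hx⟩ : part i X), rfl⟩

lemma isMapAlong_partι : IsMapAlong i (partι i hi X) where
  map_act v b := restrict_act i hi X _ (part_stable i X) (part_costable i hi X) v b
  map_coact v := restrict_coact i hi X _ (part_stable i X) (part_costable i hi X) v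

/-- A map along `i` factors through the inclusion of `X^(B)`. -/
noncomputable def IsMapAlong.lift {f : V.carrier →ₗ[k] X.carrier} (hf : IsMapAlong i f) :
    V ⟶ restrictPart i hi X :=
  ofLin (LinearMap.codRestrict (part i X) f hf.mem_part)
    (fun v b => partι_injective hi (by
      rw [(isMapAlong_partι hi).map_act]
      exact hf.map_act v b))
    (fun v => map_subtype_injective i hi X (part i X) (by
      refine Eq.trans ?_ ((isMapAlong_partι hi).map_coact _).symm
      exact (map_rTensor_apply (part i X).subtype (LinearMap.codRestrict (part i X) f hf.mem_part)
        (i : B →ₗ[k] A) (V.coact v)).trans (hf.map_coact v)))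

@[simp] lemma IsMapAlong.partι_lift {f : V.carrier →ₗ[k] X.carrier} (hf : IsMapAlong i f) :
    partι i hi X ∘ₗ toLin (hf.lift hi) = f := rfl

/-- With `IsMapAlong.lift` this identifies morphisms V → X^(B) with maps V → X along `i`, so that
questions about X^(B) can be answered inside X. -/
lemma isMapAlong_of_hom (g : V ⟶ restrictPart i hi X) :
    IsMapAlong i (partι i hi X ∘ₗ toLin g) :=
  (isMapAlong_partι hi).comp_hom g

lemma hom_ext_partι {g h : V ⟶ restrictPart i hi X}
    (e : partι i hi X ∘ₗ toLin g = partι i hi X ∘ₗ toLin h) : g = h := by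
  ext v
  exact partι_injective hi (LinearMap.congr_fun e v)

end Part

/-! ### The universal property of cofree modules, for maps along i. -/

section CofreeObject

variable {M : Type u} [AddCommGroup M] [Module k M] (act : M →ₗ[k] A →ₗ[k] M)
  (h1 : ∀ m, act m 1 = m) (h2 : ∀ m a b, act m (a * b) = act (act m a) b)

/-- The cofree Yetter-Drinfeld module `M ⊗ A` on a right `A`-module `M`. -/
noncomputable def cofree : YDModule k A where
  carrier := M ⊗[k] A
  act := cofreeAct act
  coact := cofreeCoact k A M
  isYetterDrinfeld := isYetterDrinfeld_cofree h1 h2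

lemma map_twist (i : B →ₐc[k] A) {V W : Type*} [AddCommGroup V] [Module k V]
    [AddCommGroup W] [Module k W] {actV : V →ₗ[k] A →ₗ[k] V} {actW : W →ₗ[k] B →ₗ[k] W}
    (j : W →ₗ[k] V) (hj : ∀ w b, j (actW w b) = actV (j w) (i b))
    (u : B ⊗[k] (B ⊗[k] B)) (t : W ⊗[k] B) :
    TensorProduct.map j (i : B →ₗ[k] A) (twist actW u t) =
      twist actV (TensorProduct.map (i : B →ₗ[k] A)
        (TensorProduct.map (i : B →ₗ[k] A) (i : B →ₗ[k] A)) u)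
        (TensorProduct.map j (i : B →ₗ[k] A) t) := by
  induction u with
  | zero => simp
  | add x y hx hy => simp only [map_add, LinearMap.add_apply, hx, hy]
  | tmul a u =>
    induction u with
    | zero => simp
    | add x y hx hy => simp only [map_add, tmul_add, LinearMap.add_apply, hx, hy]
    | tmul b c =>
      induction t with
      | zero => simp
      | add x y hx hy => simp only [map_add, hx, hy]
      | tmul w d => simp [hj, antipode_map]

/-- The map is v ↦ m(v₀) ⊗ i(v₁). Linearity comes from the Yetter-Drinfeld condition on V, since the
cofree action copies its right-hand side; colinearity is coassociativity. -/
lemma isMapAlong_cofreeLift (i : B →ₐc[k] A) {V : YDModule k B} (m : V.carrier →ₗ[k] M)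
    (hm : ∀ v b, m (V.act v b) = act (m v) (i b)) :
    IsMapAlong i (X := cofree act h1 h2)
      (TensorProduct.map m (i : B →ₗ[k] A) ∘ₗ V.coact) where
  map_act v b := by
    change TensorProduct.map m (i : B →ₗ[k] A) (V.coact (V.act v b)) =
      twist act (comul₃ k (i b)) (TensorProduct.map m (i : B →ₗ[k] A) (V.coact v))
    rw [V.isYetterDrinfeld.coact_act, map_twist i m hm, comul₃_map]
  map_coact v := by
    change TensorProduct.map (TensorProduct.map m (i : B →ₗ[k] A) ∘ₗ V.coact) _ (V.coact v) =
      (TensorProduct.assoc k M A A).symm (Coalgebra.comul.lTensor M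
        (TensorProduct.map m (i : B →ₗ[k] A) (V.coact v)))
    rw [← map_coassoc_right i m, ← V.isYetterDrinfeld.coact_coassoc, LinearEquiv.eq_symm_apply,
      ← LinearMap.map_comp_rTensor, LinearMap.comp_apply]
    generalize V.coact.rTensor B (V.coact v) = t
    induction t with
    | zero => simp
    | add x y hx hy => simp only [map_add, hx, hy]
    | tmul s b =>
      induction s with
      | zero => simp
      | add x y hx hy => simp only [map_add, add_tmul, hx, hy]
      | tmul v c => simp

/-- The map `m ⊗ a ↦ ε(a) m`. -/
noncomputable def cofreeCounit (k A M : Type*) [Field k] [Ring A] [HopfAlgebra k A]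
    [AddCommGroup M] [Module k M] : M ⊗[k] A →ₗ[k] M :=
  (TensorProduct.rid k M).toLinearMap ∘ₗ (Coalgebra.counit (R := k) (A := A)).lTensor M

@[simp] lemma cofreeCounit_tmul (m : M) (a : A) :
    cofreeCounit k A M (m ⊗ₜ a) = Coalgebra.counit (R := k) a • m := by
  simp [cofreeCounit]

lemma cofreeCounit_twist (u : A ⊗[k] (A ⊗[k] A)) (t : M ⊗[k] A) :
    cofreeCounit k A M (twist act u t) = act (cofreeCounit k A M t)
      (TensorProduct.lid k A ((Coalgebra.counit (R := k) (A := A)).rTensor A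
        (((TensorProduct.rid k A).toLinearMap ∘ₗ
          (Coalgebra.counit (R := k) (A := A)).lTensor A).lTensor A u))) := by
  induction u with
  | zero => simp
  | add x y hx hy => simp only [map_add, LinearMap.add_apply, hx, hy]
  | tmul a u =>
    induction u with
    | zero => simp
    | add x y hx hy => simp only [map_add, tmul_add, LinearMap.add_apply, hx, hy]
    | tmul b c =>
      induction t with
      | zero => simp
      | add x y hx hy => simp only [map_add, LinearMap.add_apply, hx, hy]
      | tmul m d =>
        simp [Bialgebra.counit_mul, smul_smul]
        congr 1
        ring

/-- The counit is multiplicative and invariant under S, so in m · a₂ ⊗ S(a₁) c a₃ the outer factors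
a₁ and a₃ are absorbed. -/
lemma cofreeCounit_act (t : M ⊗[k] A) (a : A) :
    cofreeCounit k A M (cofreeAct act t a) = act (cofreeCounit k A M t) a := by
  rw [cofreeAct_apply, cofreeCounit_twist, comul₃, LinearMap.comp_apply,
    ← LinearMap.lTensor_comp_apply]
  have h : ((TensorProduct.rid k A).toLinearMap ∘ₗ
      (Coalgebra.counit (R := k) (A := A)).lTensor A) ∘ₗ Coalgebra.comul = LinearMap.id := by
    ext a
    simp
  rw [h]
  simp

lemma rTensor_cofreeCounit (t : M ⊗[k] A) :
    (cofreeCounit k A M).rTensor A (cofreeCoact k A M t) = t := by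
  induction t with
  | zero => simp
  | add x y hx hy => simp only [map_add, hx, hy]
  | tmul m c =>
    have e : ∀ t : A ⊗[k] A, (cofreeCounit k A M).rTensor A
        ((TensorProduct.assoc k M A A).symm (m ⊗ₜ t)) =
        m ⊗ₜ TensorProduct.lid k A ((Coalgebra.counit (R := k) (A := A)).rTensor A t) := by
      intro t
      induction t with
      | zero => simp
      | add x y hx hy => simp only [map_add, tmul_add, hx, hy]
      | tmul a b => simp [smul_tmul]
    rw [cofreeCoact_tmul, e]
    simp

variable {act h1 h2}

/-- Uniqueness in the universal property: the coaction of M ⊗ A followed by the counit on the middle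
factor is the identity, so colinearity recovers f from its composite with the counit. Maps along `i`
into the cofree module thus amount to B-linear maps into M. -/
lemma IsMapAlong.eq_cofreeLift {i : B →ₐc[k] A} {V : YDModule k B}
    {f : V.carrier →ₗ[k] (cofree act h1 h2).carrier} (hf : IsMapAlong i f) :
    TensorProduct.map (cofreeCounit k A M ∘ₗ f) (i : B →ₗ[k] A) ∘ₗ V.coact = f := by
  ext v
  exact (rTensor_map_apply (cofreeCounit k A M) f (i : B →ₗ[k] A) (V.coact v)).symm.trans
    ((congrArg ((cofreeCounit k A M).rTensor A) (hf.map_coact v)).trans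
      (rTensor_cofreeCounit (M := M) (f v)))

end CofreeObject

/-! ### Coinduced modules, extension of maps, and enough injectives. -/

section Coinduced

variable {Y : Type u} [AddCommGroup Y] [Module k Y]

/-- The action `(f · b)(c) = f(b c)` of `A` on `Hom(A, Y)`. -/
noncomputable def coindAct (k A Y : Type*) [Field k] [Ring A] [HopfAlgebra k A]
    [AddCommGroup Y] [Module k Y] : (A →ₗ[k] Y) →ₗ[k] A →ₗ[k] (A →ₗ[k] Y) :=
  LinearMap.mk₂ k (fun f b => f ∘ₗ LinearMap.mulLeft k b)
    (fun _ _ _ => rfl) (fun _ _ _ => rfl)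
    (fun f a b => by ext; simp [add_mul]) (fun c f a => by ext; simp)

@[simp] lemma coindAct_apply (f : A →ₗ[k] Y) (b c : A) : coindAct k A Y f b c = f (b * c) := rfl

/-- The cofree Yetter-Drinfeld module on the coinduced module `Hom(A, Y)`. -/
noncomputable def coind (k A Y : Type u) [Field k] [Ring A] [HopfAlgebra k A]
    [AddCommGroup Y] [Module k Y] : YDModule k A :=
  cofree (coindAct k A Y) (fun f => by ext; simp) (fun f a b => by ext; simp [mul_assoc])

/-- A `B`-linear map `π : A → B` and a tensor `D = ∑ u ⊗ v` with `∑ π(a u) v = a`, a dual basis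
of the left `B`-module `A`. -/
def IsDualBasis (i : B →ₐc[k] A) (π : A →ₗ[k] B) (D : A ⊗[k] A) : Prop :=
  (∀ b a, π (i b * a) = b * π a) ∧
  ∀ a, LinearMap.mul' k A (TensorProduct.map ((i : B →ₗ[k] A) ∘ₗ π ∘ₗ LinearMap.mulLeft k a)
    LinearMap.id D) = a

lemma isDualBasis_id : IsDualBasis (BialgHom.id k A) LinearMap.id (1 ⊗ₜ 1) :=
  ⟨fun _ _ => rfl, fun a => by simp⟩

/-- A B-linear map V → Hom(A, Y) is a linear map V ⊗_B A → Y. The dual basis makes A projective over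
B, so V ⊗_B A → W ⊗_B A stays injective, and a linear map to the vector space Y extends along it.
The proof gives the extension by a formula. -/
lemma IsDualBasis.exists_extension {i : B →ₐc[k] A} {π : A →ₗ[k] B} {D : A ⊗[k] A}
    (hD : IsDualBasis i π D) {V W : YDModule k B} (j : V ⟶ W) [Mono j]
    (m : V.carrier →ₗ[k] A →ₗ[k] Y)
    (hm : ∀ v b, m (V.act v b) = coindAct k A Y (m v) (i b)) :
    ∃ g : W.carrier →ₗ[k] A →ₗ[k] Y,
      (∀ w b, g (W.act w b) = coindAct k A Y (g w) (i b)) ∧ g ∘ₗ toLin j = m := by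
  -- The retraction r is only k-linear; B-linearity of the extension will come from that of π.
  obtain ⟨r, hr⟩ := (toLin j).exists_leftInverse_of_injective
    (LinearMap.ker_eq_bot.2 (injective_of_mono j))
  have hr' : ∀ v, r (toLin j v) = v := LinearMap.congr_fun hr
  obtain ⟨s, hs⟩ := TensorProduct.exists_finset D
  have hsum : ∀ a, ∑ x ∈ s, i (π (a * x.1)) * x.2 = a := fun a => by
    conv_rhs => rw [← hD.2 a, hs]
    simp
  -- In W ⊗_B A one has w ⊗ a = ∑ w · π(a u) ⊗ v; apply r to the first factor, then m.
  let g : W.carrier →ₗ[k] A →ₗ[k] Y := LinearMap.mk₂ k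
    (fun w a => ∑ x ∈ s, m (r (W.act w (π (a * x.1)))) x.2)
    (fun w w' a => by simp [Finset.sum_add_distrib])
    (fun c w a => by simp [Finset.smul_sum])
    (fun w a a' => by simp [add_mul, Finset.sum_add_distrib])
    (fun c w a => by simp [Finset.smul_sum])
  have hg : ∀ w a, g w a = ∑ x ∈ s, m (r (W.act w (π (a * x.1)))) x.2 := fun _ _ => rfl
  refine ⟨g, fun w b => ?_, ?_⟩
  · ext a
    rw [coindAct_apply, hg, hg]
    simp only [← W.isYetterDrinfeld.act_mul, ← hD.1, mul_assoc]
  · ext v a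
    rw [LinearMap.comp_apply, hg]
    simp only [← toLin_act, hr', hm, coindAct_apply]
    rw [← map_sum, hsum]

/-- By the universal property of the cofree module it is enough to extend the composite of f with
the counit, which is a B-linear map into Hom(A, Y). -/
lemma IsDualBasis.exists_extension_along {i : B →ₐc[k] A} {π : A →ₗ[k] B} {D : A ⊗[k] A}
    (hD : IsDualBasis i π D) {V W : YDModule k B} (j : V ⟶ W) [Mono j]
    {f : V.carrier →ₗ[k] (coind k A Y).carrier} (hf : IsMapAlong i f) :
    ∃ g : W.carrier →ₗ[k] (coind k A Y).carrier, IsMapAlong i g ∧ g ∘ₗ toLin j = f := by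
  obtain ⟨g, hg, hgj⟩ := hD.exists_extension j (cofreeCounit k A (A →ₗ[k] Y) ∘ₗ f) (fun v b =>
    (congrArg (cofreeCounit k A (A →ₗ[k] Y)) (hf.map_act v b)).trans
      (cofreeCounit_act (coindAct k A Y) (f v) (i b)))
  refine ⟨_, isMapAlong_cofreeLift _ _ _ i g hg, ?_⟩
  ext v
  rw [← hf.eq_cofreeLift]
  change TensorProduct.map g (i : B →ₗ[k] A) (W.coact (toLin j v)) =
    TensorProduct.map (cofreeCounit k A (A →ₗ[k] Y) ∘ₗ f) (i : B →ₗ[k] A) (V.coact v)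
  rw [← toLin_coact, map_rTensor_apply, hgj]

/-- The extension argument with B = A and the trivial dual basis 1 ⊗ 1. -/
instance injective_coind : Injective (coind k A Y) where
  factors f j _ := by
    obtain ⟨g, hg, e⟩ := isDualBasis_id.exists_extension_along j (isMapAlong_id f)
    exact ⟨hg.toHom, by ext : 1; exact e⟩

lemma IsDualBasis.injective_restrictPart_coind {i : B →ₐc[k] A} {π : A →ₗ[k] B} {D : A ⊗[k] A}
    (hD : IsDualBasis i π D) (hi : Function.Injective i) :
    Injective (restrictPart i hi (coind k A Y)) where
  factors f j _ := by
    obtain ⟨g, hg, e⟩ := hD.exists_extension_along j (isMapAlong_of_hom hi f)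
    exact ⟨hg.lift hi, hom_ext_partι hi (by
      rw [toLin_comp, ← LinearMap.comp_assoc, hg.partι_lift, e])⟩

/-- The embedding of `X` into an injective object. -/
noncomputable def toCoind (X : YDModule k A) : X ⟶ coind k A X.carrier :=
  (isMapAlong_cofreeLift (coindAct k A X.carrier) _ _ (BialgHom.id k A) X.act
    (fun v b => by ext a; exact (X.isYetterDrinfeld.act_mul v b a).symm)).toHom

/-- The element x is recovered from (x₀ · –) ⊗ x₁ by applying ε to the second factor and evaluating
the first at 1. -/
instance mono_toCoind (X : YDModule k A) : Mono (toCoind X) := by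
  refine mono_of_injective _ (Function.LeftInverse.injective
    (g := fun t => cofreeCounit k A (A →ₗ[k] X.carrier) t 1) fun x => ?_)
  have e := map_rid_counit (BialgHom.id k A) X.act (X.coact x)
  rw [X.isYetterDrinfeld.coact_counit] at e
  exact (LinearMap.congr_fun e.symm 1).trans (X.isYetterDrinfeld.act_one x)

instance : EnoughInjectives (YDModule k A) where
  presentation X := ⟨⟨coind k A X.carrier, inferInstance, toCoind X, inferInstance⟩⟩

end Coinduced

end Restriction

/-! ### The projection of A onto B defined by an integral on L. -/

section Projection

variable {k A B L : Type*} [Field k] [Ring A] [HopfAlgebra k A] [Ring B] [HopfAlgebra k B]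
  [Ring L] [HopfAlgebra k L]

/-- The map `a ↦ a₁ σ(a₂)`. -/
noncomputable def slice (σ : A →ₗ[k] k) : A →ₗ[k] A :=
  (TensorProduct.rid k A).toLinearMap ∘ₗ σ.lTensor A ∘ₗ Coalgebra.comul

lemma comul_slice (σ : A →ₗ[k] k) (a : A) :
    Coalgebra.comul (R := k) (slice σ a) = (slice σ).lTensor A (Coalgebra.comul (R := k) a) := by
  let T : A ⊗[k] (A ⊗[k] A) →ₗ[k] A ⊗[k] A :=
    ((TensorProduct.rid k A).toLinearMap ∘ₗ σ.lTensor A).lTensor A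
  have h1 : ∀ t : A ⊗[k] A, Coalgebra.comul (R := k) (TensorProduct.rid k A (σ.lTensor A t)) =
      T (TensorProduct.assoc k A A A ((Coalgebra.comul (R := k) (A := A)).rTensor A t)) := by
    intro t
    induction t with
    | zero => simp
    | add x y hx hy => simp only [map_add, hx, hy]
    | tmul a b =>
      simp only [LinearMap.lTensor_tmul, LinearMap.rTensor_tmul, TensorProduct.rid_tmul, map_smul]
      generalize Coalgebra.comul (R := k) a = s
      induction s with
      | zero => simp
      | add x y hx hy => simp only [smul_add, map_add, add_tmul, hx, hy]
      | tmul c d => simp [T]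
  refine (h1 _).trans ?_
  rw [Coalgebra.coassoc_apply]
  simp only [T]
  rw [← LinearMap.lTensor_comp_apply]
  rfl

lemma map_slice (p : A →ₐc[k] L) (τ : L →ₗ[k] k) (a : A) :
    p (slice (τ ∘ₗ (p : A →ₗ[k] L)) a) = slice τ (p a) := by
  have h : Coalgebra.comul (R := k) (p a) = TensorProduct.map (p : A →ₗ[k] L) (p : A →ₗ[k] L)
      (Coalgebra.comul (R := k) a) := (CoalgHomClass.map_comp_comul_apply p a).symm
  simp only [slice, LinearMap.comp_apply, h]
  generalize Coalgebra.comul (R := k) a = t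
  induction t with
  | zero => simp
  | add x y hx hy => simp only [map_add, hx, hy]
  | tmul a c => simp

/-- The functional `σ` on `A` restricts to the counit of `B`, and `a₁ σ(a₂) = i(π(a))`. -/
structure IsProjection (i : B →ₐc[k] A) (π : A →ₗ[k] B) (σ : A →ₗ[k] k) : Prop where
  apply_eq : ∀ a, i (π a) = slice σ a
  counit : ∀ b, σ (i b) = Coalgebra.counit (R := k) b

section Exact

variable {i : B →ₐc[k] A} {p : A →ₐc[k] L}

/-- Apply ε to the first factor of the coinvariance identity for i(b). -/
lemma IsExactSequence.map_incl (h : IsExactSequence i p) (b : B) :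
    p (i b) = algebraMap k L (Coalgebra.counit (R := k) b) := by
  have e1 := (h.range_eq_right (i b)).1 ⟨b, rfl⟩
  have e2 : ∀ t : A ⊗[k] A, TensorProduct.lid k L ((Coalgebra.counit (R := k) (A := A)).rTensor L
      ((p : A →ₗ[k] L).lTensor A t)) =
      p (TensorProduct.lid k A ((Coalgebra.counit (R := k) (A := A)).rTensor A t)) := by
    intro t
    induction t with
    | zero => simp
    | add x y hx hy => simp only [map_add, hx, hy]
    | tmul a b => simp
  have e3 := e2 (Coalgebra.comul (R := k) (i b))
  rw [e1, Coalgebra.rTensor_counit_comul] at e3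
  have h' : Coalgebra.counit (R := k) (i b) = Coalgebra.counit (R := k) b :=
    CoalgHomClass.counit_comp_apply i b
  simpa [h', Algebra.algebraMap_eq_smul_one] using e3.symm

/-- The condition on τ is that of an integral, l₁ τ(l₂) = τ(l) 1. It turns a₁ ⊗ p(a₂) τ(p(a₃)) into
a₁ τ(p(a₂)) ⊗ 1, so the slice is coinvariant, and exactness says that coinvariants lie in i(B). -/
lemma IsExactSequence.slice_mem_range (h : IsExactSequence i p) {τ : L →ₗ[k] k}
    (hτ : ∀ l, slice τ l = τ l • (1 : L)) (a : A) :
    slice (τ ∘ₗ (p : A →ₗ[k] L)) a ∈ LinearMap.range (i : B →ₗ[k] A) := by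
  rw [h.range_eq_right, comul_slice, ← LinearMap.lTensor_comp_apply]
  have e : (p : A →ₗ[k] L) ∘ₗ slice (τ ∘ₗ (p : A →ₗ[k] L)) =
      LinearMap.toSpanSingleton k L 1 ∘ₗ τ ∘ₗ (p : A →ₗ[k] L) := by
    ext a
    exact (map_slice p τ a).trans (hτ _)
  rw [e, slice]
  simp only [LinearMap.comp_apply]
  generalize Coalgebra.comul (R := k) a = t
  induction t with
  | zero => simp
  | add x y hx hy => simp only [map_add, LinearEquiv.coe_coe, add_tmul, hx, hy]
  | tmul a c => simp [smul_tmul']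

lemma IsExactSequence.exists_isProjection (h : IsExactSequence i p) {τ : L →ₗ[k] k}
    (hτ : ∀ l, slice τ l = τ l • (1 : L)) (hτ1 : τ 1 = 1) :
    ∃ π : A →ₗ[k] B, IsProjection i π (τ ∘ₗ (p : A →ₗ[k] L)) := by
  let e := LinearEquiv.ofInjective (i : B →ₗ[k] A) h.injective
  refine ⟨e.symm.toLinearMap ∘ₗ LinearMap.codRestrict _ (slice (τ ∘ₗ (p : A →ₗ[k] L)))
    (h.slice_mem_range hτ), fun a => ?_, fun b => ?_⟩
  · exact congrArg Subtype.val (e.apply_symm_apply ⟨_, h.slice_mem_range hτ a⟩)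
  · change τ (p (i b)) = _
    rw [h.map_incl, Algebra.algebraMap_eq_smul_one, map_smul, hτ1, smul_eq_mul, mul_one]

/-- The map `A → A ⊗ L`, `a ↦ a₁ ⊗ p(a₂)`. -/
noncomputable def coactAlgHom (p : A →ₐc[k] L) : A →ₐ[k] A ⊗[k] L :=
  (Algebra.TensorProduct.map (AlgHom.id k A) (p : A →ₐ[k] L)).comp (Bialgebra.comulAlgHom k A)

lemma coactAlgHom_apply (p : A →ₐc[k] L) (a : A) :
    coactAlgHom p a = (p : A →ₗ[k] L).lTensor A (Coalgebra.comul (R := k) a) := rfl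

/-- The map `a ⊗ l ↦ τ(l) a`. -/
noncomputable def evalRight (A : Type*) {k L : Type*} [Field k] [Ring A] [Algebra k A]
    [Ring L] [Algebra k L] (τ : L →ₗ[k] k) : A ⊗[k] L →ₗ[k] A :=
  (TensorProduct.rid k A).toLinearMap ∘ₗ τ.lTensor A

@[simp] lemma evalRight_tmul (τ : L →ₗ[k] k) (a : A) (l : L) :
    evalRight A τ (a ⊗ₜ l) = τ l • a := by simp [evalRight]

lemma slice_eq_evalRight (τ : L →ₗ[k] k) (a : A) :
    slice (τ ∘ₗ (p : A →ₗ[k] L)) a = evalRight A τ (coactAlgHom p a) := by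
  rw [coactAlgHom_apply, evalRight, slice, LinearMap.lTensor_comp]
  rfl

lemma evalRight_mul (τ : L →ₗ[k] k) (a : A) (t : A ⊗[k] L) :
    evalRight A τ ((a ⊗ₜ 1) * t) = a * evalRight A τ t := by
  induction t with
  | zero => simp
  | add x y hx hy => simp only [map_add, mul_add, hx, hy]
  | tmul b l => simp

lemma coactAlgHom_antipode (p : A →ₐc[k] L) (a : A) :
    coactAlgHom p (HopfAlgebra.antipode k a) =
      TensorProduct.map (HopfAlgebra.antipode k) (HopfAlgebra.antipode k ∘ₗ (p : A →ₗ[k] L))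
        (TensorProduct.comm k A A (Coalgebra.comul (R := k) a)) := by
  rw [coactAlgHom_apply, comul_antipode]
  generalize TensorProduct.comm k A A (Coalgebra.comul (R := k) a) = t
  induction t with
  | zero => simp
  | add x y hx hy => simp only [map_add, hx, hy]
  | tmul a b => simp [antipode_map]

/-- For y = a ⊗ l, comultiplicativity of S up to the flip makes the left side a S(t₂) t₃ τ(l
S(p(t₁))), where S(t₂) t₃ collapses to the counit. This is the computation behind the dual basis. -/
lemma sum_evalRight_antipode (p : A →ₐc[k] L) (τ : L →ₗ[k] k) (y : A ⊗[k] L) (t : A) :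
    LinearMap.mul' k A (TensorProduct.map (evalRight A τ ∘ₗ LinearMap.mulLeft k y ∘ₗ
      (coactAlgHom p).toLinearMap ∘ₗ HopfAlgebra.antipode k) LinearMap.id
        (Coalgebra.comul (R := k) t)) =
      evalRight A τ (y * (1 ⊗ₜ HopfAlgebra.antipode k (p t))) := by
  induction y with
  | zero => simp [LinearMap.zero_comp]
  | add x y hx hy =>
    rw [add_mul, map_add, ← hx, ← hy]
    generalize Coalgebra.comul (R := k) t = s
    induction s with
    | zero => simp
    | add x y hx hy => simp only [map_add, hx, hy]; abel
    | tmul a b => simp [add_mul]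
  | tmul a l =>
    let ν : A →ₗ[k] k := τ ∘ₗ LinearMap.mulLeft k l ∘ₗ HopfAlgebra.antipode k ∘ₗ (p : A →ₗ[k] L)
    let K : A ⊗[k] (A ⊗[k] A) →ₗ[k] A := LinearMap.mulLeft k a ∘ₗ
      (TensorProduct.lid k A).toLinearMap ∘ₗ TensorProduct.map ν
        (LinearMap.mul' k A ∘ₗ (HopfAlgebra.antipode k).rTensor A)
    have h1 : ∀ s : A ⊗[k] A, LinearMap.mul' k A (TensorProduct.map (evalRight A τ ∘ₗ
        LinearMap.mulLeft k (a ⊗ₜ l) ∘ₗ (coactAlgHom p).toLinearMap ∘ₗ HopfAlgebra.antipode k)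
        LinearMap.id s) =
        K (TensorProduct.assoc k A A A ((Coalgebra.comul (R := k) (A := A)).rTensor A s)) := by
      intro s
      induction s with
      | zero => simp
      | add x y hx hy => simp only [map_add, hx, hy]
      | tmul b c =>
        simp only [TensorProduct.map_tmul, LinearMap.comp_apply, AlgHom.toLinearMap_apply,
          coactAlgHom_antipode, LinearMap.rTensor_tmul]
        generalize Coalgebra.comul (R := k) b = r
        induction r with
        | zero => simp
        | add x y hx hy => simp only [map_add, add_tmul, hx, hy]
        | tmul b d => simp [K, ν, mul_assoc]
    have h2 : ∀ s : A ⊗[k] A, K ((Coalgebra.comul (R := k) (A := A)).lTensor A s) =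
        ν (TensorProduct.rid k A ((Coalgebra.counit (R := k) (A := A)).lTensor A s)) • a := by
      intro s
      induction s with
      | zero => simp
      | add x y hx hy => simp only [map_add, add_smul, hx, hy]
      | tmul b c =>
        simp only [LinearMap.lTensor_tmul, K, LinearMap.comp_apply, TensorProduct.map_tmul,
          HopfAlgebra.mul_antipode_rTensor_comul_apply]
        simp [Algebra.algebraMap_eq_smul_one, smul_smul]
    rw [h1, Coalgebra.coassoc_apply, h2]
    simp [ν]

end Exact

end Projection

/-! ### The dual basis of A over B. -/

section DualBasis

variable {k A B : Type u} {L : Type*} [Field k] [Ring A] [HopfAlgebra k A] [Ring B]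
  [HopfAlgebra k B] [Ring L] [HopfAlgebra k L] {i : B →ₐc[k] A} {p : A →ₐc[k] L}

/-- The hypotheses say that S(p(t)) is a left integral of L normalised by τ. Hence the sum for a
reduces to a₁ τ(p(a₂) S(p(t))) = a₁ ε(a₂) = a. The projection is B-linear because elements of i(B)
are coinvariant. -/
lemma IsExactSequence.isDualBasis (h : IsExactSequence i p) {τ : L →ₗ[k] k} {π : A →ₗ[k] B}
    (hπ : IsProjection i π (τ ∘ₗ (p : A →ₗ[k] L))) {t : A}
    (ht : ∀ l, l * HopfAlgebra.antipode k (p t) =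
      Coalgebra.counit (R := k) l • HopfAlgebra.antipode k (p t))
    (ht1 : τ (HopfAlgebra.antipode k (p t)) = 1) :
    IsDualBasis i π ((HopfAlgebra.antipode k).rTensor A (Coalgebra.comul (R := k) t)) := by
  refine ⟨fun b a => h.injective ?_, fun a => ?_⟩
  · rw [map_mul i, hπ.apply_eq, hπ.apply_eq, slice_eq_evalRight, slice_eq_evalRight, map_mul]
    have e : coactAlgHom p (i b) = i b ⊗ₜ 1 := (h.range_eq_right (i b)).1 ⟨b, rfl⟩
    rw [e, evalRight_mul]
  · have e : ((i : B →ₗ[k] A) ∘ₗ π ∘ₗ LinearMap.mulLeft k a) ∘ₗ HopfAlgebra.antipode k =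
        evalRight A τ ∘ₗ LinearMap.mulLeft k (coactAlgHom p a) ∘ₗ
          (coactAlgHom p).toLinearMap ∘ₗ HopfAlgebra.antipode k := by
      ext x
      refine (hπ.apply_eq _).trans ?_
      rw [slice_eq_evalRight]
      simp
    rw [map_rTensor_apply, e, sum_evalRight_antipode, coactAlgHom_apply]
    have e2 : ∀ s : A ⊗[k] A, evalRight A τ ((p : A →ₗ[k] L).lTensor A s *
        (1 ⊗ₜ HopfAlgebra.antipode k (p t))) =
        TensorProduct.rid k A ((Coalgebra.counit (R := k) (A := A)).lTensor A s) := by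
      intro s
      induction s with
      | zero => simp
      | add x y hx hy => simp only [map_add, add_mul, hx, hy]
      | tmul b c =>
        have hc : Coalgebra.counit (R := k) (p c) = Coalgebra.counit (R := k) c :=
          CoalgHomClass.counit_comp_apply p c
        simp [ht, ht1, hc]
    rw [e2, Coalgebra.lTensor_counit_comul]
    simp

end DualBasis

/-! ### Integrals on and in the group algebra. -/

section GroupAlgebra

variable {k : Type*} [Field k] {Γ : Type*} [CommGroup Γ]

/-- The coefficient of `1` of an element of the group algebra. -/
noncomputable def coeffOne (k Γ : Type*) [Field k] [CommGroup Γ] : MonoidAlgebra k Γ →ₗ[k] k :=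
  Finsupp.lapply 1 ∘ₗ (MonoidAlgebra.coeffLinearEquiv k).toLinearMap

open Classical in
lemma coeffOne_single (g : Γ) (c : k) :
    coeffOne k Γ (MonoidAlgebra.single g c) = if g = 1 then c else 0 :=
  Finsupp.single_apply

/-- Group elements are grouplike, so the slice of g is τ(g) g, and τ(g) vanishes unless g = 1. -/
lemma slice_coeffOne (l : MonoidAlgebra k Γ) :
    slice (coeffOne k Γ) l = coeffOne k Γ l • (1 : MonoidAlgebra k Γ) := by
  induction l using MonoidAlgebra.induction_linear with
  | zero => simp
  | add x y hx hy => rw [map_add, map_add, hx, hy, add_smul]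
  | single g c =>
    have h : slice (coeffOne k Γ) (MonoidAlgebra.single g c) =
        coeffOne k Γ (MonoidAlgebra.single g c) • MonoidAlgebra.single g 1 := by
      simp [slice, coeffOne_single]
    rw [h, coeffOne_single]
    split_ifs with hg
    · rw [hg, MonoidAlgebra.one_def]
    · simp

/-- The sum of the elements of `Γ` in the group algebra. -/
noncomputable def groupSum (k Γ : Type*) [Field k] [CommGroup Γ] [Fintype Γ] :
    MonoidAlgebra k Γ := ∑ g, MonoidAlgebra.single g 1

variable [Fintype Γ]

lemma antipode_groupSum : HopfAlgebra.antipode k (groupSum k Γ) = groupSum k Γ := by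
  simp only [groupSum, map_sum, MonoidAlgebra.antipode_single]
  exact Fintype.sum_equiv (Equiv.inv Γ) _ _ (fun g => by simp)

lemma mul_groupSum (l : MonoidAlgebra k Γ) :
    l * groupSum k Γ = Coalgebra.counit (R := k) l • groupSum k Γ := by
  induction l using MonoidAlgebra.induction_linear with
  | zero => simp
  | add x y hx hy => rw [add_mul, map_add, hx, hy, add_smul]
  | single g c =>
    simp only [groupSum, Finset.mul_sum, Finset.smul_sum]
    exact Fintype.sum_equiv (Equiv.mulLeft g) _ _ (fun h => by simp [MonoidAlgebra.single_mul_single])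

lemma coeffOne_groupSum : coeffOne k Γ (groupSum k Γ) = 1 := by
  classical
  simp [groupSum, coeffOne_single]

end GroupAlgebra

end YD

/-! ### Comparison of Ext along an exact functor, by dimension shifting. -/

section ExtComparison

open Abelian Limits

universe w w' v v' u₁ u₂

variable {k : Type*} [Field k] {C : Type u₁} [Category.{v} C] [Abelian C] [Linear k C]
  {D : Type u₂} [Category.{v'} D] [Abelian D] [Linear k D] [HasExt.{w} C] [HasExt.{w'} D]
  (F : C ⥤ D) [F.Additive] [PreservesFiniteLimits F] [PreservesFiniteColimits F] [F.Linear k]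
  {s : Type*} [Fintype s] {Y : s → C} {V : D} (ι : ∀ j, V ⟶ F.obj (Y j))

/-- For morphisms `ι j : V ⟶ F (Y j)`, the map `(e j)_j ↦ ∑ j, F (e j) ∘ ι j` on `Ext`. -/
noncomputable def extComparison (k : Type*) [Field k] [Linear k C] [Linear k D] [F.Linear k]
    (X : C) (n : ℕ) : (∀ j, Ext (Y j) X n) →ₗ[k] Ext V (F.obj X) n :=
  ∑ j, Ext.bilinearCompOfLinear k _ _ _ 0 n n (zero_add n) (Ext.mk₀ (ι j)) ∘ₗ
    F.mapExtLinearMap k (Y j) X n ∘ₗ LinearMap.proj j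

lemma extComparison_apply (X : C) (n : ℕ) (e : ∀ j, Ext (Y j) X n) :
    extComparison F ι k X n e =
      ∑ j, (Ext.mk₀ (ι j)).comp ((e j).mapExactFunctor F) (zero_add n) := by
  simp [extComparison]
  rfl

/-- An exact functor respects Yoneda products. Used with f of degree 0 for naturality, and with f an
extension class for compatibility with connecting maps. -/
lemma extComparison_comp {X X' : C} {a b c : ℕ} (h : a + b = c) (e : ∀ j, Ext (Y j) X a)
    (f : Ext X X' b) : extComparison F ι k X' c (fun j => (e j).comp f h) =
      (extComparison F ι k X a e).comp (f.mapExactFunctor F) h := by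
  rw [extComparison_apply, extComparison_apply, ← Ext.bilinearComp_apply_apply, map_sum,
    AddMonoidHom.finsetSum_apply]
  refine Finset.sum_congr rfl fun j _ => ?_
  rw [Ext.bilinearComp_apply_apply, Ext.mapExactFunctor_comp,
    Ext.comp_assoc _ _ _ (zero_add a) h (by omega)]

lemma extComparison_zero_bijective (X : C)
    (h : Function.Bijective fun f : ∀ j, Y j ⟶ X => ∑ j, ι j ≫ F.map (f j)) :
    Function.Bijective (extComparison F ι k X 0) := by
  let e₁ : (∀ j, Y j ⟶ X) ≃ (∀ j, Ext (Y j) X 0) :=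
    Equiv.piCongrRight fun j => Ext.homEquiv₀.symm
  have e : (extComparison F ι k X 0) ∘ e₁ =
      Ext.homEquiv₀.symm ∘ fun f : ∀ j, Y j ⟶ X => ∑ j, ι j ≫ F.map (f j) := by
    ext1 f
    simp only [Function.comp_apply, extComparison_apply]
    change ∑ j, (Ext.mk₀ (ι j)).comp ((Ext.mk₀ (f j)).mapExactFunctor F) _ =
      Ext.mk₀ (∑ j, ι j ≫ F.map (f j))
    rw [Ext.mk₀_sum]
    simp only [Ext.mapExactFunctor_mk₀, Ext.mk₀_comp_mk₀]
  rw [← Function.Bijective.of_comp_iff _ e₁.bijective, e]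
  exact Ext.homEquiv₀.symm.bijective.comp h

/-- Embed X in J as provided by `hF`, with cokernel Q. Since J and F(J) are injective, in degree n +
1 both sides for X are the cokernel of the map from degree n for J to degree n for Q. The comparison
commutes with the maps involved, so bijectivity for J and Q in degree n gives it for X in degree n +
1. -/
lemma extComparison_bijective
    (hF : ∀ X : C, ∃ (J : C) (f : X ⟶ J), Mono f ∧ Injective J ∧ Injective (F.obj J))
    (h₀ : ∀ X, Function.Bijective fun f : ∀ j, Y j ⟶ X => ∑ j, ι j ≫ F.map (f j))
    (X : C) (n : ℕ) : Function.Bijective (extComparison F ι k X n) := by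
  induction n generalizing X with
  | zero => exact extComparison_zero_bijective F ι X (h₀ X)
  | succ n hn =>
    obtain ⟨J, f, _, hJ, hFJ⟩ := hF X
    let S := ShortComplex.mk _ _ (cokernel.condition f)
    have hS : S.ShortExact := { exact := ShortComplex.exact_cokernel f }
    have : Injective (S.map F).X₂ := hFJ
    have hC : ∀ j (x : Ext (Y j) X (n + 1)), ∃ z : Ext (Y j) S.X₃ n,
        z.comp hS.extClass rfl = x := fun j x =>
      Ext.covariant_sequence_exact₁ _ hS x (Ext.eq_zero_of_injective _) rfl
    constructor
    · refine (injective_iff_map_eq_zero _).2 fun e he => ?_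
      choose z hz using fun j => hC j (e j)
      obtain rfl : (fun j => (z j).comp hS.extClass rfl) = e := funext hz
      rw [extComparison_comp, Ext.mapExactFunctor_extClass] at he
      -- The comparison class of z dies under the connecting map, so it comes from F(J).
      -- Surjectivity for J and injectivity for the cokernel, both in degree n, show that z itself
      -- comes from J, and so e = 0.
      obtain ⟨y, hy⟩ := Ext.covariant_sequence_exact₃ _ (hS.map_of_exact F) _ rfl he
      obtain ⟨w, rfl⟩ := (hn S.X₂).2 y
      have h2 : extComparison F ι k S.X₃ n (fun j => (w j).comp (Ext.mk₀ S.g) (add_zero n)) =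
          extComparison F ι k S.X₃ n z := by
        rw [extComparison_comp, Ext.mapExactFunctor_mk₀]
        exact hy
      have h3 := (hn S.X₃).1 h2
      funext j
      rw [← congrFun h3 j, Ext.comp_assoc_of_second_deg_zero, ShortComplex.ShortExact.comp_extClass,
        Ext.comp_zero]
      rfl
    · intro y
      obtain ⟨z, hz⟩ := Ext.covariant_sequence_exact₁ _ (hS.map_of_exact F) y
        (Ext.eq_zero_of_injective _) rfl
      obtain ⟨w, rfl⟩ := (hn S.X₃).2 z
      refine ⟨fun j => (w j).comp hS.extClass rfl, ?_⟩
      rw [extComparison_comp, Ext.mapExactFunctor_extClass]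
      exact hz

end ExtComparison

namespace YD

/-! ### Exactness of X ↦ X^(B). -/

section Functors

variable {k A B : Type u} [Field k] [Ring A] [HopfAlgebra k A] [Ring B] [HopfAlgebra k B]

lemma shortExact_of_maps (S : ShortComplex (YDModule k A)) (h1 : Function.Injective (toLin S.f))
    (h2 : Function.Surjective (toLin S.g))
    (h3 : ∀ y, toLin S.g y = 0 → y ∈ LinearMap.range (toLin S.f)) : S.ShortExact where
  exact := ShortComplex.exact_of_f_is_kernel _ (isKernel S.f S.g S.zero h1 h3)
  mono_f := mono_of_injective _ h1
  epi_g := epi_of_surjective _ h2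

lemma mem_range_of_shortExact {S : ShortComplex (YDModule k A)} (hS : S.ShortExact)
    (y : S.X₂.carrier) (hy : toLin S.g y = 0) : y ∈ LinearMap.range (toLin S.f) := by
  have := hS.mono_f
  let l : kerObj S.g ⟶ S.X₁ := hS.fIsKernel.lift (Limits.KernelFork.ofι (kerι S.g) (kerι_comp S.g))
  have hl : l ≫ S.f = kerι S.g :=
    hS.fIsKernel.fac (Limits.KernelFork.ofι (kerι S.g) (kerι_comp S.g))
      Limits.WalkingParallelPair.zero
  exact ⟨toLin l (⟨y, hy⟩ : LinearMap.ker (toLin S.g)),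
    LinearMap.congr_fun (congrArg toLin hl) (⟨y, hy⟩ : LinearMap.ker (toLin S.g))⟩

variable {i : B →ₐc[k] A} (hi : Function.Injective i)

/-- The functor `X ↦ X^(B)`. -/
noncomputable def restrictFunctor (i : B →ₐc[k] A) (hi : Function.Injective i) :
    YDModule k A ⥤ YDModule k B where
  obj X := restrictPart i hi X
  map f := ((isMapAlong_partι hi).hom_comp f).lift hi
  map_id _ := hom_ext_partι hi rfl
  map_comp _ _ := hom_ext_partι hi rfl

lemma partι_restrictFunctor_map {X Y : YDModule k A} (f : X ⟶ Y)
    (x : (restrictPart i hi X).carrier) :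
    partι i hi Y (toLin ((restrictFunctor i hi).map f) x) = toLin f (partι i hi X x) := rfl

instance : (restrictFunctor i hi).Additive where
  map_add := hom_ext_partι hi rfl

instance : (restrictFunctor i hi).Linear k where
  map_smul _ _ := hom_ext_partι hi rfl

/-- The map `x ↦ x₀ σ(x₁)`. -/
noncomputable def coslice (σ : A →ₗ[k] k) (X : YDModule k A) : X.carrier →ₗ[k] X.carrier :=
  (TensorProduct.rid k X.carrier).toLinearMap ∘ₗ σ.lTensor X.carrier ∘ₗ X.coact

lemma coslice_natural (σ : A →ₗ[k] k) {X Y : YDModule k A} (f : X ⟶ Y) (x : X.carrier) :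
    toLin f (coslice σ X x) = coslice σ Y (toLin f x) := by
  simp only [coslice, LinearMap.comp_apply, ← toLin_coact]
  generalize X.coact x = t
  induction t with
  | zero => simp
  | add x y hx hy => simp only [map_add, hx, hy]
  | tmul a c => simp

lemma coact_coslice (σ : A →ₗ[k] k) (X : YDModule k A) (x : X.carrier) :
    X.coact (coslice σ X x) = (slice σ).lTensor X.carrier (X.coact x) := by
  have h1 : ∀ t : X.carrier ⊗[k] A, X.coact (TensorProduct.rid k _ (σ.lTensor _ t)) =
      ((TensorProduct.rid k A).toLinearMap ∘ₗ σ.lTensor A).lTensor X.carrier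
        (TensorProduct.assoc k _ A A (X.coact.rTensor A t)) := by
    intro t
    induction t with
    | zero => simp
    | add x y hx hy => simp only [map_add, hx, hy]
    | tmul y b =>
      simp only [LinearMap.lTensor_tmul, LinearMap.rTensor_tmul, TensorProduct.rid_tmul, map_smul]
      generalize X.coact y = s
      induction s with
      | zero => simp
      | add x y hx hy => simp only [smul_add, map_add, add_tmul, hx, hy]
      | tmul c d => simp
  refine (h1 _).trans ?_
  rw [X.isYetterDrinfeld.coact_coassoc, ← LinearMap.lTensor_comp_apply]
  rfl

variable {π : A →ₗ[k] B} {σ : A →ₗ[k] k}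

/-- The coaction of x₀ σ(x₁) is x₀ ⊗ x₁ σ(x₂), and slices by σ lie in i(B). -/
lemma IsProjection.coslice_mem_part (h : IsProjection i π σ) (X : YDModule k A) (x : X.carrier) :
    coslice σ X x ∈ part i X := by
  have e : slice σ = (i : B →ₗ[k] A) ∘ₗ π := LinearMap.ext fun a => (h.apply_eq a).symm
  change X.coact _ ∈ LinearMap.range ((i : B →ₗ[k] A).lTensor X.carrier)
  rw [coact_coslice, e, LinearMap.lTensor_comp]
  exact ⟨_, rfl⟩

/-- On i(B) the functional σ is the counit. Thus `coslice` is a linear projection of X onto X^(B),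
natural in X by `coslice_natural`. -/
lemma IsProjection.coslice_partι (h : IsProjection i π σ) {X : YDModule k A}
    (x : (restrictPart i hi X).carrier) : coslice σ X (partι i hi X x) = partι i hi X x := by
  have e : σ ∘ₗ (i : B →ₗ[k] A) = Coalgebra.counit := LinearMap.ext h.counit
  conv_rhs => rw [← (restrictPart i hi X).isYetterDrinfeld.coact_counit x, ← e]
  simp only [coslice, LinearMap.comp_apply, ← (isMapAlong_partι hi).map_coact]
  generalize (restrictPart i hi X).coact x = t
  induction t with
  | zero => simp
  | add x y hx hy => simp only [map_add, hx, hy]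
  | tmul a c => simp

/-- The vector space X^(B) is a natural direct summand of X. A preimage found in the ambient module
is moved into the summand by `coslice`, which fixes the element it must map to. -/
lemma IsProjection.shortExact_map (h : IsProjection i π σ) (S : ShortComplex (YDModule k A))
    (hS : S.ShortExact) : (S.map (restrictFunctor i hi)).ShortExact := by
  have := hS.mono_f
  have := hS.epi_g
  have hf := injective_of_mono S.f
  refine shortExact_of_maps _ (fun x y e => ?_) (fun z => ?_) (fun y hy => ?_)
  · exact partι_injective hi (hf (congrArg (partι i hi S.X₂) e))
  · obtain ⟨y, hy⟩ := surjective_of_epi S.g (partι i hi S.X₃ z)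
    obtain ⟨x, hx⟩ := mem_range_partι hi _ (h.coslice_mem_part S.X₂ y)
    refine ⟨x, partι_injective hi ?_⟩
    refine (partι_restrictFunctor_map hi S.g x).trans ?_
    rw [hx, coslice_natural, hy]
    exact h.coslice_partι hi (X := S.X₃) z
  · obtain ⟨x, hx⟩ := mem_range_of_shortExact hS (partι i hi S.X₂ y)
      (congrArg (partι i hi S.X₃) hy)
    obtain ⟨z, hz⟩ := mem_range_partι hi _ (h.coslice_mem_part S.X₁ x)
    refine ⟨z, partι_injective hi ?_⟩
    refine (partι_restrictFunctor_map hi S.f z).trans ?_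
    rw [hz, coslice_natural, hx]
    exact h.coslice_partι hi (X := S.X₂) y

lemma IsProjection.preservesFiniteLimits_and_colimits (h : IsProjection i π σ) :
    Limits.PreservesFiniteLimits (restrictFunctor i hi) ∧
      Limits.PreservesFiniteColimits (restrictFunctor i hi) :=
  -- Entries 0 and 3 of the list: preservation of short exact sequences, and preservation of finite
  -- limits and finite colimits.
  ((restrictFunctor i hi).exact_tfae.out 0 3 rfl rfl).1 (h.shortExact_map hi)

end Functors

/-! ### Tensoring with a one-dimensional module is an autoequivalence. -/

section Twist

variable {k A : Type u} [Field k] [Ring A] [HopfAlgebra k A]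

lemma slice_slice (σ χ : A →ₗ[k] k) (a : A) : slice σ (slice χ a) = slice (σ ∘ₗ slice χ) a := by
  rw [slice, LinearMap.comp_apply, LinearMap.comp_apply, comul_slice,
    ← LinearMap.lTensor_comp_apply]
  rfl

lemma slice_counit (a : A) : slice (Coalgebra.counit (R := k) (A := A)) a = a := by
  simp [slice]

lemma rid_map₂_slice {V : Type*} [AddCommGroup V] [Module k V] (act : V →ₗ[k] A →ₗ[k] V)
    (ψ : A →ₐ[k] k) (t : V ⊗[k] k) (r : A ⊗[k] A) :
    TensorProduct.rid k V (TensorProduct.map₂ act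
      ((LinearMap.mul k k).compl₂ ψ.toLinearMap) t r) =
    act (TensorProduct.rid k V t) (TensorProduct.rid k A (ψ.toLinearMap.lTensor A r)) := by
  induction t with
  | zero => simp
  | add x y hx hy => simp only [map_add, LinearMap.add_apply, hx, hy]
  | tmul x c =>
    induction r with
    | zero => simp
    | add x y hx hy => simp only [map_add, hx, hy]
    | tmul a b => simp [smul_smul, mul_comm]

lemma rid_tensorMul_one {V : Type*} [AddCommGroup V] [Module k V]
    (coact : V →ₗ[k] V ⊗[k] A) (t : V ⊗[k] k) :
    (TensorProduct.rid k V).toLinearMap.rTensor A (tensorMul k A V k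
      (TensorProduct.map coact ((TensorProduct.mk k k A).flip 1) t)) =
    coact (TensorProduct.rid k V t) := by
  induction t with
  | zero => simp
  | add x y hx hy => simp only [map_add, hx, hy]
  | tmul x c =>
    rw [TensorProduct.map_tmul, TensorProduct.rid_tmul, map_smul]
    generalize coact x = s
    induction s with
    | zero => simp
    | add x y hx hy => simp only [smul_add, map_add, add_tmul, hx, hy]
    | tmul y a => simp [smul_tmul']

/-- The map `x ⊗ c ↦ c x` on `X ⊗ k_ψ`. -/
noncomputable def untwist (X : YDModule k A) (ψ : A →ₐ[k] k) (hψ : IsCentralChar ψ) :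
    (tensor X (oneDim ψ hψ)).carrier ≃ₗ[k] X.carrier :=
  TensorProduct.rid k X.carrier

section
variable {X Y : YDModule k A} (ψ : A →ₐ[k] k) (hψ : IsCentralChar ψ)

/-- With `untwist_coact`, this describes X ⊗ k_ψ as X with the same coaction and with the action
precomposed with a ↦ a₁ ψ(a₂). -/
lemma untwist_act (t : (tensor X (oneDim ψ hψ)).carrier) (a : A) :
    untwist X ψ hψ ((tensor X (oneDim ψ hψ)).act t a) =
      X.act (untwist X ψ hψ t) (slice ψ.toLinearMap a) :=
  rid_map₂_slice X.act ψ t (Coalgebra.comul a)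

lemma untwist_coact (t : (tensor X (oneDim ψ hψ)).carrier) :
    (untwist X ψ hψ).toLinearMap.rTensor A ((tensor X (oneDim ψ hψ)).coact t) =
      X.coact (untwist X ψ hψ t) :=
  rid_tensorMul_one X.coact t

lemma untwist_symm_act (x : X.carrier) (a : A) :
    (untwist X ψ hψ).symm (X.act x (slice ψ.toLinearMap a)) =
      (tensor X (oneDim ψ hψ)).act ((untwist X ψ hψ).symm x) a := by
  rw [LinearEquiv.symm_apply_eq, untwist_act, LinearEquiv.apply_symm_apply]

lemma untwist_symm_coact (x : X.carrier) :
    (untwist X ψ hψ).symm.toLinearMap.rTensor A (X.coact x) =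
      (tensor X (oneDim ψ hψ)).coact ((untwist X ψ hψ).symm x) := by
  obtain ⟨t, rfl⟩ := (untwist X ψ hψ).surjective x
  rw [← untwist_coact, ← LinearMap.rTensor_comp_apply, LinearEquiv.symm_apply_apply]
  simp

/-- The map `X ⊗ k_ψ → Y ⊗ k_ψ` of a linear map `X → Y`. -/
noncomputable def twistMap (f : X.carrier →ₗ[k] Y.carrier) :
    (tensor X (oneDim ψ hψ)).carrier →ₗ[k] (tensor Y (oneDim ψ hψ)).carrier :=
  (untwist Y ψ hψ).symm.toLinearMap ∘ₗ f ∘ₗ (untwist X ψ hψ).toLinearMap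

end

/-- The functor `X ↦ X ⊗ k_ψ`. -/
noncomputable def twistFunctor (ψ : A →ₐ[k] k) (hψ : IsCentralChar ψ) :
    YDModule k A ⥤ YDModule k A where
  obj X := tensor X (oneDim ψ hψ)
  map {X Y} f := ofLin (twistMap ψ hψ (toLin f))
    (fun t a => by
      simp only [twistMap, LinearMap.comp_apply, LinearEquiv.coe_coe]
      rw [untwist_act, toLin_act, untwist_symm_act])
    (fun t => by
      simp only [twistMap, LinearMap.comp_apply, LinearEquiv.coe_coe]
      rw [LinearMap.rTensor_comp_apply, LinearMap.rTensor_comp_apply, untwist_coact, toLin_coact,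
        untwist_symm_coact])
  map_id X := by
    ext t
    exact (untwist X ψ hψ).symm_apply_apply t
  map_comp f g := by
    ext t
    simp [twistMap]

section
variable {X Y : YDModule k A} (ψ : A →ₐ[k] k) (hψ : IsCentralChar ψ)

instance : (twistFunctor ψ hψ).Additive where
  map_add {X Y f g} := hom_ext (LinearMap.ext fun t =>
    map_add (untwist Y ψ hψ).symm (toLin f (untwist X ψ hψ t)) (toLin g (untwist X ψ hψ t)))

instance : (twistFunctor ψ hψ).Linear k where
  map_smul {X Y} f c := hom_ext (LinearMap.ext fun t =>
    map_smul (untwist Y ψ hψ).symm c (toLin f (untwist X ψ hψ t)))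

instance : (twistFunctor ψ hψ).Faithful where
  map_injective {X Y f g} h := by
    ext x
    obtain ⟨t, rfl⟩ := (untwist X ψ hψ).surjective x
    exact (untwist Y ψ hψ).symm.injective (LinearMap.congr_fun (congrArg toLin h) t)

variable {ψ} {χ : A →ₐ[k] k}

/-- The hypothesis makes a ↦ a₁ ψ(a₂) surjective, so a map that is linear for the twisted actions is
linear for the original ones. -/
lemma twistFunctor_full (h : ∀ a, slice ψ.toLinearMap (slice χ.toLinearMap a) = a) :
    (twistFunctor ψ hψ).Full where
  map_surjective {X Y} g := by
    let g' : tensor X (oneDim ψ hψ) ⟶ tensor Y (oneDim ψ hψ) := g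
    refine ⟨ofLin ((untwist Y ψ hψ).toLinearMap ∘ₗ toLin g' ∘ₗ (untwist X ψ hψ).symm.toLinearMap)
      (fun x a => ?_) (fun x => ?_), hom_ext (LinearMap.ext fun t => ?_)⟩
    · simp only [LinearMap.comp_apply, LinearEquiv.coe_coe]
      conv_lhs => rw [← h a]
      rw [untwist_symm_act, toLin_act, untwist_act, h]
    · simp only [LinearMap.comp_apply, LinearEquiv.coe_coe]
      rw [LinearMap.rTensor_comp_apply, LinearMap.rTensor_comp_apply, untwist_symm_coact,
        toLin_coact, untwist_coact]
    · refine ((untwist Y ψ hψ).symm_apply_apply _).trans ?_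
      exact congrArg (toLin g') ((untwist X ψ hψ).symm_apply_apply t)

lemma isIso_of_bijective (f : X ⟶ Y) (hf : Function.Bijective (toLin f)) : IsIso f :=
  have := mono_of_injective f hf.1
  have := epi_of_surjective f hf.2
  isIso_of_mono_of_epi f

/-- The object X ⊗ k_χ is a preimage of X: twisting by both characters precomposes the action with
the composite of the two slices, which is the identity. -/
lemma twistFunctor_essSurj (hχ : IsCentralChar χ)
    (h : ∀ a, slice χ.toLinearMap (slice ψ.toLinearMap a) = a) :
    (twistFunctor ψ hψ).EssSurj where
  mem_essImage X := by
    let e := (untwist (tensor X (oneDim χ hχ)) ψ hψ).trans (untwist X χ hχ)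
    let f : (twistFunctor ψ hψ).obj (tensor X (oneDim χ hχ)) ⟶ X := ofLin e.toLinearMap
      (fun t a => by
        refine (congrArg (untwist X χ hχ) (untwist_act ψ hψ t a)).trans ?_
        rw [untwist_act, h]
        rfl)
      (fun t => by
        refine (LinearMap.rTensor_comp_apply (M := A) (g := (untwist X χ hχ).toLinearMap)
          (f := (untwist (tensor X (oneDim χ hχ)) ψ hψ).toLinearMap) _).trans ?_
        refine (congrArg _ (untwist_coact ψ hψ t)).trans ?_
        exact untwist_coact χ hχ _)
    have := isIso_of_bijective f e.bijective
    exact ⟨_, ⟨asIso f⟩⟩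

lemma twistFunctor_isEquivalence (hχ : IsCentralChar χ)
    (h : ∀ a, slice χ.toLinearMap (slice ψ.toLinearMap a) = a)
    (h' : ∀ a, slice ψ.toLinearMap (slice χ.toLinearMap a) = a) :
    (twistFunctor ψ hψ).IsEquivalence where
  full := twistFunctor_full hψ h'
  essSurj := twistFunctor_essSurj hψ hχ h

/-- The isomorphism `k_χ ⊗ k_ψ → k_θ` for `θ(a) = χ(a₁) ψ(a₂)`. -/
noncomputable def oneDimTensorIso (hχ : IsCentralChar χ) {θ : A →ₐ[k] k} (hθ : IsCentralChar θ)
    (h : ∀ a, χ (slice ψ.toLinearMap a) = θ a) :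
    tensor (oneDim χ hχ) (oneDim ψ hψ) ≅ oneDim θ hθ :=
  let f : tensor (oneDim χ hχ) (oneDim ψ hψ) ⟶ oneDim θ hθ :=
    ofLin (untwist (oneDim χ hχ) ψ hψ).toLinearMap
      (fun t a => by
        refine (untwist_act ψ hψ t a).trans ?_
        exact congrArg (HMul.hMul (α := k) (β := k) (untwist (oneDim χ hχ) ψ hψ t)) (h a))
      (untwist_coact ψ hψ)
  have := isIso_of_bijective f (untwist (oneDim χ hχ) ψ hψ).bijective
  asIso f

end

end Twist

/-! ### Characters of Γ and the idempotents of the group algebra. -/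

section Characters

variable {k : Type*} [Field k] {Γ : Type*} [CommGroup Γ]

/-- The algebra map `kΓ → k` that extends a character. -/
noncomputable def charLift (ψ : Γ →* kˣ) : MonoidAlgebra k Γ →ₐ[k] k :=
  MonoidAlgebra.lift k k Γ ((Units.coeHom k).comp ψ)

@[simp] lemma charLift_single (ψ : Γ →* kˣ) (g : Γ) (c : k) :
    charLift ψ (MonoidAlgebra.single g c) = c * ψ g := by
  simp [charLift]

lemma charLift_slice (ψ χ : Γ →* kˣ) (l : MonoidAlgebra k Γ) :
    charLift ψ (slice (charLift χ).toLinearMap l) = charLift (ψ * χ) l := by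
  induction l using MonoidAlgebra.induction_linear with
  | zero => simp
  | add x y hx hy => simp only [map_add, hx, hy]
  | single g c => simp [slice]; ring

lemma charLift_one (l : MonoidAlgebra k Γ) :
    charLift (1 : Γ →* kˣ) l = Coalgebra.counit (R := k) l := by
  induction l using MonoidAlgebra.induction_linear with
  | zero => simp
  | add x y hx hy => simp only [map_add, hx, hy]
  | single g c => simp

variable [Fintype Γ]

/-- The idempotent `|Γ|⁻¹ ∑ ψ(g⁻¹) g` of a character `ψ`. -/
noncomputable def charIdem (ψ : Γ →* kˣ) : MonoidAlgebra k Γ :=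
  (Fintype.card Γ : k)⁻¹ • ∑ g, MonoidAlgebra.single g ((ψ g⁻¹ : kˣ) : k)

/-- For l a group element h, substituting g ↦ h g in the sum brings out the factor ψ(h). -/
lemma mul_charIdem (ψ : Γ →* kˣ) (l : MonoidAlgebra k Γ) :
    l * charIdem ψ = charLift ψ l • charIdem ψ := by
  induction l using MonoidAlgebra.induction_linear with
  | zero => simp
  | add x y hx hy => rw [add_mul, map_add, hx, hy, add_smul]
  | single h c =>
    have e : ∑ g, MonoidAlgebra.single h c * MonoidAlgebra.single g ((ψ g⁻¹ : kˣ) : k) =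
        ∑ g, charLift ψ (MonoidAlgebra.single h c) •
          MonoidAlgebra.single g ((ψ g⁻¹ : kˣ) : k) := by
      refine Fintype.sum_equiv (Equiv.mulLeft h) _ _ fun g => ?_
      simp [MonoidAlgebra.single_mul_single, MonoidAlgebra.smul_single]
      have := (ψ h).ne_zero
      field_simp
    rw [charIdem, mul_smul_comm, Finset.mul_sum, e, ← Finset.smul_sum, smul_smul, smul_smul,
      mul_comm]

-- Orthogonality of characters: a nontrivial homomorphism χ⁻¹ψ sums to zero over Γ.
open Classical in
lemma charLift_charIdem (h : (Fintype.card Γ : k) ≠ 0) (ψ χ : Γ →* kˣ) :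
    charLift ψ (charIdem χ) = if ψ = χ then 1 else 0 := by
  have e : charLift ψ (charIdem χ) = (Fintype.card Γ : k)⁻¹ *
      ∑ g, ((Units.coeHom k).comp (χ⁻¹ * ψ)) g := by
    simp [charIdem]
  rw [e]
  split_ifs with hψ
  · simp [hψ, h]
  · rw [sum_hom_units_eq_zero, mul_zero]
    intro h1
    refine hψ ?_
    have h2 : χ⁻¹ * ψ = 1 := by
      ext g
      exact DFunLike.congr_fun h1 g
    exact (inv_mul_eq_one.1 h2).symm

/-- The exponent of Γ divides |Γ| and so is nonzero in k; an algebraically closed field then has all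
the roots of unity needed for the duality of finite abelian groups. -/
lemma finite_char [IsAlgClosed k] (h : (Fintype.card Γ : k) ≠ 0) :
    Nonempty ((Γ →* kˣ) ≃* Γ) ∧ ∀ g : Γ, g ≠ 1 → ∃ ψ : Γ →* kˣ, ψ g ≠ 1 := by
  have hexp : NeZero ((Monoid.exponent Γ : ℕ) : k) := ⟨fun h0 => h (by
    obtain ⟨m, hm⟩ := Group.exponent_dvd_card (G := Γ)
    rw [hm, Nat.cast_mul, h0, zero_mul])⟩
  exact ⟨CommGroup.monoidHom_mulEquiv_of_hasEnoughRootsOfUnity Γ k,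
    fun g hg => CommGroup.exists_apply_ne_one_of_hasEnoughRootsOfUnity Γ k hg⟩

/-- The dual orthogonality relation: for g ≠ 1, evaluation at g⁻¹ is a nontrivial homomorphism on
the character group and sums to zero, while for g = 1 the sum counts the characters, of which there
are |Γ|. -/
lemma sum_charIdem [IsAlgClosed k] (h : (Fintype.card Γ : k) ≠ 0) [Fintype (Γ →* kˣ)] :
    ∑ ψ : Γ →* kˣ, charIdem ψ = 1 := by
  classical
  obtain ⟨⟨e⟩, hne⟩ := finite_char (k := k) h
  have hsum : ∀ g : Γ, ∑ ψ : Γ →* kˣ, ((ψ g⁻¹ : kˣ) : k) =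
      if g = 1 then (Fintype.card Γ : k) else 0 := by
    intro g
    split_ifs with hg
    · simp [hg, Fintype.card_congr e.toEquiv]
    · let f : (Γ →* kˣ) →* k := (Units.coeHom k).comp (MonoidHom.eval g⁻¹)
      refine sum_hom_units_eq_zero f fun h1 => ?_
      obtain ⟨ψ, hψ⟩ := hne g⁻¹ (by simpa using hg)
      exact hψ (Units.ext (DFunLike.congr_fun h1 ψ))
  simp only [charIdem, ← Finset.smul_sum]
  rw [Finset.sum_comm]
  have e2 : ∀ g : Γ, ∑ ψ : Γ →* kˣ, MonoidAlgebra.single g ((ψ g⁻¹ : kˣ) : k) =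
      if g = 1 then MonoidAlgebra.single 1 (Fintype.card Γ : k) else 0 := by
    intro g
    refine (map_sum (MonoidAlgebra.singleAddHom g) _ _).symm.trans ?_
    rw [hsum g]
    split_ifs with hg
    · rw [hg]
      rfl
    · exact map_zero _
  rw [Finset.sum_congr rfl fun g _ => e2 g]
  simp [h, MonoidAlgebra.one_def]

end Characters

/-! ### The modules k_ψ and the morphisms from k to X^(B). -/

section CharModules

variable {k A B : Type u} [Field k] [Ring A] [HopfAlgebra k A] [Ring B] [HopfAlgebra k B]
  {Γ : Type*} [CommGroup Γ] {i : B →ₐc[k] A} {p : A →ₐc[k] MonoidAlgebra k Γ}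

lemma charHom_apply (ψ : Γ →* kˣ) (a : A) : charHom p ψ a = charLift ψ (p a) := rfl

lemma charHom_slice (ψ χ : Γ →* kˣ) (a : A) :
    charHom p ψ (slice (charHom p χ).toLinearMap a) = charHom p (ψ * χ) a := by
  rw [charHom_apply, charHom_apply, ← charLift_slice]
  exact congrArg (charLift ψ) (map_slice p (charLift χ).toLinearMap a)

lemma charHom_one (a : A) : charHom p (1 : Γ →* kˣ) a = Coalgebra.counit (R := k) a := by
  rw [charHom_apply, charLift_one]
  exact CoalgHomClass.counit_comp_apply p a

lemma slice_charHom_slice (ψ χ : Γ →* kˣ) (h : ψ * χ = 1) (a : A) :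
    slice (charHom p ψ).toLinearMap (slice (charHom p χ).toLinearMap a) = a := by
  have e : (charHom p ψ).toLinearMap ∘ₗ slice (charHom p χ).toLinearMap =
      Coalgebra.counit := by
    ext a
    exact (charHom_slice ψ χ a).trans (by rw [h, charHom_one])
  rw [slice_slice, e, slice_counit]

variable (hp : IsCocentral p)

lemma twistFunctor_char_isEquivalence (ψ : Γ →* kˣ) :
    (twistFunctor (charHom p ψ) (hp.isCentralChar ψ)).IsEquivalence :=
  twistFunctor_isEquivalence _ (hp.isCentralChar ψ⁻¹)
    (slice_charHom_slice ψ⁻¹ ψ (inv_mul_cancel ψ)) (slice_charHom_slice ψ ψ⁻¹ (mul_inv_cancel ψ))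

/-- The isomorphism `k_{ψ⁻¹} ⊗ k_ψ → k`. -/
noncomputable def charInvTensorIso (ψ : Γ →* kˣ) :
    tensor (charModule p hp ψ⁻¹) (charModule p hp ψ) ≅ triv k A :=
  oneDimTensorIso _ _ _ fun a => by
    rw [charHom_slice, show ψ⁻¹ * ψ = 1 from inv_mul_cancel ψ, charHom_one]
    rfl

/-- The isomorphism `k ⊗ k_ψ → k_ψ`. -/
noncomputable def trivTensorCharIso (ψ : Γ →* kˣ) :
    tensor (triv k A) (charModule p hp ψ) ≅ charModule p hp ψ :=
  oneDimTensorIso _ _ _ fun a => by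
    have e := charHom_slice (p := p) 1 ψ a
    rwa [charHom_one, show 1 * ψ = ψ from one_mul ψ] at e

lemma isMapAlong_one {χ : A →ₐ[k] k} (hχ : IsCentralChar χ)
    (h : ∀ b, χ (i b) = Coalgebra.counit (R := k) b) :
    IsMapAlong i (V := triv k B) (X := oneDim χ hχ) (LinearMap.id (M := k)) where
  map_act v b := congrArg (HMul.hMul (α := k) (β := k) v) (h b).symm
  map_coact v := congrArg (fun a : A => (TensorProduct.mk k k A) v a) (map_one i)

lemma IsExactSequence.charHom_incl (h : IsExactSequence i p) (ψ : Γ →* kˣ) (b : B) :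
    charHom p ψ (i b) = Coalgebra.counit (R := k) b := by
  rw [charHom_apply, h.map_incl, AlgHom.commutes]
  rfl

/-- The morphism `k → k_ψ^(B)`. -/
noncomputable def trivToChar (h : IsExactSequence i p) (ψ : Γ →* kˣ) :
    triv k B ⟶ (restrictFunctor i h.injective).obj (charModule p hp ψ) :=
  (isMapAlong_one (hp.isCentralChar ψ) (h.charHom_incl ψ)).lift h.injective

lemma isIso_trivLift (hi : Function.Injective i) {χ : A →ₐ[k] k} (hχ : IsCentralChar χ)
    (h : ∀ b, χ (i b) = Coalgebra.counit (R := k) b) :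
    IsIso ((isMapAlong_one hχ h).lift hi) :=
  isIso_of_bijective _ ⟨fun _ _ e => congrArg (partι i hi (oneDim χ hχ)) e,
    fun x => ⟨partι i hi (oneDim χ hχ) x, partι_injective hi rfl⟩⟩

/-- The isomorphism `k → k^(B)`. -/
noncomputable def trivIso (hi : Function.Injective i) :
    triv k B ≅ restrictPart i hi (triv k A) :=
  have h : ∀ b, Bialgebra.counitAlgHom k A (i b) = Coalgebra.counit (R := k) b :=
    fun b => CoalgHomClass.counit_comp_apply i b
  @asIso _ _ (triv k B) (restrictPart i hi (triv k A)) _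
    (isIso_trivLift hi isCentralChar_counit h)

-- One has x · a ↦ x · a₂ ⊗ S(a₁) a₃ under the coaction. As the action on x depends only on p,
-- cocentrality permits exchanging a₁ and a₂, and x · a₁ ⊗ S(a₂) a₃ = x · a ⊗ 1.
include hp in
lemma coact_act_of_coinvariant {X : YDModule k A} {x : X.carrier} (hx : X.coact x = x ⊗ₜ 1)
    {ρ : MonoidAlgebra k Γ →ₗ[k] X.carrier} (hρ : ∀ a, ρ (p a) = X.act x a) (a : A) :
    X.coact (X.act x a) = X.act x a ⊗ₜ 1 := by
  let V : (MonoidAlgebra k Γ ⊗[k] A) ⊗[k] A →ₗ[k] X.carrier ⊗[k] A :=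
    TensorProduct.map ρ (LinearMap.mul' k A ∘ₗ (HopfAlgebra.antipode k).rTensor A) ∘ₗ
      (TensorProduct.assoc k (MonoidAlgebra k Γ) A A).toLinearMap
  let P : A →ₗ[k] MonoidAlgebra k Γ := p
  have h1 : ∀ t : (A ⊗[k] A) ⊗[k] A,
      twist X.act (TensorProduct.assoc k A A A t) (x ⊗ₜ 1) =
      V ((P.rTensor A ∘ₗ (TensorProduct.comm k A A).toLinearMap).rTensor A t) := by
    intro t
    induction t with
    | zero => simp
    | add x y hx hy => simp only [map_add, LinearMap.add_apply, hx, hy]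
    | tmul s c =>
      induction s with
      | zero => simp
      | add x y hx hy => simp only [map_add, add_tmul, LinearMap.add_apply, hx, hy]
      | tmul a b => simp [V, P, hρ]
  have h2 : ∀ t : (A ⊗[k] A) ⊗[k] A, V ((P.rTensor A).rTensor A t) =
      TensorProduct.map (ρ ∘ₗ P) (LinearMap.mul' k A ∘ₗ (HopfAlgebra.antipode k).rTensor A)
        (TensorProduct.assoc k A A A t) := by
    intro t
    induction t with
    | zero => simp
    | add x y hx hy => simp only [map_add, hx, hy]
    | tmul s c =>
      induction s with
      | zero => simp
      | add x y hx hy => simp only [map_add, add_tmul, hx, hy]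
      | tmul a b => simp [V]
  -- This is where cocentrality enters.
  have h3 : (P.rTensor A ∘ₗ (TensorProduct.comm k A A).toLinearMap) ∘ₗ Coalgebra.comul =
      P.rTensor A ∘ₗ Coalgebra.comul := LinearMap.ext fun a => (hp a).symm
  have h4 : ∀ t : A ⊗[k] A, TensorProduct.map (ρ ∘ₗ P) (LinearMap.mul' k A ∘ₗ
      (HopfAlgebra.antipode k).rTensor A) ((Coalgebra.comul (R := k) (A := A)).lTensor A t) =
      ρ (P (TensorProduct.rid k A ((Coalgebra.counit (R := k) (A := A)).lTensor A t))) ⊗ₜ 1 := by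
    intro t
    induction t with
    | zero => simp
    | add x y hx hy => simp only [map_add, add_tmul, hx, hy]
    | tmul a b =>
      simp only [LinearMap.lTensor_tmul, TensorProduct.map_tmul, LinearMap.comp_apply,
        HopfAlgebra.mul_antipode_rTensor_comul_apply]
      simp [Algebra.algebraMap_eq_smul_one, smul_tmul]
  rw [X.isYetterDrinfeld.coact_act, hx, comul₃, LinearMap.comp_apply, ← Coalgebra.coassoc_apply,
    h1, ← LinearMap.rTensor_comp_apply, h3, LinearMap.rTensor_comp_apply, h2,
    Coalgebra.coassoc_apply, h4, Coalgebra.lTensor_counit_comul]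
  simp [P, hρ]

/-- The kernel of p is i(B)⁺A, and i(B)⁺ annihilates x, so a ↦ x · a vanishes on it. Composing with
a linear section of p gives ρ. -/
lemma IsExactSequence.exists_factor (h : IsExactSequence i p) {X : YDModule k A} {x : X.carrier}
    (hx : ∀ b, X.act x (i b) = Coalgebra.counit (R := k) b • x) :
    ∃ ρ : MonoidAlgebra k Γ →ₗ[k] X.carrier, ∀ a, ρ (p a) = X.act x a := by
  obtain ⟨s, hs⟩ := (p : A →ₗ[k] MonoidAlgebra k Γ).exists_rightInverse_of_surjective
    (LinearMap.range_eq_top.2 h.surjective)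
  have hker : LinearMap.ker (p : A →ₗ[k] MonoidAlgebra k Γ) ≤ LinearMap.ker (X.act x) := by
    rw [h.ker_eq_right, Submodule.mul_le]
    rintro _ ⟨⟨b, rfl⟩, hb⟩ a -
    have hb' : Coalgebra.counit (R := k) b = 0 :=
      (CoalgHomClass.counit_comp_apply i b).symm.trans hb
    rw [LinearMap.mem_ker, X.isYetterDrinfeld.act_mul]
    refine (congrArg (fun y => X.act y a) (hx b)).trans ?_
    simp [hb']
  refine ⟨X.act x ∘ₗ s, fun a => ?_⟩
  have h1 : s (p a) - a ∈ LinearMap.ker (p : A →ₗ[k] MonoidAlgebra k Γ) := by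
    rw [LinearMap.mem_ker, map_sub, sub_eq_zero]
    exact LinearMap.congr_fun hs (p a)
  have h2 := hker h1
  rwa [LinearMap.mem_ker, map_sub, sub_eq_zero] at h2

/-- The value at `1` of a morphism from a one-dimensional module. -/
noncomputable def valueOne {X : YDModule k A} {χ : A →ₐ[k] k} {hχ : IsCentralChar χ} :
    (oneDim χ hχ ⟶ X) →+ X.carrier where
  toFun f := toLin f (1 : k)
  map_zero' := rfl
  map_add' _ _ := rfl

section
variable {X : YDModule k A} {χ : A →ₐ[k] k} {hχ : IsCentralChar χ}

lemma valueOne_injective : Function.Injective (valueOne (X := X) (hχ := hχ)) := fun _ _ h =>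
  hom_ext (LinearMap.ext_ring (R := k) h)

lemma valueOne_act (f : oneDim χ hχ ⟶ X) (a : A) : X.act (valueOne f) a = χ a • valueOne f := by
  refine (toLin_act f (1 : k) a).symm.trans ?_
  have e : (oneDim χ hχ).act (1 : k) a = χ a • (1 : k) := (one_mul (χ a)).trans (mul_one _).symm
  rw [e]
  exact map_smul (toLin f) (χ a) (1 : k)

lemma valueOne_coact (f : oneDim χ hχ ⟶ X) : X.coact (valueOne f) = valueOne f ⊗ₜ 1 :=
  (toLin_coact f (1 : k)).symm

variable (hχ) in
/-- The morphism `c ↦ c x` from a one-dimensional module. -/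
noncomputable def ofValueOne (x : X.carrier) (h1 : ∀ a, X.act x a = χ a • x)
    (h2 : X.coact x = x ⊗ₜ 1) : oneDim χ hχ ⟶ X :=
  ofLin (X := oneDim χ hχ) (LinearMap.toSpanSingleton k X.carrier x)
    (fun (c : k) a => by
      have e : X.act (c • x) a = (c * χ a) • x := by
        rw [map_smul, LinearMap.smul_apply, h1, smul_smul]
      exact e.symm)
    (fun (c : k) => by
      have e : X.coact (c • x) = (c • x) ⊗ₜ 1 := by rw [map_smul, h2, smul_tmul']
      exact e.symm)

lemma valueOne_ofValueOne (x : X.carrier) (h1 : ∀ a, X.act x a = χ a • x)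
    (h2 : X.coact x = x ⊗ₜ 1) : valueOne (ofValueOne hχ x h1 h2) = x :=
  one_smul k x

end

/-- The value at `1` of a morphism from `k` to `X^(B)`, as an element of `X`. -/
noncomputable def evalOne (hi : Function.Injective i) (X : YDModule k A) :
    (triv k B ⟶ restrictPart i hi X) →+ X.carrier :=
  (partι i hi X).toAddMonoidHom.comp valueOne

lemma evalOne_injective (hi : Function.Injective i) (X : YDModule k A) :
    Function.Injective (evalOne hi X) :=
  (partι_injective hi).comp valueOne_injective

lemma evalOne_act (hi : Function.Injective i) {X : YDModule k A}
    (g : triv k B ⟶ restrictPart i hi X) (b : B) :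
    X.act (evalOne hi X g) (i b) = Coalgebra.counit (R := k) b • evalOne hi X g :=
  ((isMapAlong_partι hi).map_act _ b).symm.trans
    ((congrArg (partι i hi X) (valueOne_act g b)).trans (map_smul _ _ _))

lemma evalOne_coact (hi : Function.Injective i) {X : YDModule k A}
    (g : triv k B ⟶ restrictPart i hi X) :
    X.coact (evalOne hi X g) = evalOne hi X g ⊗ₜ 1 := by
  refine ((isMapAlong_partι hi).map_coact _).symm.trans ?_
  refine (congrArg _ (valueOne_coact g)).trans ?_
  exact congrArg (TensorProduct.mk k _ A (partι i hi X (valueOne g))) (map_one i)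

/-- Morphisms from `k` to `X^(B)` are sums of morphisms from the modules `k_ψ` to `X`. -/
lemma IsExactSequence.bijective_hom [IsAlgClosed k] [Fintype Γ] [Fintype (Γ →* kˣ)]
    (h : IsExactSequence i p) (hΓ : (Fintype.card Γ : k) ≠ 0) (X : YDModule k A) :
    Function.Bijective fun f : ∀ ψ, charModule p hp ψ ⟶ X =>
      ∑ ψ, trivToChar hp h ψ ≫ (restrictFunctor i h.injective).map (f ψ) := by
  classical
  have heval : ∀ f : ∀ ψ, charModule p hp ψ ⟶ X, evalOne h.injective X
      (∑ ψ, trivToChar hp h ψ ≫ (restrictFunctor i h.injective).map (f ψ)) =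
      ∑ ψ, valueOne (f ψ) := fun f => map_sum (evalOne h.injective X) _ _
  constructor
  · intro f g hfg
    have e := (heval f).symm.trans ((congrArg (evalOne h.injective X) hfg).trans (heval g))
    funext χ
    -- Acting by a lift of the idempotent of χ isolates the χ-summand, by orthogonality.
    obtain ⟨a, ha⟩ := h.surjective (charIdem χ)
    have e2 := congrArg (fun y => X.act y a) e
    simp only [map_sum, LinearMap.sum_apply] at e2
    have e3 : ∀ (f : ∀ ψ, charModule p hp ψ ⟶ X) (ψ), X.act (valueOne (f ψ)) a =
        if ψ = χ then valueOne (f ψ) else 0 := fun f ψ => by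
      refine (valueOne_act (f ψ) a).trans ?_
      rw [charHom_apply, ha, charLift_charIdem hΓ, ite_smul, one_smul, zero_smul]
    simp only [e3, Finset.sum_ite_eq', Finset.mem_univ, if_true] at e2
    exact valueOne_injective e2
  · intro g
    let x := evalOne h.injective X g
    obtain ⟨ρ, hρ⟩ := h.exists_factor (evalOne_act h.injective g)
    -- The component of x at ψ is x acted on by a lift of the idempotent. It is an eigenvector since
    -- kΓ is commutative and multiplies this idempotent through ψ.
    have hact : ∀ ψ a, X.act (ρ (charIdem ψ)) a = charHom p ψ a • ρ (charIdem ψ) := by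
      intro ψ a
      obtain ⟨c, hc⟩ := h.surjective (charIdem ψ)
      rw [← hc, hρ, ← X.isYetterDrinfeld.act_mul, ← hρ, map_mul, hc, mul_comm, mul_charIdem,
        map_smul, ← hc, hρ, charHom_apply]
    have hcoact : ∀ ψ, X.coact (ρ (charIdem ψ)) = ρ (charIdem ψ) ⊗ₜ 1 := by
      intro ψ
      obtain ⟨c, hc⟩ := h.surjective (charIdem ψ)
      rw [← hc, hρ, coact_act_of_coinvariant hp (evalOne_coact h.injective g) hρ]
    refine ⟨fun ψ => ofValueOne _ (ρ (charIdem ψ)) (hact ψ) (hcoact ψ),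
      evalOne_injective h.injective X ?_⟩
    -- The idempotents add up to 1, so the components add up to ρ(1) = x · 1 = x.
    refine (heval _).trans ?_
    rw [Finset.sum_congr rfl fun ψ _ => valueOne_ofValueOne _ (hact ψ) (hcoact ψ), ← map_sum,
      sum_charIdem hΓ, ← map_one p, hρ, X.isYetterDrinfeld.act_one]

end CharModules

end YD

/-! ### Invariance of Ext under isomorphisms. -/

section ExtIso

open Abelian

universe w v u₁

variable (k : Type*) [Field k] {C : Type u₁} [Category.{v} C] [Abelian C] [Linear k C]
  [HasExt.{w} C]

/-- An isomorphism in the second variable of `Ext`. -/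
noncomputable def extPostcomp (X : C) {Y Y' : C} (e : Y ≅ Y') (n : ℕ) :
    Ext X Y n ≃ₗ[k] Ext X Y' n :=
  LinearEquiv.ofBijective
    ((Ext.bilinearCompOfLinear k X Y Y' n 0 n (add_zero n)).flip (Ext.mk₀ e.hom))
    (Function.bijective_iff_has_inverse.2
      ⟨fun f => f.comp (Ext.mk₀ e.inv) (add_zero n), fun f => by
        change (f.comp (Ext.mk₀ e.hom) (add_zero n)).comp (Ext.mk₀ e.inv) (add_zero n) = f
        simp, fun f => by
        change (f.comp (Ext.mk₀ e.inv) (add_zero n)).comp (Ext.mk₀ e.hom) (add_zero n) = f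
        simp⟩)

/-- An isomorphism in the first variable of `Ext`. -/
noncomputable def extPrecomp {X X' : C} (e : X' ≅ X) (Y : C) (n : ℕ) :
    Ext X Y n ≃ₗ[k] Ext X' Y n :=
  LinearEquiv.ofBijective
    (Ext.bilinearCompOfLinear k X' X Y 0 n n (zero_add n) (Ext.mk₀ e.hom))
    (Function.bijective_iff_has_inverse.2
      ⟨fun f => (Ext.mk₀ e.inv).comp f (zero_add n), fun f => by
        change (Ext.mk₀ e.inv).comp ((Ext.mk₀ e.hom).comp f (zero_add n)) (zero_add n) = f
        simp, fun f => by
        change (Ext.mk₀ e.hom).comp ((Ext.mk₀ e.inv).comp f (zero_add n)) (zero_add n) = f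
        simp⟩)

end ExtIso

/-! ### Assembling the isomorphism. -/

namespace YD

open Abelian

variable {k A B : Type u} [Field k] [Ring A] [HopfAlgebra k A] [Ring B] [HopfAlgebra k B]
  {Γ : Type*} [CommGroup Γ] {i : B →ₐc[k] A} {p : A →ₐc[k] MonoidAlgebra k Γ}

/-- Tensoring with `k_ψ` identifies `Ext(k_ψ⁻¹, X)` with the cohomology of `X ⊗ k_ψ`. -/
noncomputable def twistExtEquiv (hp : IsCocentral p) (ψ : Γ →* kˣ) (X : YDModule k A) (n : ℕ) :
    Ext.{u + 1} (charModule p hp ψ⁻¹) X n ≃ₗ[k] HGS (tensor X (charModule p hp ψ)) n :=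
  -- The equivalence sends k_ψ⁻¹ to k_ψ⁻¹ ⊗ k_ψ, and precomposition with k ≅ k_ψ⁻¹ ⊗ k_ψ then makes
  -- k the source.
  have := twistFunctor_char_isEquivalence hp ψ
  (LinearEquiv.ofBijective
    ((twistFunctor (charHom p ψ) (hp.isCentralChar ψ)).mapExtLinearMap k
      (charModule p hp ψ⁻¹) X n)
    (Functor.mapExt_bijective_of_preservesInjectiveObjects _ _ _ n)).trans
  (extPrecomp k (charInvTensorIso hp ψ).symm _ n)

lemma IsExactSequence.exists_isProjection_coeffOne (h : IsExactSequence i p) :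
    ∃ π : A →ₗ[k] B, IsProjection i π (coeffOne k Γ ∘ₗ (p : A →ₗ[k] MonoidAlgebra k Γ)) :=
  h.exists_isProjection slice_coeffOne ((coeffOne_single 1 1).trans (by simp))

/-- The integral on kΓ is the coefficient of 1, and t lifts the sum of all group elements. This sum
is fixed by S, absorbs multiplication through ε, and has coefficient 1 at the identity without
dividing by |Γ|. -/
lemma IsExactSequence.exists_injective_restrict [Finite Γ] (h : IsExactSequence i p)
    (X : YDModule k A) : ∃ (J : YDModule k A) (f : X ⟶ J), Mono f ∧ Injective J ∧
      Injective ((restrictFunctor i h.injective).obj J) := by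
  have := Fintype.ofFinite Γ
  obtain ⟨π, hπ⟩ := h.exists_isProjection_coeffOne
  obtain ⟨t, ht⟩ := h.surjective (groupSum k Γ)
  refine ⟨coind k A X.carrier, toCoind X, inferInstance, inferInstance,
    (h.isDualBasis hπ (t := t) (fun l => ?_) ?_).injective_restrictPart_coind h.injective⟩
  · rw [ht, antipode_groupSum, mul_groupSum]
  · rw [ht, antipode_groupSum, coeffOne_groupSum]

/-- The cohomology of `X^(B)` as a direct sum over the characters. -/
lemma IsExactSequence.nonempty_equiv [IsAlgClosed k] [Finite Γ] (h : IsExactSequence i p)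
    (hp : IsCocentral p) (hΓ : (Nat.card Γ : k) ≠ 0) (X : YDModule k A) (n : ℕ) :
    Nonempty (HGS (restrictPart i h.injective X) n ≃ₗ[k]
      DirectSum (Γ →* kˣ) (fun ψ => HGS (tensor X (charModule p hp ψ)) n)) := by
  classical
  have := Fintype.ofFinite Γ
  rw [Nat.card_eq_fintype_card] at hΓ
  obtain ⟨⟨e⟩, -⟩ := finite_char (Γ := Γ) hΓ
  have := Fintype.ofEquiv Γ e.symm.toEquiv
  obtain ⟨π, hπ⟩ := h.exists_isProjection_coeffOne
  obtain ⟨_, _⟩ := hπ.preservesFiniteLimits_and_colimits h.injective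
  let e₁ := LinearEquiv.ofBijective _ (extComparison_bijective (k := k)
    (restrictFunctor i h.injective) (trivToChar hp h) h.exists_injective_restrict
    (h.bijective_hom hp hΓ) X n)
  -- Reindexing by ψ ↦ ψ⁻¹, because `twistExtEquiv` for ψ starts from k_ψ⁻¹.
  let e₂ : (∀ ψ, Ext.{u + 1} (charModule p hp ψ) X n) ≃ₗ[k]
      ∀ ψ, Ext.{u + 1} (charModule p hp ψ⁻¹) X n :=
    (LinearEquiv.piCongrLeft k (fun ψ => Ext.{u + 1} (charModule p hp ψ) X n)
      (Equiv.inv (Γ →* kˣ))).symm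
  exact ⟨e₁.symm.trans (e₂.trans
    ((LinearEquiv.piCongrRight fun ψ => twistExtEquiv hp ψ X n).trans
      (DirectSum.linearEquivFunOnFintype k _ _).symm))⟩

end YD

theorem mainTheorem3 {k A B : Type u} {Γ : Type*} [Field k] [IsAlgClosed k]
    [Ring A] [HopfAlgebra k A] [Ring B] [HopfAlgebra k B] [CommGroup Γ] [Finite Γ]
    (hΓ : (Nat.card Γ : k) ≠ 0)
    (i : B →ₐc[k] A) (p : A →ₐc[k] MonoidAlgebra k Γ)
    (hexact : YD.IsExactSequence i p) (hp : YD.IsCocentral p) :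
    (∀ (X : YD.YDModule k A) (n : ℕ),
      Nonempty (YD.HGS (YD.restrictPart i hexact.injective X) n ≃ₗ[k]
        DirectSum (Γ →* kˣ) (fun ψ => YD.HGS (YD.tensor X (YD.charModule p hp ψ)) n))) ∧
    ∀ n : ℕ,
      Nonempty (YD.Hb k B n ≃ₗ[k]
        DirectSum (Γ →* kˣ) (fun ψ => YD.HGS (YD.charModule p hp ψ) n)) := by
  classical
  refine ⟨fun X n => hexact.nonempty_equiv hp hΓ X n, fun n => ?_⟩
  obtain ⟨e⟩ := hexact.nonempty_equiv hp hΓ (YD.triv k A) n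
  -- The case X = k, rewritten through k ≅ k^(B) and k ⊗ k_ψ ≅ k_ψ.
  exact ⟨(extPostcomp k _ (YD.trivIso hexact.injective) n).trans (e.trans
    (DFinsupp.mapRange.linearEquiv fun ψ => extPostcomp k _ (YD.trivTensorCharIso hp ψ) n))⟩
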